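/- Let $s,t\ge 1$ and $0\le r\le s-1$ be integers. Let $X(s,t,r)$ be the (multi)graph with vertices $x^i_j$, $0\le i\le t-1$, $0\le j\le s-1$ (subscripts modulo $s$), and with the $2st$ edges - $[x^i_j,x^i_{j+1}]$ for $0\le i\le t-1$, $0\le j\le s-1$ (horizontal edges, coloured red), - $[x^i_j,x^{i+1}_j]$ for $0\le i\le t-2$, $0\le j\le s-1$ (vertical edges, coloured blue), - $[x^{t-1}_j,x^0_{j+r}]$ for $0\le j\le s-1$ (diagonal edges, coloured blue), where edges listed separately are regarded as different, so that parallel edges may occur. A spanning subgraph $W$ of $X(s,t,r)$ is called *admissible* if every vertex has valence $2$ or $4$ in $W$ and every vertex of valence $2$ in $W$ is incident with one red and one blue edge of $W$. A *good Eulerian tour* of $W$ is a closed walk that traverses each edge of $W$ exactly once and that, whenever it passes through a vertex of valence $4$ in $W$, enters and leaves it by edges of the same colour. A *good Eulerian subgraph* of $X(s,t,r)$ is an admissible subgraph that possesses a good Eulerian tour. **Lemma.** Let $s\ge 3$, $t\ge 2$ and $0\le r\le s-1$. Then $X(s,t,r)$ has a good Eulerian subgraph unless $s$ is odd and $(t,r)=(2,0)$;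 in that exceptional case it has none. That is, $X(s,t,r)$ has a good Eulerian subgraph if and only if it is not the case that $s$ is odd, $t=2$ and $r=0$. -/

import Mathlib

namespace QuarticTours

/-! ### Multigraphs with a red / blue edge colouring, and good Eulerian subgraphs

Multigraphs are Mathlib's `Graph α β`, where parallel edges are different elements of `β`.
The colouring of the edges is given by the set `red : Set β`; an edge outside `red` is blue. -/

section Multigraph

variable {α β : Type*}

/-- The valence of the vertex `v` in the multigraph `W`, each loop being counted twice. -/
noncomputable def valence (W : Graph α β) (v : α) : ℕ :=
  {e | W.IsNonloopAt e v}.ncard + 2 * (W.loopSet v).ncard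

/-- `W` is an admissible subgraph of `X`: it is a spanning subgraph, each of its vertices has
valence `2` or `4`, and at each `2`-valent vertex the unique transition is traversing, that is,
one of the two edges at the vertex is red and the other one is blue. -/
structure IsAdmissible (red : Set β) (X W : Graph α β) : Prop where
  spanning : W.IsSpanningSubgraph X
  valence_eq : ∀ v ∈ W.vertexSet, valence W v = 2 ∨ valence W v = 4
  traversing : ∀ v ∈ W.vertexSet, valence W v = 2 →
    ∃ e f, e ∈ red ∧ f ∉ red ∧ W.Inc e v ∧ W.Inc f v

/-- The closed walk `v 0, e 0, v 1, e 1, …, v (n - 1), e (n - 1), v 0` of length `n`, indexed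
cyclically by `ZMod n`, is a good Eulerian tour of `W`: it runs through every edge of `W` exactly
once, and at each `4`-valent vertex of `W` it only uses non-traversing (colour-preserving)
transitions. -/
structure IsGoodEulerianTour (red : Set β) (W : Graph α β) (n : ℕ)
    (v : ZMod n → α) (e : ZMod n → β) : Prop where
  length_pos : 0 < n
  isLink : ∀ k, W.IsLink (e k) (v k) (v (k + 1))
  injective : Function.Injective e
  range_eq : Set.range e = W.edgeSet
  allowed : ∀ k, valence W (v (k + 1)) = 4 → (e k ∈ red ↔ e (k + 1) ∈ red)

/-- `W` is a good Eulerian subgraph of `X`: an admissible subgraph that has a good Eulerian tour.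
(All valences are positive, so that the tour visits every vertex and `W` is connected.) -/
def IsGoodEulerianSubgraph (red : Set β) (X W : Graph α β) : Prop :=
  IsAdmissible red X W ∧ ∃ n v e, IsGoodEulerianTour red W n v e

end Multigraph

/-! ### The graphs `X(s, t, r)` -/

/-- The vertex `(i, j)` is the vertex of row `i` and column `j`; columns are read modulo `s`. -/
abbrev XVertex (s t : ℕ) : Type := Fin t × ZMod s

/-- The edges of `X(s, t, r)`. `horiz i j` is the edge from `(i, j)` to `(i, j + 1)`.
`rise i j` is the edge that leaves `(i, j)` towards the next row: the vertical edge
to `(i + 1, j)` if `i < t - 1`, and the diagonal edge to `(0, j + r)` if `i = t - 1`. -/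
inductive XEdge (s t : ℕ) : Type
  | horiz (i : Fin t) (j : ZMod s)
  | rise (i : Fin t) (j : ZMod s)

/-- The upper end of the vertical or diagonal edge that leaves a vertex. -/
def nextRow (s t r : ℕ) (x : XVertex s t) : XVertex s t :=
  if h : x.1.val + 1 < t then (⟨x.1.val + 1, h⟩, x.2)
  else (⟨0, Nat.lt_of_le_of_lt (Nat.zero_le _) x.1.isLt⟩, x.2 + (r : ZMod s))

/-- The two ends of an edge of `X(s, t, r)`. -/
def XEdge.ends (s t r : ℕ) : XEdge s t → Sym2 (XVertex s t)
  | .horiz i j => s((i, j), (i, j + 1))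
  | .rise i j => s((i, j), nextRow s t r (i, j))

/-- The multigraph `X(s, t, r)`, for `s, t ≥ 1` and `0 ≤ r ≤ s - 1`. -/
def X (s t r : ℕ) : Graph (XVertex s t) (XEdge s t) where
  vertexSet := Set.univ
  edgeSet := Set.univ
  IsLink e x y := e.ends s t r = s(x, y)
  isLink_symm _ _ := ⟨fun _ _ h => h.trans Sym2.eq_swap⟩
  eq_or_eq_of_isLink_of_isLink e x y v w h h' := by
    have h2 : s(x, y) = s(v, w) := h.symm.trans h'
    rcases Sym2.eq_iff.1 h2 with h3 | h3
    · exact Or.inl h3.1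
    · exact Or.inr h3.1
  edge_mem_iff_exists_isLink e := by
    refine ⟨fun _ => ?_, fun _ => Set.mem_univ e⟩
    cases e with
    | horiz i j => exact ⟨_, _, rfl⟩
    | rise i j => exact ⟨_, _, rfl⟩
  left_mem_of_isLink _ _ _ _ := Set.mem_univ _

/-- The horizontal edges of `X(s, t, r)`, which form its red `2`-factor; the vertical and diagonal
edges form the blue one. -/
def horizontal (s t : ℕ) : Set (XEdge s t) := {e | ∃ i j, e = XEdge.horiz i j}

end QuarticTours

/-!
A good Eulerian subgraph is described by the set of edges that it lacks: every vertex loses either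
no edge, or one red and one blue edge (`AdmissibleDeletion`). A tour has no choice at any vertex: it
keeps the colour at a vertex of valence `4` and changes it at a vertex of valence `2`. So all closed
walks with allowed transitions are found by splitting every vertex into a red and a blue copy, which
are joined if the vertex has valence `2`; the closed walks are the components of this split graph,
and the subgraph has a good Eulerian tour if and only if the split graph is connected. Only one
direction is needed for the existence (`exists_isGoodEulerianSubgraph`): the tour is the orbit of an
oriented edge under the map to its successor, and it uses no edge in both directions since reversal
conjugates this map to its inverse. If `s` is odd, `t = 2` and `r = 0`, a column of two vertices of
valence `4` would trap the tour, and if there is no such column, then every second red edge of a row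
is missing, which is impossible for odd `s` (`not_isGoodEulerianSubgraph_two_zero`).

The notion `HasTour` only depends on the two permutations that move along red and blue edges, and is
invariant under mirror images (`hasTour_mirror`) and under interchanging the colours, where the
columns become rows (`hasTour_transpose`). The remaining grids are treated by two constructions.

* Deleting the edges of a closed path that moves by one column in each row, and by `c` columns in
  total (`hasTour_of_path`). Each row remains connected, and the other columns, `s - 1` of them up to
  identification, are permuted by a rotation by `c`, so that `c` prime to `s - 1` is sufficient.

* Deleting the sides of disjoint squares. The tour then breaks into strands that run up a column, and
  the components can be followed along them. The pattern may be extended by two rows with a single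
  square in them, in two neighbouring columns: it joins the two lower ends of these columns, and the
  two upper ends. If a pattern without deleted diagonal edges has a *crossing seam*, that is, two
  neighbouring columns for which cutting the diagonal edges leaves two components, each of them from
  the upper end of one column to the lower end of the other one, then any number of such extensions
  is possible (`CrossingSeam.hasTour`): the squares are put alternately into the columns `a, b` and
  the columns `b, e` among three consecutive columns. So it suffices to find crossing seams for two,
  three or four rows.

For odd `s` and even `ρ`, squares in the columns `0, …, ρ - 1` of one level give a crossing seam if the
shift is `ρ` (`crossingSeam_rowSquares`), and one more square does the same with three rows
(`crossingSeam_twoRowSquares`); the reason is the path along the strands in `folded_strands`. For even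
`s` and odd `r` and `t`, the same squares in `s - r` columns are used, as the other columns just
repeat the shift. If `s` and `r` are even and `t` is odd, the colours are interchanged, so that the
number of rows becomes `gcd(s, r)`, which is even.
-/

namespace QuarticTours

open Relation

/-! ### Tours as connectedness of the split graph -/

section Splitting

variable {V : Type*}

/-- Some edge of colour `c` at `v` is deleted; here `P true` and `P false` are
the permutations that move a vertex along its red and blue edge, and `del c v` says that the edge
of colour `c` from `v` to `P c v` is deleted. -/
def Loses (P : Bool → Equiv.Perm V) (del : Bool → V → Prop) (c : Bool) (v : V) : Prop :=
  del c v ∨ del c ((P c).symm v)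

/-- Every vertex loses either no edge, or exactly one red edge and one blue edge. -/
def AdmissibleDeletion (P : Bool → Equiv.Perm V) (del : Bool → V → Prop) : Prop :=
  ∀ v, (∀ c, ¬(del c v ∧ del c ((P c).symm v))) ∧ (Loses P del true v ↔ Loses P del false v)

/-- Adjacency in the graph on `V × Bool` that arises from the subgraph left by a deletion when
each vertex is split into a red and a blue copy: the remaining edges join copies of their own
colour, and the two copies of a vertex that loses edges are joined. The components of this graph
are the closed walks of the subgraph that have only allowed transitions. -/
inductive SplitLink (P : Bool → Equiv.Perm V) (del : Bool → V → Prop) :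
    V × Bool → V × Bool → Prop
  | edge (c : Bool) (v : V) : ¬del c v → SplitLink P del (v, c) (P c v, c)
  | spoke (v : V) : Loses P del true v → SplitLink P del (v, true) (v, false)

/-- There is an admissible deletion whose split graph is connected. -/
def HasTour (P : Bool → Equiv.Perm V) : Prop :=
  ∃ del : Bool → V → Prop, AdmissibleDeletion P del ∧ ∀ x y, EqvGen (SplitLink P del) x y

/-- Darts, that is, oriented edges: `(v, c, true)` is the edge of colour `c` from `v` to `P c v`,
and `(v, c, false)` the edge from `v` to `(P c).symm v`. -/
abbrev Dart (V : Type*) : Type _ := V × Bool × Bool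

/-- The end of a dart. -/
def dartHead (P : Bool → Equiv.Perm V) (d : Dart V) : V :=
  bif d.2.2 then P d.2.1 d.1 else (P d.2.1).symm d.1

/-- The vertex `v` for which the underlying edge of a dart goes from `v` to `P c v`. -/
def dartBase (P : Bool → Equiv.Perm V) (d : Dart V) : V :=
  bif d.2.2 then d.1 else (P d.2.1).symm d.1

/-- The reversed dart. -/
def dartRev (P : Bool → Equiv.Perm V) (d : Dart V) : Dart V :=
  (dartHead P d, d.2.1, !d.2.2)

/-- The underlying edge of the dart is not deleted. -/
def Kept (P : Bool → Equiv.Perm V) (del : Bool → V → Prop) (d : Dart V) : Prop :=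
  ¬del d.2.1 (dartBase P d)

open Classical in
/-- The dart that follows `d` in a walk with allowed transitions only. -/
noncomputable def dartNext (P : Bool → Equiv.Perm V) (del : Bool → V → Prop) (d : Dart V) :
    Dart V :=
  if Loses P del true (dartHead P d) then
    (dartHead P d, !d.2.1, !decide (del (!d.2.1) (dartHead P d)))
  else (dartHead P d, d.2.1, d.2.2)

variable {P : Bool → Equiv.Perm V} {del : Bool → V → Prop}

theorem loses_iff (h : AdmissibleDeletion P del) (c : Bool) (v : V) :
    Loses P del c v ↔ Loses P del true v := by
  cases c
  · exact (h v).2.symm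
  · exact Iff.rfl

theorem dartRev_dartRev (d : Dart V) : dartRev P (dartRev P d) = d := by
  rcases d with ⟨v, c, σ⟩
  cases σ <;> simp [dartRev, dartHead]

theorem dartBase_dartRev (d : Dart V) : dartBase P (dartRev P d) = dartBase P d := by
  rcases d with ⟨v, c, σ⟩
  cases σ <;> simp [dartRev, dartHead, dartBase]

theorem Kept.dartRev {d : Dart V} (h : Kept P del d) : Kept P del (dartRev P d) := by
  unfold Kept
  rw [dartBase_dartRev]
  exact h

theorem Kept.dartNext (hadm : AdmissibleDeletion P del) {d : Dart V} (_h : Kept P del d) :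
    Kept P del (dartNext P del d) := by
  rcases d with ⟨v, c, σ⟩
  unfold QuarticTours.dartNext
  generalize hw : QuarticTours.dartHead P (v, c, σ) = w
  split_ifs with hl
  · by_cases hd : del (!c) w
    · have := (hadm w).1 (!c)
      simp only [hd, true_and] at this
      simpa [Kept, dartBase, hd] using this
    · simp [Kept, dartBase, hd]
  · have := (not_congr (loses_iff hadm c w)).2 hl
    simp only [Loses, not_or] at this
    cases σ <;> simp [Kept, dartBase, this]

/-- Two remaining darts of the same colour at a vertex that loses edges are equal. -/
theorem dart_eq_of_loses (hadm : AdmissibleDeletion P del) {v : V} {c σ τ : Bool}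
    (hl : Loses P del true v) (h : Kept P del (v, c, σ)) (h' : Kept P del (v, c, τ)) : σ = τ := by
  have hl' := (loses_iff hadm c v).2 hl
  cases σ <;> cases τ <;> simp_all [Kept, dartBase, Loses]

theorem dartNext_of_loses (hadm : AdmissibleDeletion P del) {d : Dart V} {c σ : Bool}
    (hd : Kept P del d) (hl : Loses P del true (dartHead P d)) (hc : c = !d.2.1)
    (hk : Kept P del (dartHead P d, c, σ)) : dartNext P del d = (dartHead P d, c, σ) := by
  have h1 := Kept.dartNext hadm hd
  subst hc
  simp only [dartNext, hl, if_true] at h1 ⊢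
  rw [dart_eq_of_loses hadm hl h1 hk]

theorem dartNext_of_not_loses {d : Dart V}
    (hl : ¬Loses P del true (dartHead P d)) :
    dartNext P del d = (dartHead P d, d.2.1, d.2.2) := by
  simp [dartNext, hl]

theorem dartNext_fst (d : Dart V) : (dartNext P del d).1 = dartHead P d := by
  unfold dartNext
  split_ifs <;> rfl

/-- Reversal conjugates the successor map on darts to its inverse. -/
theorem dartNext_dartRev_dartNext (hadm : AdmissibleDeletion P del) {d : Dart V}
    (hd : Kept P del d) : dartNext P del (dartRev P (dartNext P del d)) = dartRev P d := by
  have hh : dartHead P (dartRev P (dartNext P del d)) = dartHead P d := by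
    have := dartRev_dartRev (P := P) (dartNext P del d)
    have h2 := congrArg Prod.fst this
    rw [dartNext_fst] at h2
    exact h2
  have hkr := (Kept.dartNext hadm hd).dartRev
  by_cases hl : Loses P del true (dartHead P d)
  · rw [dartNext_of_loses hadm hkr (c := d.2.1) (σ := !d.2.2) (by rw [hh]; exact hl) ?_ ?_, hh]
    · rfl
    · simp [dartRev, dartNext, hl]
    · rw [hh]
      exact hd.dartRev
  · rw [dartNext_of_not_loses (by rw [hh]; exact hl), hh]
    simp [dartNext, hl, dartRev]

/-- The successor of a dart is never its reversal. -/
theorem dartNext_ne_dartRev {d : Dart V} : dartNext P del d ≠ dartRev P d := by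
  intro h
  unfold dartNext dartRev at h
  split_ifs at h <;> simp [Prod.ext_iff] at h

theorem dartRev_ne {d : Dart V} : dartRev P d ≠ d := by
  intro h
  simp [dartRev, Prod.ext_iff] at h

/-- The successor map on the darts that are not deleted. -/
noncomputable def succDart (hadm : AdmissibleDeletion P del) :
    Equiv.Perm {d : Dart V // Kept P del d} where
  toFun d := ⟨dartNext P del d.1, d.2.dartNext hadm⟩
  invFun d := ⟨dartRev P (dartNext P del (dartRev P d.1)), (d.2.dartRev.dartNext hadm).dartRev⟩
  left_inv d := by
    apply Subtype.ext
    simp only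
    rw [dartNext_dartRev_dartNext hadm d.2, dartRev_dartRev]
  right_inv d := by
    apply Subtype.ext
    simp only
    rw [dartNext_dartRev_dartNext hadm d.2.dartRev, dartRev_dartRev]

/-- Reversal of the darts that are not deleted. -/
def revDart (d : {d : Dart V // Kept P del d}) : {d : Dart V // Kept P del d} :=
  ⟨dartRev P d.1, d.2.dartRev⟩

theorem revDart_revDart (d : {d : Dart V // Kept P del d}) : revDart (revDart d) = d :=
  Subtype.ext (dartRev_dartRev d.1)

theorem succDart_symm_revDart (hadm : AdmissibleDeletion P del)
    (d : {d : Dart V // Kept P del d}) :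
    (succDart hadm).symm (revDart d) = revDart (succDart hadm d) := by
  rw [Equiv.symm_apply_eq]
  exact Subtype.ext (dartNext_dartRev_dartNext hadm d.2).symm

theorem revDart_iterate (hadm : AdmissibleDeletion P del) (m : ℕ)
    (d : {d : Dart V // Kept P del d}) :
    (succDart hadm)^[m] (revDart ((succDart hadm)^[m] d)) = revDart d := by
  induction m generalizing d with
  | zero => rfl
  | succ m ih =>
    rw [Function.iterate_succ_apply' (succDart hadm) m d, Function.iterate_succ_apply,
      ← succDart_symm_revDart, Equiv.apply_symm_apply, ih]

/-- A walk with allowed transitions does not traverse an edge in both directions. -/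
theorem revDart_ne_iterate (hadm : AdmissibleDeletion P del) (k : ℕ)
    (d : {d : Dart V // Kept P del d}) : (succDart hadm)^[k] d ≠ revDart d := by
  intro h
  obtain ⟨m, hm | hm⟩ := Nat.even_or_odd' k
  · have h1 := revDart_iterate hadm m d
    rw [← h, hm, two_mul, Function.iterate_add_apply] at h1
    have h2 := (succDart hadm).injective.iterate m h1
    exact dartRev_ne (congrArg Subtype.val h2)
  · have h1 := revDart_iterate hadm m d
    rw [← h, hm, two_mul, add_assoc, Function.iterate_add_apply] at h1
    have h2 := (succDart hadm).injective.iterate m h1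
    rw [add_comm m 1, Function.iterate_add_apply, Function.iterate_one] at h2
    exact dartNext_ne_dartRev (congrArg Subtype.val h2).symm

/-- If the split graph is connected, then the walk that starts with the dart `d₀` traverses all
edges. -/
theorem exists_iterate_eq [Finite V] (hadm : AdmissibleDeletion P del)
    (hconn : ∀ x y, EqvGen (SplitLink P del) x y) (d₀ d : {d : Dart V // Kept P del d}) :
    ∃ k, (succDart hadm)^[k] d₀ = d ∨ (succDart hadm)^[k] d₀ = revDart d := by
  set f := succDart hadm with hf
  -- the darts whose edge is traversed by the walk, in one direction or the other
  let O : {d : Dart V // Kept P del d} → Prop :=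
    fun d => f.SameCycle d₀ d ∨ f.SameCycle d₀ (revDart d)
  have hOrev : ∀ d, O d → O (revDart d) := by
    rintro d (h | h)
    · right
      rwa [revDart_revDart]
    · exact Or.inl h
  have hOsucc : ∀ d, O d → O (f d) := by
    rintro d (h | h)
    · exact Or.inl (h.trans (Equiv.Perm.sameCycle_apply_right.2 (Equiv.Perm.SameCycle.refl f d)))
    · right
      rw [← succDart_symm_revDart]
      exact h.trans ⟨-1, by simp [hf]⟩
  -- the vertices of the split graph at which all remaining edges are traversed
  let Q : V × Bool → Prop := fun x => ∀ σ (h : Kept P del (x.1, x.2, σ)), O ⟨(x.1, x.2, σ), h⟩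
  -- one remaining dart in `O` at a red or blue copy of a vertex brings in the other one
  have hQ : ∀ (v : V) (c σ : Bool) (h : Kept P del (v, c, σ)), O ⟨(v, c, σ), h⟩ → Q (v, c) := by
    intro v c σ h hO τ hτ
    by_cases hστ : σ = τ
    · subst hστ
      exact hO
    · have hl : ¬Loses P del true v := fun hl => hστ (dart_eq_of_loses hadm hl h hτ)
      have hhead : dartHead P (dartRev P (v, c, σ)) = v := by
        have := dartRev_dartRev (P := P) (v, c, σ)
        exact congrArg Prod.fst this
      have h1 := hOsucc _ (hOrev _ hO)
      have h2 : f (revDart ⟨(v, c, σ), h⟩) = ⟨(v, c, τ), hτ⟩ := by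
        apply Subtype.ext
        change dartNext P del (dartRev P (v, c, σ)) = _
        rw [dartNext_of_not_loses (by rw [hhead]; exact hl), hhead]
        have : (!σ) = τ := by cases σ <;> cases τ <;> simp_all
        exact congrArg (fun x => (v, c, x)) this
      rwa [h2] at h1
  have hspoke : ∀ v c, Loses P del true v → Q (v, c) → Q (v, !c) := by
    intro v c hl hq τ hτ
    obtain ⟨σ, hσ⟩ : ∃ σ, Kept P del (v, c, σ) := by
      by_cases hd : del c v
      · exact ⟨false, fun h => (hadm v).1 c ⟨hd, h⟩⟩
      · exact ⟨true, hd⟩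
    have hhead : dartHead P (dartRev P (v, c, σ)) = v :=
      congrArg Prod.fst (dartRev_dartRev (P := P) (v, c, σ))
    have h1 := hOsucc _ (hOrev _ (hq σ hσ))
    have h2 : f (revDart ⟨(v, c, σ), hσ⟩) = ⟨(v, !c, τ), hτ⟩ := by
      apply Subtype.ext
      change dartNext P del (dartRev P (v, c, σ)) = _
      rw [dartNext_of_loses hadm hσ.dartRev (c := !c) (σ := τ) (by rw [hhead]; exact hl) rfl
        (by rw [hhead]; exact hτ), hhead]
    rwa [h2] at h1
  have hstep : ∀ x y, SplitLink P del x y → (Q x ↔ Q y) := by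
    intro x y hxy
    cases hxy with
    | edge c v h =>
      have hk : Kept P del (v, c, true) := h
      constructor
      · intro hq
        exact hQ _ c false hk.dartRev (hOrev _ (hq true hk))
      · intro hq
        have h2 := hOrev _ (hq false hk.dartRev)
        refine hQ v c true hk ?_
        have h3 : revDart ⟨(P c v, c, false), hk.dartRev⟩ =
            (⟨(v, c, true), hk⟩ : {d : Dart V // Kept P del d}) :=
          Subtype.ext (dartRev_dartRev (P := P) (v, c, true))
        rwa [h3] at h2
    | spoke v h => exact ⟨hspoke v true h, hspoke v false h⟩
  have hall : ∀ x y, EqvGen (SplitLink P del) x y → (Q x ↔ Q y) := by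
    intro x y h
    induction h with
    | rel x y h => exact hstep x y h
    | refl x => exact Iff.rfl
    | symm x y _ ih => exact ih.symm
    | trans x y z _ _ ih1 ih2 => exact ih1.trans ih2
  have h0 : Q (d₀.1.1, d₀.1.2.1) := hQ _ _ d₀.1.2.2 d₀.2 (Or.inl (Equiv.Perm.SameCycle.refl f d₀))
  have hd : O d := (hall _ (d.1.1, d.1.2.1) (hconn _ _)).1 h0 d.1.2.2 d.2
  have hfin : ∀ a b, f.SameCycle a b → ∃ k : ℕ, f^[k] a = b := by
    intro a b hab
    obtain ⟨k, hk⟩ := hab.exists_nat_pow_eq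
    exact ⟨k, by rw [← hk, Equiv.Perm.iterate_eq_pow]⟩
  rcases hd with h | h
  · obtain ⟨k, hk⟩ := hfin _ _ h
    exact ⟨k, Or.inl hk⟩
  · obtain ⟨k, hk⟩ := hfin _ _ h
    exact ⟨k, Or.inr hk⟩

end Splitting

/-! ### The split graph of a grid -/

section GridTour

/-- The lower end of the vertical or diagonal edge that arrives at a vertex. -/
def prevRow (s t r : ℕ) (x : XVertex s t) : XVertex s t :=
  if 0 < x.1.val then (⟨x.1.val - 1, by have := x.1.isLt; omega⟩, x.2)
  else (⟨t - 1, by have := x.1.isLt; omega⟩, x.2 - (r : ZMod s))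

theorem prevRow_nextRow (s t r : ℕ) (x : XVertex s t) : prevRow s t r (nextRow s t r x) = x := by
  rcases x with ⟨⟨i, hi⟩, j⟩
  unfold nextRow
  split_ifs with h
  · simp [prevRow]
  · simp only at h
    have : i = t - 1 := by omega
    subst this
    simp [prevRow]

theorem nextRow_prevRow (s t r : ℕ) (x : XVertex s t) : nextRow s t r (prevRow s t r x) = x := by
  rcases x with ⟨⟨i, hi⟩, j⟩
  unfold prevRow
  split_ifs with h
  · simp only at h
    have : i - 1 + 1 = i := by omega
    simp [nextRow, this, hi]
  · simp only at h
    have h0 : i = 0 := by omega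
    subst h0
    have : ¬(t - 1 + 1 < t) := by omega
    simp [nextRow, this]

/-- The moves of `X(s, t, r)`: along a red edge for `true`, along a blue edge for `false`. -/
def gridPerm (s t r : ℕ) (c : Bool) : Equiv.Perm (XVertex s t) :=
  bif c then
    ⟨fun x => (x.1, x.2 + 1), fun x => (x.1, x.2 - 1), fun x => by simp, fun x => by simp⟩
  else ⟨nextRow s t r, prevRow s t r, prevRow_nextRow s t r, nextRow_prevRow s t r⟩

/-- The edge of colour `c` from `v` to `gridPerm s t r c v`. -/
def edgeAt {s t : ℕ} (c : Bool) (v : XVertex s t) : XEdge s t :=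
  bif c then XEdge.horiz v.1 v.2 else XEdge.rise v.1 v.2

theorem edgeAt_inj {s t : ℕ} {c c' : Bool} {v v' : XVertex s t} :
    edgeAt c v = edgeAt c' v' ↔ c = c' ∧ v = v' := by
  cases c <;> cases c' <;> simp [edgeAt, Prod.ext_iff]

theorem exists_edgeAt {s t : ℕ} (e : XEdge s t) : ∃ c v, e = edgeAt c v := by
  cases e with
  | horiz i j => exact ⟨true, (i, j), rfl⟩
  | rise i j => exact ⟨false, (i, j), rfl⟩

theorem edgeAt_mem_horizontal {s t : ℕ} {c : Bool} {v : XVertex s t} :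
    edgeAt c v ∈ horizontal s t ↔ c = true := by
  cases c <;> simp [edgeAt, horizontal]

variable {s t r : ℕ}

theorem ends_edgeAt (c : Bool) (v : XVertex s t) :
    (edgeAt c v).ends s t r = s(v, gridPerm s t r c v) := by
  cases c <;> rfl

theorem gridPerm_ne (hs : 2 ≤ s) (ht : 2 ≤ t) (c : Bool) (v : XVertex s t) :
    gridPerm s t r c v ≠ v := by
  rcases v with ⟨⟨i, hi⟩, j⟩
  cases c
  · change nextRow s t r _ ≠ _
    unfold nextRow
    split_ifs with h
    · simp
    · simp only at h
      simp only [ne_eq, Prod.mk.injEq, Fin.mk.injEq, not_and]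
      omega
  · have : Fact (1 < s) := ⟨hs⟩
    simp [gridPerm]

theorem gridPerm_symm_ne (hs : 2 ≤ s) (ht : 2 ≤ t) (c : Bool) (v : XVertex s t) :
    (gridPerm s t r c).symm v ≠ v := by
  intro h
  rw [Equiv.symm_apply_eq] at h
  exact gridPerm_ne hs ht c v h.symm

/-- The underlying edge of a dart. -/
def dartEdge (s t r : ℕ) (d : Dart (XVertex s t)) : XEdge s t :=
  edgeAt d.2.1 (dartBase (gridPerm s t r) d)

theorem ends_dartEdge (d : Dart (XVertex s t)) :
    (dartEdge s t r d).ends s t r = s(d.1, dartHead (gridPerm s t r) d) := by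
  rcases d with ⟨v, c, σ⟩
  unfold dartEdge
  rw [ends_edgeAt]
  cases σ
  · simp [dartBase, dartHead, Sym2.eq_swap]
  · simp [dartBase, dartHead]

theorem dartEdge_mem_horizontal {d : Dart (XVertex s t)} :
    dartEdge s t r d ∈ horizontal s t ↔ d.2.1 = true :=
  edgeAt_mem_horizontal

theorem dartEdge_eq_iff {d d' : Dart (XVertex s t)} :
    dartEdge s t r d = dartEdge s t r d' ↔ d = d' ∨ d = dartRev (gridPerm s t r) d' := by
  rcases d with ⟨v, c, σ⟩
  rcases d' with ⟨v', c', σ'⟩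
  unfold dartEdge
  rw [edgeAt_inj]
  constructor
  · rintro ⟨h1, h2⟩
    simp only at h1
    subst h1
    cases σ <;> cases σ' <;> simp_all [dartBase, dartRev, dartHead]
    rw [← h2]; simp
  · rintro (h | h)
    · rw [h]; simp
    · rw [h, dartBase_dartRev]
      simp [dartRev]

/-- The spanning subgraph of `X(s, t, r)` that remains after a deletion of edges. -/
def remaining (s t r : ℕ) (del : Bool → XVertex s t → Prop) :
    Graph (XVertex s t) (XEdge s t) where
  vertexSet := Set.univ
  edgeSet := {e | ∃ c v, e = edgeAt c v ∧ ¬del c v}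
  IsLink e x y := (∃ c v, e = edgeAt c v ∧ ¬del c v) ∧ e.ends s t r = s(x, y)
  isLink_symm _ _ := ⟨fun _ _ h => ⟨h.1, h.2.trans Sym2.eq_swap⟩⟩
  eq_or_eq_of_isLink_of_isLink e x y v w h h' :=
    (X s t r).eq_or_eq_of_isLink_of_isLink (e := e) h.2 h'.2
  edge_mem_iff_exists_isLink e := by
    refine ⟨fun h => ?_, fun ⟨_, _, h⟩ => h.1⟩
    obtain ⟨c, v, he, hd⟩ := h
    exact ⟨v, gridPerm s t r c v, ⟨c, v, he, hd⟩, by rw [he, ends_edgeAt]⟩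
  left_mem_of_isLink _ _ _ _ := Set.mem_univ _

variable {del : Bool → XVertex s t → Prop}

theorem remaining_isLink_dartEdge {d : Dart (XVertex s t)} (h : Kept (gridPerm s t r) del d) :
    (remaining s t r del).IsLink (dartEdge s t r d) d.1 (dartHead (gridPerm s t r) d) :=
  ⟨⟨_, _, rfl, h⟩, ends_dartEdge d⟩

theorem remaining_isNonloopAt (hs : 2 ≤ s) (ht : 2 ≤ t) {e : XEdge s t} {v : XVertex s t} :
    (remaining s t r del).IsNonloopAt e v ↔
      ∃ c σ, Kept (gridPerm s t r) del (v, c, σ) ∧ dartEdge s t r (v, c, σ) = e := by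
  constructor
  · rintro ⟨y, hy, ⟨c, w, he, hd⟩, hends⟩
    rw [he, ends_edgeAt] at hends
    rcases Sym2.eq_iff.1 hends with ⟨h1, h2⟩ | ⟨h1, h2⟩
    · subst h1
      exact ⟨c, true, hd, he.symm⟩
    · have hw : w = (gridPerm s t r c).symm v := by rw [← h2]; simp
      refine ⟨c, false, ?_, ?_⟩
      · simpa [Kept, dartBase, ← hw] using hd
      · simp [dartEdge, dartBase, ← hw, he]
  · rintro ⟨c, σ, hk, rfl⟩
    refine ⟨_, ?_, remaining_isLink_dartEdge hk⟩
    cases σ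
    · exact gridPerm_symm_ne hs ht c v
    · exact gridPerm_ne hs ht c v

theorem remaining_valence (hs : 2 ≤ s) (ht : 2 ≤ t) (v : XVertex s t) :
    valence (remaining s t r del) v =
      {p : Bool × Bool | Kept (gridPerm s t r) del (v, p)}.ncard := by
  have h1 : (remaining s t r del).loopSet v = ∅ := by
    ext e
    simp only [Graph.loopSet, Graph.IsLoopAt, Set.mem_ofPred_eq, Set.mem_empty_iff_false, iff_false]
    rintro ⟨⟨c, w, he, -⟩, hends⟩
    rw [he, ends_edgeAt] at hends
    have : gridPerm s t r c w = w := by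
      rcases Sym2.eq_iff.1 hends with ⟨h1, h2⟩ | ⟨h1, h2⟩ <;> rw [h2, h1]
    exact gridPerm_ne hs ht c w this
  have h2 : {e | (remaining s t r del).IsNonloopAt e v} =
      (fun p : Bool × Bool => dartEdge s t r (v, p)) ''
        {p : Bool × Bool | Kept (gridPerm s t r) del (v, p)} := by
    ext e
    rw [Set.mem_ofPred_eq, remaining_isNonloopAt hs ht]
    simp [Set.mem_image]
  have h3 : Function.Injective (fun p : Bool × Bool => dartEdge s t r (v, p)) := by
    intro p q h
    rcases dartEdge_eq_iff.1 h with h | h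
    · exact congrArg Prod.snd h
    · exfalso
      have hv := congrArg Prod.fst h
      obtain ⟨c, σ⟩ := q
      cases σ
      · exact gridPerm_symm_ne (r := r) hs ht c v hv.symm
      · exact gridPerm_ne (r := r) hs ht c v hv.symm
  unfold valence
  rw [h1, h2, Set.ncard_image_of_injective _ h3]
  simp

theorem remaining_valence_of_not_loses (hs : 2 ≤ s) (ht : 2 ≤ t)
    (hadm : AdmissibleDeletion (gridPerm s t r) del) {v : XVertex s t}
    (hl : ¬Loses (gridPerm s t r) del true v) : valence (remaining s t r del) v = 4 := by
  rw [remaining_valence hs ht]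
  have : {p : Bool × Bool | Kept (gridPerm s t r) del (v, p)} = Set.univ := by
    ext ⟨c, σ⟩
    have := (not_congr (loses_iff hadm c v)).2 hl
    simp only [Loses, not_or] at this
    cases σ <;> simp [Kept, dartBase, this]
  rw [this, Set.ncard_univ]
  simp

theorem exists_kept (hadm : AdmissibleDeletion (gridPerm s t r) del) (v : XVertex s t) (c : Bool) :
    ∃ σ, Kept (gridPerm s t r) del (v, c, σ) := by
  by_cases hd : del c v
  · exact ⟨false, fun h => (hadm v).1 c ⟨hd, h⟩⟩
  · exact ⟨true, hd⟩

theorem remaining_valence_of_loses (hs : 2 ≤ s) (ht : 2 ≤ t)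
    (hadm : AdmissibleDeletion (gridPerm s t r) del) {v : XVertex s t}
    (hl : Loses (gridPerm s t r) del true v) : valence (remaining s t r del) v = 2 := by
  rw [remaining_valence hs ht]
  obtain ⟨σ, hσ⟩ := exists_kept hadm v true
  obtain ⟨τ, hτ⟩ := exists_kept hadm v false
  have : {p : Bool × Bool | Kept (gridPerm s t r) del (v, p)} = {(true, σ), (false, τ)} := by
    ext ⟨c, ρ⟩
    simp only [Set.mem_ofPred_eq, Set.mem_insert_iff, Set.mem_singleton_iff, Prod.mk.injEq]
    constructor
    · intro h
      cases c
      · exact Or.inr ⟨rfl, dart_eq_of_loses hadm hl h hτ⟩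
      · exact Or.inl ⟨rfl, dart_eq_of_loses hadm hl h hσ⟩
    · rintro (⟨rfl, rfl⟩ | ⟨rfl, rfl⟩)
      · exact hσ
      · exact hτ
  rw [this, Set.ncard_pair (by simp)]

theorem remaining_isAdmissible (hs : 2 ≤ s) (ht : 2 ≤ t)
    (hadm : AdmissibleDeletion (gridPerm s t r) del) :
    IsAdmissible (horizontal s t) (X s t r) (remaining s t r del) where
  spanning :=
    { le :=
        { vertexSet_mono := fun _ _ => Set.mem_univ _
          isLink_mono := fun _ _ _ h => h.2 }
      vertexSet_eq := rfl }
  valence_eq v _ := by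
    by_cases hl : Loses (gridPerm s t r) del true v
    · exact Or.inl (remaining_valence_of_loses hs ht hadm hl)
    · exact Or.inr (remaining_valence_of_not_loses hs ht hadm hl)
  traversing v _ _ := by
    obtain ⟨σ, hσ⟩ := exists_kept hadm v true
    obtain ⟨τ, hτ⟩ := exists_kept hadm v false
    refine ⟨dartEdge s t r (v, true, σ), dartEdge s t r (v, false, τ), ?_, ?_,
      ⟨_, remaining_isLink_dartEdge hσ⟩, ⟨_, remaining_isLink_dartEdge hτ⟩⟩
    · rw [dartEdge_mem_horizontal]
    · rw [dartEdge_mem_horizontal]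
      simp

/-- An admissible deletion with connected split graph leaves a good Eulerian subgraph: the tour is
the orbit of a dart under the successor map. -/
theorem exists_isGoodEulerianSubgraph (hs : 2 ≤ s) (ht : 2 ≤ t) (h : HasTour (gridPerm s t r)) :
    ∃ W, IsGoodEulerianSubgraph (horizontal s t) (X s t r) W := by
  obtain ⟨del, hadm, hconn⟩ := h
  have : NeZero s := ⟨by omega⟩
  refine ⟨remaining s t r del, remaining_isAdmissible hs ht hadm, ?_⟩
  obtain ⟨σ₀, hσ₀⟩ := exists_kept hadm ((⟨0, by omega⟩, 0) : XVertex s t) true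
  set d₀ : {d : Dart (XVertex s t) // Kept (gridPerm s t r) del d} := ⟨_, hσ₀⟩
  set f := succDart hadm with hf
  set n := Function.minimalPeriod f d₀ with hn
  have hpos : 0 < n := by
    refine Function.minimalPeriod_pos_of_mem_periodicPts ?_
    exact (Function.Injective.mem_periodicPts f.injective d₀)
  have : NeZero n := ⟨hpos.ne'⟩
  let D : ZMod n → {d : Dart (XVertex s t) // Kept (gridPerm s t r) del d} := fun k => f^[k.val] d₀
  have hDnat : ∀ m : ℕ, D (m : ZMod n) = f^[m] d₀ := by
    intro m
    change f^[(m : ZMod n).val] d₀ = _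
    rw [ZMod.val_natCast, hn]
    exact Function.iterate_mod_minimalPeriod_eq
  have hD : ∀ k, D (k + 1) = f (D k) := by
    intro k
    have h1 : k + 1 = ((k.val + 1 : ℕ) : ZMod n) := by simp
    rw [h1, hDnat, Function.iterate_succ_apply']
  have hDval : ∀ k, (D (k + 1)).1 = dartNext (gridPerm s t r) del (D k).1 := by
    intro k
    rw [hD]
    rfl
  refine ⟨n, fun k => (D k).1.1, fun k => dartEdge s t r (D k).1, hpos, ?_, ?_, ?_, ?_⟩
  · intro k
    have h1 := remaining_isLink_dartEdge (D k).2
    have h2 : (D (k + 1)).1.1 = dartHead (gridPerm s t r) (D k).1 := by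
      rw [hDval, dartNext_fst]
    rw [h2]
    exact h1
  · intro k l hkl
    have hinj : ∀ a b : ZMod n, D a = D b → a = b := by
      intro a b hab
      have := Function.iterate_injOn_Iio_minimalPeriod (f := f) (x := d₀)
        (Set.mem_Iio.2 (ZMod.val_lt a)) (Set.mem_Iio.2 (ZMod.val_lt b)) hab
      exact ZMod.val_injective n this
    have hrev : ∀ a m, D a = revDart (f^[m] (D a)) → False := by
      intro a m h
      refine revDart_ne_iterate hadm m (D a) ?_
      rw [h, revDart_revDart]
      rw [← h]
    rcases dartEdge_eq_iff.1 hkl with h | h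
    · exact hinj k l (Subtype.ext h)
    · exfalso
      have h' : D k = revDart (D l) := Subtype.ext h
      have : D l = f^[(l - k).val] (D k) := by
        have h1 : l = (((l - k).val + k.val : ℕ) : ZMod n) := by simp
        conv_lhs => rw [h1]
        rw [hDnat, Function.iterate_add_apply]
      rw [this] at h'
      exact hrev k _ h'
  · ext e
    constructor
    · rintro ⟨k, rfl⟩
      exact ⟨_, _, rfl, (D k).2⟩
    · rintro ⟨c, v, rfl, hd⟩
      obtain ⟨k, hk⟩ := exists_iterate_eq hadm hconn d₀ ⟨(v, c, true), hd⟩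
      refine ⟨(k : ZMod n), ?_⟩
      have h1 : edgeAt c v = dartEdge s t r (v, c, true) := rfl
      simp only
      rw [hDnat, h1, dartEdge_eq_iff]
      rcases hk with hk | hk
      · exact Or.inl (congrArg Subtype.val hk)
      · exact Or.inr (congrArg Subtype.val hk)
  · intro k hk
    change valence _ (D (k + 1)).1.1 = 4 at hk
    rw [hDval, dartNext_fst] at hk
    rw [dartEdge_mem_horizontal, dartEdge_mem_horizontal, hDval]
    by_cases hl : Loses (gridPerm s t r) del true (dartHead (gridPerm s t r) (D k).1)
    · rw [remaining_valence_of_loses hs ht hadm hl] at hk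
      omega
    · rw [dartNext_of_not_loses hl]

end GridTour

/-! ### The case of two rows without shift -/

section Necessity

variable {s t r : ℕ}

/-- Every admissible subgraph is what remains after an admissible deletion. -/
theorem exists_eq_remaining (hs : 2 ≤ s) (ht : 2 ≤ t) {W : Graph (XVertex s t) (XEdge s t)}
    (hW : IsAdmissible (horizontal s t) (X s t r) W) :
    ∃ del, W = remaining s t r del ∧ AdmissibleDeletion (gridPerm s t r) del := by
  let del : Bool → XVertex s t → Prop := fun c v => edgeAt c v ∉ W.edgeSet
  have hvert : W.vertexSet = Set.univ := hW.spanning.vertexSet_eq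
  have hle : W ≤ X s t r := hW.spanning.le
  have hWeq : W = remaining s t r del := by
    refine Graph.ext hvert ?_
    intro e x y
    constructor
    · intro h
      obtain ⟨c, v, rfl⟩ := exists_edgeAt e
      exact ⟨⟨c, v, rfl, fun h' => h' h.edge_mem⟩, (hle.isLink_iff h.edge_mem).1 h⟩
    · rintro ⟨⟨c, v, rfl, hd⟩, h⟩
      exact (hle.isLink_iff (not_not.1 hd)).2 h
  refine ⟨del, hWeq, fun v => ?_⟩
  have hv := hW.valence_eq v (by rw [hvert]; trivial)
  have htr := hW.traversing v (by rw [hvert]; trivial)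
  rw [hWeq, remaining_valence hs ht] at hv htr
  rcases hv with h2 | h4
  · obtain ⟨e, f, he, hf, hev, hfv⟩ := htr h2
    have hinc : ∀ e, (remaining s t r del).Inc e v →
        ∃ c σ, Kept (gridPerm s t r) del (v, c, σ) ∧ dartEdge s t r (v, c, σ) = e := by
      rintro e ⟨y, hy⟩
      refine (remaining_isNonloopAt hs ht).1 ⟨y, ?_, hy⟩
      rintro rfl
      obtain ⟨⟨c, w, rfl, -⟩, hends⟩ := hy
      rw [ends_edgeAt] at hends
      have : gridPerm s t r c w = w := by
        rcases Sym2.eq_iff.1 hends with ⟨h1, h2⟩ | ⟨h1, h2⟩ <;> rw [h2, h1]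
      exact gridPerm_ne hs ht c w this
    obtain ⟨c, σ, hk, rfl⟩ := hinc e hev
    obtain ⟨c', τ, hk', rfl⟩ := hinc f hfv
    rw [dartEdge_mem_horizontal] at he hf
    simp only [Bool.not_eq_true] at he hf
    subst he hf
    have hset : {p : Bool × Bool | Kept (gridPerm s t r) del (v, p)} = {(true, σ), (false, τ)} := by
      symm
      refine Set.eq_of_subset_of_ncard_le ?_ ?_ (Set.toFinite _)
      · rintro p (rfl | rfl)
        · exact hk
        · exact hk'
      · rw [h2, Set.ncard_pair (by simp)]
    have hkept : ∀ c ρ, Kept (gridPerm s t r) del (v, c, ρ) ↔ ρ = bif c then σ else τ := by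
      intro c ρ
      have : Kept (gridPerm s t r) del (v, c, ρ) ↔
          (c, ρ) ∈ ({(true, σ), (false, τ)} : Set (Bool × Bool)) := by
        rw [← hset]
        rfl
      rw [this]
      cases c <;> simp
    have hdel : ∀ c, (del c v ↔ (bif c then σ else τ) = false) ∧
        (del c ((gridPerm s t r c).symm v) ↔ (bif c then σ else τ) = true) := by
      intro c
      have h1 := hkept c true
      have h2 := hkept c false
      simp only [Kept, dartBase, cond_true, cond_false] at h1 h2
      constructor
      · rw [← not_iff_not, h1]
        cases c <;> simp [eq_comm]
      · rw [← not_iff_not, h2]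
        cases c <;> simp [eq_comm]
    refine ⟨fun c => ?_, ?_⟩
    · rw [(hdel c).1, (hdel c).2]
      cases c <;> cases σ <;> cases τ <;> simp
    · unfold Loses
      rw [(hdel true).1, (hdel true).2, (hdel false).1, (hdel false).2]
      cases σ <;> cases τ <;> simp
  · have hset : {p : Bool × Bool | Kept (gridPerm s t r) del (v, p)} = Set.univ := by
      refine Set.eq_of_subset_of_ncard_le (Set.subset_univ _) ?_ (Set.toFinite _)
      rw [h4, Set.ncard_univ]
      simp
    have hkept : ∀ c σ, Kept (gridPerm s t r) del (v, c, σ) := by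
      intro c σ
      have : (c, σ) ∈ {p : Bool × Bool | Kept (gridPerm s t r) del (v, p)} := by
        rw [hset]
        trivial
      exact this
    have h1 : ∀ c, ¬del c v := fun c => hkept c true
    have h2 : ∀ c, ¬del c ((gridPerm s t r c).symm v) := fun c => hkept c false
    refine ⟨fun c h => h1 c h.1, ?_⟩
    simp [Loses, h1, h2]

theorem nextRow_two_zero_snd (x : XVertex s 2) : (nextRow s 2 0 x).2 = x.2 := by
  unfold nextRow
  split_ifs <;> simp

/-- In `X(s, 2, 0)`, the vertices of a column have the same valence. If it is `4`, a tour that runs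
through a blue edge of the column can never leave the column. If all valences are `2`, every second
red edge of a row is deleted, so that `s` is even. -/
theorem not_isGoodEulerianSubgraph_two_zero (hs : 3 ≤ s) (hodd : Odd s)
    (W : Graph (XVertex s 2) (XEdge s 2)) :
    ¬IsGoodEulerianSubgraph (horizontal s 2) (X s 2 0) W := by
  rintro ⟨hW, n, v, e, htour⟩
  obtain ⟨del, rfl, hadm⟩ := exists_eq_remaining (by omega) le_rfl hW
  have hnz : NeZero n := ⟨htour.length_pos.ne'⟩
  have hU : ∀ j : ZMod s, (gridPerm s 2 0 false).symm ((0, j) : XVertex s 2) = (1, j) := by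
    intro j
    rw [Equiv.symm_apply_eq]
    simp [gridPerm, nextRow]
  have hU' : ∀ j : ZMod s, (gridPerm s 2 0 false).symm ((1, j) : XVertex s 2) = (0, j) := by
    intro j
    rw [Equiv.symm_apply_eq]
    simp [gridPerm, nextRow]
  have hloses : ∀ j : ZMod s, Loses (gridPerm s 2 0) del true ((0, j) : XVertex s 2) := by
    intro j
    by_contra hl0
    have hl1 : ¬Loses (gridPerm s 2 0) del true ((1, j) : XVertex s 2) := by
      rw [(hadm _).2] at hl0 ⊢
      unfold Loses at hl0 ⊢
      rw [hU] at hl0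
      rw [hU', or_comm]
      exact hl0
    have hval : ∀ i : Fin 2, valence (remaining s 2 0 del) (i, j) = 4 := by
      intro i
      refine remaining_valence_of_not_loses (by omega) le_rfl hadm ?_
      fin_cases i
      · exact hl0
      · exact hl1
    have hrise : ∀ k i j', e k = XEdge.rise i j' → (v k).2 = j' ∧ (v (k + 1)).2 = j' := by
      intro k i j' hk
      have h1 := (htour.isLink k).2
      rw [hk] at h1
      change s((i, j'), nextRow s 2 0 (i, j')) = s(v k, v (k + 1)) at h1
      rcases Sym2.eq_iff.1 h1 with ⟨h1, h2⟩ | ⟨h1, h2⟩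
      · rw [← h1, ← h2, nextRow_two_zero_snd]
        simp
      · rw [← h1, ← h2, nextRow_two_zero_snd]
        simp
    have hstart : ∃ k, e k = XEdge.rise 0 j := by
      have : XEdge.rise 0 j ∈ Set.range e := by
        rw [htour.range_eq]
        refine ⟨false, (0, j), rfl, fun h => hl0 ?_⟩
        rw [(hadm _).2]
        exact Or.inl h
      exact this
    obtain ⟨k₀, hk₀⟩ := hstart
    -- no horizontal edge can follow in this column
    have hall : ∀ m : ℕ, ∃ i, e (k₀ + m) = XEdge.rise i j := by
      intro m
      induction m with
      | zero => exact ⟨0, by simpa using hk₀⟩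
      | succ m ih =>
        obtain ⟨i, hi⟩ := ih
        have hv := (hrise _ i j hi).2
        have hv4 : valence (remaining s 2 0 del) (v (k₀ + m + 1)) = 4 := by
          have := hval (v (k₀ + m + 1)).1
          rwa [← hv] at this
        have hcol := htour.allowed _ hv4
        rw [hi] at hcol
        have hnot : e (k₀ + m + 1) ∉ horizontal s 2 := by
          rw [← hcol]
          simp [horizontal]
        have hassoc : k₀ + ((m + 1 : ℕ) : ZMod n) = k₀ + m + 1 := by
          push_cast
          ring
        rw [hassoc]
        cases hek : e (k₀ + m + 1) with
        | horiz i' j' => exact absurd ⟨i', j', hek⟩ hnot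
        | rise i' j' =>
          have := (hrise _ i' j' hek).1
          rw [hv] at this
          exact ⟨i', by rw [this]⟩
    have hh : XEdge.horiz 0 j ∈ Set.range e := by
      rw [htour.range_eq]
      exact ⟨true, (0, j), rfl, fun h => hl0 (Or.inl h)⟩
    obtain ⟨l, hl⟩ := hh
    obtain ⟨i, hi⟩ := hall (l - k₀).val
    rw [ZMod.natCast_val, ZMod.cast_id', id, add_sub_cancel, hl] at hi
    cases hi
  have halt : ∀ j : ZMod s,
      del true ((0, j + 1) : XVertex s 2) ↔ ¬del true ((0, j) : XVertex s 2) := by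
    intro j
    have h1 := hloses (j + 1)
    have h2 := (hadm (0, j + 1)).1 true
    have h3 : (gridPerm s 2 0 true).symm ((0, j + 1) : XVertex s 2) = (0, j) := by
      simp [gridPerm]
    unfold Loses at h1
    rw [h3] at h1 h2
    tauto
  have hpar : ∀ m : ℕ, del true ((0, (m : ZMod s)) : XVertex s 2) ↔
      (Even m ↔ del true ((0, 0) : XVertex s 2)) := by
    intro m
    induction m with
    | zero => simp
    | succ m ih =>
      push_cast
      rw [halt, ih, Nat.even_add_one]
      tauto
  have := hpar s
  rw [ZMod.natCast_self] at this
  have hne : ¬Even s := Nat.not_even_iff_odd.2 hodd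
  tauto

end Necessity

/-! ### Symmetries of the grids -/

section Symmetry

variable {V V' : Type*} {P : Bool → Equiv.Perm V} {P' : Bool → Equiv.Perm V'}

theorem eqvGen_of_surjective {α β : Type*} {ρ : α → α → Prop} {σ : β → β → Prop} (g : α → β)
    (hg : Function.Surjective g) (hlink : ∀ x y, ρ x y → EqvGen σ (g x) (g y))
    (h : ∀ x y, EqvGen ρ x y) (x y : β) : EqvGen σ x y := by
  obtain ⟨a, rfl⟩ := hg x
  obtain ⟨b, rfl⟩ := hg y
  have hab := h a b
  induction hab with
  | rel x y h => exact hlink x y h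
  | refl x => exact EqvGen.refl _
  | symm x y _ ih => exact EqvGen.symm _ _ ih
  | trans x y z _ _ ih1 ih2 => exact EqvGen.trans _ _ _ ih1 ih2

theorem HasTour.swap_colours (h : HasTour P) : HasTour fun c => P (!c) := by
  obtain ⟨del, hadm, hconn⟩ := h
  refine ⟨fun c => del (!c), fun v => ⟨fun c => (hadm v).1 (!c), (hadm v).2.symm⟩, ?_⟩
  refine eqvGen_of_surjective (fun x => (x.1, !x.2)) (fun x => ⟨(x.1, !x.2), by simp⟩) ?_ hconn
  rintro x y (⟨c, v, hd⟩ | ⟨v, hl⟩)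
  · have := SplitLink.edge (P := fun c => P (!c)) (del := fun c => del (!c)) (!c) v (by simpa using hd)
    simp only [Bool.not_not] at this
    exact EqvGen.rel _ _ this
  · exact EqvGen.symm _ _ (EqvGen.rel _ _ (SplitLink.spoke v ((hadm v).2.1 hl)))

theorem HasTour.of_equiv (φ : V ≃ V') (hφ : ∀ c v, φ (P c v) = P' c (φ v)) (h : HasTour P) :
    HasTour P' := by
  obtain ⟨del, hadm, hconn⟩ := h
  have hsymm : ∀ c v, φ.symm ((P' c).symm v) = (P c).symm (φ.symm v) := by
    intro c v
    apply φ.injective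
    apply (P' c).injective
    rw [← hφ c ((P c).symm _)]
    simp
  refine ⟨fun c v => del c (φ.symm v), fun v => ?_, ?_⟩
  · have := hadm (φ.symm v)
    simpa only [Loses, hsymm] using this
  refine eqvGen_of_surjective (fun x => (φ x.1, x.2)) (fun x => ⟨(φ.symm x.1, x.2), by simp⟩) ?_
    hconn
  rintro x y (⟨c, v, hd⟩ | ⟨v, hl⟩)
  · have := SplitLink.edge (P := P') (del := fun c v => del c (φ.symm v)) c (φ v) (by simpa using hd)
    rw [← hφ] at this
    exact EqvGen.rel _ _ this
  · refine EqvGen.rel _ _ (SplitLink.spoke (φ v) ?_)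
    simpa only [Loses, hsymm, Equiv.symm_apply_apply] using hl

/-- Reversing the direction of the red moves changes nothing. -/
theorem HasTour.reverse_red (h : HasTour P) :
    HasTour fun c => bif c then (P true).symm else P false := by
  obtain ⟨del, hadm, hconn⟩ := h
  have hloses : ∀ c v, Loses (fun c => bif c then (P true).symm else P false)
      (fun c v => bif c then del true ((P true).symm v) else del false v) c v ↔
      Loses P del c v := by
    intro c v
    cases c
    · exact Iff.rfl
    · simp [Loses, or_comm]
  refine ⟨fun c v => bif c then del true ((P true).symm v) else del false v, fun v => ⟨?_, ?_⟩, ?_⟩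
  · intro c
    have := (hadm v).1 c
    cases c
    · exact this
    · simpa [and_comm] using this
  · rw [hloses, hloses]
    exact (hadm v).2
  · refine eqvGen_of_surjective id Function.surjective_id ?_ hconn
    rintro x y (⟨c, v, hd⟩ | ⟨v, hl⟩)
    · cases c
      · exact EqvGen.rel _ _ (SplitLink.edge false v hd)
      · have := SplitLink.edge (P := fun c => bif c then (P true).symm else P false)
          (del := fun c v => bif c then del true ((P true).symm v) else del false v) true
          (P true v) (by simpa using hd)
        simp only [cond_true, Equiv.symm_apply_apply] at this
        exact EqvGen.symm _ _ (EqvGen.rel _ _ this)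
    · exact EqvGen.rel _ _ (SplitLink.spoke v ((hloses true v).2 hl))

end Symmetry

section GridSymmetry

variable {s t r : ℕ}

theorem gridPerm_true_apply (x : XVertex s t) : gridPerm s t r true x = (x.1, x.2 + 1) := rfl

theorem gridPerm_false_apply (x : XVertex s t) : gridPerm s t r false x = nextRow s t r x := rfl

/-- `X(s, t, r)` and `X(s, t, r')` are mirror images if `r + r'` is divisible by `s`. -/
theorem hasTour_mirror {r' : ℕ} (hr : ((r + r' : ℕ) : ZMod s) = 0) (h : HasTour (gridPerm s t r)) :
    HasTour (gridPerm s t r') := by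
  have hr' : (r' : ZMod s) = -(r : ZMod s) := by
    push_cast at hr
    exact eq_neg_of_add_eq_zero_right hr
  refine (h.reverse_red).of_equiv ((Equiv.refl (Fin t)).prodCongr (Equiv.neg (ZMod s))) ?_
  rintro c ⟨⟨i, hi⟩, j⟩
  cases c
  · simp only [cond_false, gridPerm_false_apply, nextRow, Equiv.prodCongr_apply, Prod.map,
      Equiv.refl_apply, Equiv.neg_apply]
    split_ifs
    · rfl
    · simp [hr', add_comm]
  · simp [gridPerm, sub_eq_add_neg, add_comm]

theorem gridPerm_true_pow (m : ℕ) (x : XVertex s t) :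
    (gridPerm s t r true ^ m) x = (x.1, x.2 + m) := by
  induction m with
  | zero => simp
  | succ m ih =>
    rw [pow_succ', Equiv.Perm.mul_apply, ih, gridPerm_true_apply]
    push_cast
    rw [add_assoc]

theorem gridPerm_false_pow (m : ℕ) (i : ℕ) (j : ZMod s) (h : i + m < t) :
    (gridPerm s t r false ^ m) ((⟨i, by omega⟩, j) : XVertex s t) = (⟨i + m, h⟩, j) := by
  induction m with
  | zero => simp
  | succ m ih =>
    rw [pow_succ', Equiv.Perm.mul_apply, ih (by omega), gridPerm_false_apply]
    unfold nextRow
    rw [dif_pos (by simp only; omega)]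
    simp [add_assoc]

theorem gridPerm_commute : Commute (gridPerm s t r true) (gridPerm s t r false) := by
  ext x
  · rcases x with ⟨⟨i, hi⟩, j⟩
    simp only [Equiv.Perm.mul_apply, gridPerm_true_apply, gridPerm_false_apply, nextRow]
    split_ifs <;> rfl
  · rcases x with ⟨⟨i, hi⟩, j⟩
    simp only [Equiv.Perm.mul_apply, gridPerm_true_apply, gridPerm_false_apply, nextRow]
    split_ifs
    · rfl
    · simp only
      ring

theorem gridPerm_false_pow_height :
    gridPerm s t r false ^ t = gridPerm s t r true ^ r := by
  ext1 ⟨⟨i, hi⟩, j⟩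
  rw [gridPerm_true_pow]
  have h1 : gridPerm s t r false ^ t = gridPerm s t r false ^ (i + (1 + (t - 1 - i))) := by
    congr 1
    omega
  rw [h1, pow_add, pow_add, Equiv.Perm.mul_apply, Equiv.Perm.mul_apply,
    gridPerm_false_pow (t - 1 - i) i j (by omega), pow_one, gridPerm_false_apply]
  unfold nextRow
  rw [dif_neg (by simp only; omega)]
  rw [gridPerm_false_pow i 0 _ (by omega)]
  simp

theorem gridPerm_true_pow_width : gridPerm s t r true ^ s = 1 := by
  ext1 x
  rw [gridPerm_true_pow]
  simp

/-- Interchanging the colours turns `X(s, t, r)` into `X(s', t', r')`, provided that the blue moves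
`U` have order dividing `s'`, and that `t'` red moves amount to `r'` blue ones. -/
theorem hasTour_transpose {s' t' r' : ℕ} (hs : 0 < s) (ht : 0 < t) (hs' : 0 < s') (ht' : 0 < t')
    (hcard : s' * t' = s * t) (hU : gridPerm s t r false ^ s' = 1)
    (hR : gridPerm s t r true ^ t' = gridPerm s t r false ^ r')
    (h : HasTour (gridPerm s' t' r')) : HasTour (gridPerm s t r) := by
  have : NeZero s := ⟨hs.ne'⟩
  have : NeZero s' := ⟨hs'.ne'⟩
  set R := gridPerm s t r true with hRdef
  set U := gridPerm s t r false with hUdef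
  have hcomm : Commute R U := gridPerm_commute
  let x₀ : XVertex s t := (⟨0, ht⟩, 0)
  have hmod : ∀ m, U ^ (m % s') = U ^ m := by
    intro m
    conv_rhs => rw [← Nat.div_add_mod m s', pow_add, pow_mul, hU, one_pow, one_mul]
  let φ : XVertex s' t' → XVertex s t := fun x => (R ^ x.1.val * U ^ x.2.val) x₀
  have hφ : ∀ (i : ℕ) (hi : i < t') (m : ℕ), φ (⟨i, hi⟩, (m : ZMod s')) = (R ^ i * U ^ m) x₀ := by
    intro i hi m
    simp only [φ, ZMod.val_natCast, hmod]
  have hsurj : Function.Surjective φ := by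
    rintro ⟨⟨i, hi⟩, j⟩
    have h1 : (R ^ j.val * U ^ i) x₀ = (⟨i, hi⟩, j) := by
      rw [Equiv.Perm.mul_apply, hUdef, gridPerm_false_pow i 0 0 (by omega), hRdef,
        gridPerm_true_pow]
      simp
    refine ⟨(⟨j.val % t', Nat.mod_lt _ ht'⟩, ((r' * (j.val / t') + i : ℕ) : ZMod s')), ?_⟩
    rw [hφ, ← h1, pow_add, pow_mul, ← hR, ← pow_mul, ← mul_assoc, ← pow_add, Nat.mod_add_div]
  have hbij : Function.Bijective φ := by
    rw [Fintype.bijective_iff_surjective_and_card]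
    refine ⟨hsurj, ?_⟩
    simp only [Fintype.card_prod, Fintype.card_fin, ZMod.card]
    rw [mul_comm t' s', hcard, mul_comm]
  have hkey : ∀ c x, φ (gridPerm s' t' r' c x) = gridPerm s t r (!c) (φ x) := by
    rintro c ⟨⟨i, hi⟩, j⟩
    obtain ⟨m, rfl⟩ : ∃ m : ℕ, j = (m : ZMod s') := ⟨j.val, by simp⟩
    rw [hφ]
    cases c
    · simp only [Bool.not_false, gridPerm_false_apply, nextRow]
      split_ifs with hlt
      · rw [hφ, ← Equiv.Perm.mul_apply, ← mul_assoc, ← pow_succ']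
      · have hi' : i + 1 = t' := by omega
        rw [← Nat.cast_add, hφ, ← Equiv.Perm.mul_apply, ← mul_assoc, ← hRdef, ← pow_succ', hi', hR,
          ← pow_add, pow_zero, one_mul, add_comm]
    · have h1 : gridPerm s' t' r' true (⟨i, hi⟩, (m : ZMod s')) = (⟨i, hi⟩, ((m + 1 : ℕ) : ZMod s')) := by
        rw [gridPerm_true_apply]
        simp
      rw [h1, hφ, Bool.not_true, ← hUdef, ← Equiv.Perm.mul_apply, ← mul_assoc,
        ← (hcomm.pow_left i).eq, mul_assoc, ← pow_succ']
  have h2 : HasTour fun c => gridPerm s t r (!c) :=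
    h.of_equiv (Equiv.ofBijective φ hbij) hkey
  simpa using h2.swap_colours

end GridSymmetry

/-! ### Patterns of deleted edges, and adding two rows -/

section Pattern

/-- A choice of edges to delete in a grid with columns modulo `s`: `red i j` is about the edge from
`(i, j)` to `(i, j + 1)`, and `blue i j` about the blue edge that leaves `(i, j)` upwards. Only the
rows `i < t` matter for `X(s, t, r)`, so that patterns can be extended to more rows. -/
structure Pattern (s : ℕ) where
  /-- The deleted horizontal edges. -/
  red : ℕ → ZMod s → Prop
  /-- The deleted vertical and diagonal edges. -/
  blue : ℕ → ZMod s → Prop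

/-- The blue edge that arrives at `(i, j)` from below is deleted. -/
def Pattern.below {s : ℕ} (A : Pattern s) (t : ℕ) (r : ZMod s) (i : ℕ) (j : ZMod s) : Prop :=
  if i = 0 then A.blue (t - 1) (j - r) else A.blue (i - 1) j

/-- The deletion described by a pattern is admissible in `X(s, t, r)`. -/
def Pattern.Admissible {s : ℕ} (A : Pattern s) (t : ℕ) (r : ZMod s) : Prop :=
  ∀ i < t, ∀ j, ¬(A.red i j ∧ A.red i (j - 1)) ∧ ¬(A.blue i j ∧ A.below t r i j) ∧
    ((A.red i j ∨ A.red i (j - 1)) ↔ (A.blue i j ∨ A.below t r i j))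

/-- Vertices of the split graph of a grid: row, column, and colour of the copy. -/
abbrev Spot (s : ℕ) : Type := ℕ × ZMod s × Bool

/-- Adjacency in the split graph that a pattern leaves, with the diagonal edges from the columns in
`K` cut. -/
inductive GridLink {s : ℕ} (A : Pattern s) (t : ℕ) (r : ZMod s) (K : ZMod s → Prop) :
    Spot s → Spot s → Prop
  | red (i : ℕ) (j : ZMod s) : i < t → ¬A.red i j →
      GridLink A t r K (i, j, true) (i, j + 1, true)
  | blue (i : ℕ) (j : ZMod s) : i + 1 < t → ¬A.blue i j →
      GridLink A t r K (i, j, false) (i + 1, j, false)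
  | diag (j : ZMod s) : ¬A.blue (t - 1) j → ¬K j →
      GridLink A t r K (t - 1, j, false) (0, j + r, false)
  | spoke (i : ℕ) (j : ZMod s) : i < t → (A.red i j ∨ A.red i (j - 1)) →
      GridLink A t r K (i, j, true) (i, j, false)

/-- Connectedness in the split graph that a pattern leaves, with the diagonal edges from the
columns in `K` cut. -/
def Conn {s : ℕ} (A : Pattern s) (t : ℕ) (r : ZMod s) (K : ZMod s → Prop) : Spot s → Spot s → Prop :=
  EqvGen (GridLink A t r K)

variable {s t : ℕ} {r : ZMod s} {A : Pattern s} {K : ZMod s → Prop}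

theorem Conn.refl (x : Spot s) : Conn A t r K x x := EqvGen.refl x

theorem Conn.symm {x y : Spot s} (h : Conn A t r K x y) : Conn A t r K y x := EqvGen.symm _ _ h

theorem Conn.trans {x y z : Spot s} (h : Conn A t r K x y) (h' : Conn A t r K y z) :
    Conn A t r K x z := EqvGen.trans _ _ _ h h'

theorem Conn.of_link {x y : Spot s} (h : GridLink A t r K x y) : Conn A t r K x y :=
  EqvGen.rel _ _ h

theorem Conn.mono {K' : ZMod s → Prop} (hK : ∀ j, K' j → K j) {x y : Spot s}
    (h : Conn A t r K x y) : Conn A t r K' x y := by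
  refine EqvGen.mono ?_ _ _ h
  rintro x y (⟨i, j, h1, h2⟩ | ⟨i, j, h1, h2⟩ | ⟨j, h1, h2⟩ | ⟨i, j, h1, h2⟩)
  · exact GridLink.red i j h1 h2
  · exact GridLink.blue i j h1 h2
  · exact GridLink.diag j h1 fun h => h2 (hK _ h)
  · exact GridLink.spoke i j h1 h2

theorem hasTour_of_conn {r : ℕ} (ht : 0 < t) (hadm : A.Admissible t (r : ZMod s)) (x₀ : Spot s)
    (hconn : ∀ i < t, ∀ j c, Conn A t (r : ZMod s) (fun _ => False) (i, j, c) x₀) :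
    HasTour (gridPerm s t r) := by
  let del : Bool → XVertex s t → Prop := fun c v => bif c then A.red v.1 v.2 else A.blue v.1 v.2
  have hred : ∀ (i : ℕ) (hi : i < t) (j : ZMod s),
      Loses (gridPerm s t r) del true ((⟨i, hi⟩, j) : XVertex s t) ↔
        (A.red i j ∨ A.red i (j - 1)) := fun i hi j => Iff.rfl
  have hbelow : ∀ (i : ℕ) (hi : i < t) (j : ZMod s),
      del false ((gridPerm s t r false).symm ((⟨i, hi⟩, j) : XVertex s t)) ↔
        A.below t (r : ZMod s) i j := by
    intro i hi j
    change del false (prevRow s t r _) ↔ _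
    unfold prevRow Pattern.below
    rcases Nat.eq_zero_or_pos i with h0 | h0
    · subst h0
      simp [del]
    · simp [h0, h0.ne', del]
  let g : Spot s → XVertex s t × Bool := fun x =>
    if h : x.1 < t then ((⟨x.1, h⟩, x.2.1), x.2.2) else ((⟨0, ht⟩, 0), false)
  have hg : ∀ (i : ℕ) (hi : i < t) (j : ZMod s) (c : Bool), g (i, j, c) = ((⟨i, hi⟩, j), c) := by
    intro i hi j c
    simp [g, hi]
  have hlink : ∀ x y, Conn A t (r : ZMod s) (fun _ => False) x y →
      EqvGen (SplitLink (gridPerm s t r) del) (g x) (g y) := by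
    intro x y h
    induction h with
    | rel x y h =>
      rcases h with ⟨i, j, h1, h2⟩ | ⟨i, j, h1, h2⟩ | ⟨j, h1, -⟩ | ⟨i, j, h1, h2⟩
      · rw [hg i h1, hg i h1]
        exact EqvGen.rel _ _ (SplitLink.edge true ((⟨i, h1⟩, j) : XVertex s t) h2)
      · rw [hg i (by omega), hg (i + 1) h1]
        have := SplitLink.edge (P := gridPerm s t r) (del := del) false
          ((⟨i, by omega⟩, j) : XVertex s t) h2
        simp only [gridPerm_false_apply, nextRow, h1, dif_pos] at this
        exact EqvGen.rel _ _ this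
      · rw [hg (t - 1) (by omega), hg 0 ht]
        have := SplitLink.edge (P := gridPerm s t r) (del := del) false
          ((⟨t - 1, by omega⟩, j) : XVertex s t) h1
        have hlt : ¬(t - 1 + 1 < t) := by omega
        simp only [gridPerm_false_apply, nextRow, hlt, dif_neg, not_false_iff] at this
        exact EqvGen.rel _ _ this
      · rw [hg i h1, hg i h1]
        exact EqvGen.rel _ _ (SplitLink.spoke _ ((hred i h1 j).2 h2))
    | refl x => exact EqvGen.refl _
    | symm x y _ ih => exact EqvGen.symm _ _ ih
    | trans x y z _ _ ih1 ih2 => exact EqvGen.trans _ _ _ ih1 ih2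
  refine ⟨del, ?_, ?_⟩
  · rintro ⟨⟨i, hi⟩, j⟩
    obtain ⟨h1, h2, h3⟩ := hadm i hi j
    refine ⟨?_, ?_⟩
    · rintro (_ | _)
      · rw [hbelow]
        exact h2
      · exact h1
    · rw [hred, h3]
      unfold Loses
      rw [hbelow]
      exact Iff.rfl
  · rintro ⟨⟨⟨i, hi⟩, j⟩, c⟩ ⟨⟨⟨i', hi'⟩, j'⟩, c'⟩
    have h1 := hlink _ _ (hconn i hi j c)
    have h2 := hlink _ _ (hconn i' hi' j' c')
    rw [hg i hi] at h1
    rw [hg i' hi'] at h2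
    exact EqvGen.trans _ _ _ h1 (EqvGen.symm _ _ h2)

/-- A row with only one deleted edge is still connected. -/
theorem conn_row [NeZero s] {i : ℕ} (hi : i < t) (d : ZMod s) (h : ∀ j, j ≠ d → ¬A.red i j)
    (j j' : ZMod s) : Conn A t r K (i, j, true) (i, j', true) := by
  have key : ∀ n : ℕ, n < s → Conn A t r K (i, d + 1, true) (i, d + 1 + n, true) := by
    intro n
    induction n with
    | zero =>
      intro _
      simp only [Nat.cast_zero, add_zero]
      exact Conn.refl _
    | succ n ih =>
      intro hn
      refine (ih (by omega)).trans ?_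
      have h1 : d + 1 + ((n + 1 : ℕ) : ZMod s) = d + 1 + n + 1 := by
        push_cast
        ring
      rw [h1]
      refine Conn.of_link (GridLink.red i _ hi (h _ ?_))
      intro h2
      have h3 : ((n + 1 : ℕ) : ZMod s) = 0 := by
        push_cast
        have h4 : d + 1 + (n : ZMod s) = d + ((n : ZMod s) + 1) := by ring
        rw [h4] at h2
        exact (add_eq_left).1 h2
      rw [ZMod.natCast_eq_zero_iff] at h3
      exact absurd (Nat.le_of_dvd (by omega) h3) (by omega)
  have all : ∀ j, Conn A t r K (i, d + 1, true) (i, j, true) := by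
    intro j
    have := key (j - (d + 1)).val (ZMod.val_lt _)
    rwa [ZMod.natCast_zmod_val, add_sub_cancel] at this
  exact (all j).symm.trans (all j')

/-- The pattern `A` on `t` rows, extended by two rows; in them the squares with lower left corner
`(t, j)` are deleted for all `j` with `q j`. -/
def Pattern.extend (A : Pattern s) (t : ℕ) (q : ZMod s → Prop) : Pattern s where
  red i j := if i < t then A.red i j else q j
  blue i j := if i < t then A.blue i j else i = t ∧ (q j ∨ q (j - 1))

/-- No diagonal edge is deleted. -/
def Pattern.Open (A : Pattern s) (t : ℕ) : Prop := ∀ j, ¬A.blue (t - 1) j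

theorem Pattern.extend_open {q : ZMod s → Prop} : (A.extend t q).Open (t + 2) := by
  intro j
  simp [Pattern.extend]

theorem Pattern.Admissible.extend {q : ZMod s → Prop} (ht : 0 < t) (hopen : A.Open t)
    (hadm : A.Admissible t r) (hq : ∀ j, ¬(q j ∧ q (j - 1))) :
    (A.extend t q).Admissible (t + 2) r := by
  intro i hi j
  rcases lt_trichotomy i t with h | h | h
  · have h1 := hadm i h j
    have h2 : (A.extend t q).below (t + 2) r i j ↔ A.below t r i j := by
      unfold Pattern.below
      split_ifs with h0
      · simp only [Pattern.extend]
        have := hopen (j - r)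
        simp [this]
      · simp [Pattern.extend, show i - 1 < t by omega]
    rw [h2]
    simpa [Pattern.extend, h] using h1
  · subst h
    have h2 : ¬(A.extend i q).below (i + 2) r i j := by
      unfold Pattern.below
      rw [if_neg (by omega)]
      simpa [Pattern.extend, show i - 1 < i by omega] using hopen j
    have := hq j
    simp [Pattern.extend]
    tauto
  · have hi' : i = t + 1 := by omega
    subst hi'
    have := hq j
    simp [Pattern.extend, Pattern.below]
    tauto

theorem Conn.extend {q : ZMod s → Prop} (ht : 0 < t)
    (hq : ∀ j, q j → K j ∧ K (j + 1)) {x y : Spot s} (h : Conn A t r K x y) :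
    Conn (A.extend t q) (t + 2) r K x y := by
  induction h with
  | rel x y h =>
    rcases h with ⟨i, j, h1, h2⟩ | ⟨i, j, h1, h2⟩ | ⟨j, h1, h2⟩ | ⟨i, j, h1, h2⟩
    · exact Conn.of_link (GridLink.red i j (by omega) (by simpa [Pattern.extend, h1] using h2))
    · exact Conn.of_link (GridLink.blue i j (by omega)
        (by simpa [Pattern.extend, show i < t by omega] using h2))
    · have hj : ¬q j := fun h => h2 (hq j h).1
      have hj' : ¬q (j - 1) := fun h => h2 (by simpa using (hq _ h).2)
      have e1 : Conn (A.extend t q) (t + 2) r K (t - 1, j, false) (t - 1 + 1, j, false) :=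
        Conn.of_link (GridLink.blue (t - 1) j (by omega)
          (by simpa [Pattern.extend, show t - 1 < t by omega] using h1))
      rw [Nat.sub_add_cancel ht] at e1
      have e2 : Conn (A.extend t q) (t + 2) r K (t, j, false) (t + 1, j, false) :=
        Conn.of_link (GridLink.blue t j (by omega) (by simp [Pattern.extend, hj, hj']))
      have e3 : Conn (A.extend t q) (t + 2) r K (t + 1, j, false) (0, j + r, false) :=
        Conn.of_link (GridLink.diag j (by simp [Pattern.extend]) h2)
      exact (e1.trans e2).trans e3
    · exact Conn.of_link (GridLink.spoke i j (by omega) (by simpa [Pattern.extend, h1] using h2))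
  | refl x => exact EqvGen.refl _
  | symm x y _ ih => exact EqvGen.symm _ _ ih
  | trans x y z _ _ ih1 ih2 => exact EqvGen.trans _ _ _ ih1 ih2

section ExtendOne

/-- Neighbouring columns. -/
def Adjacent (a b : ZMod s) : Prop := b = a + 1 ∨ a = b + 1

theorem Adjacent.symm {a b : ZMod s} (h : Adjacent a b) : Adjacent b a := Or.symm h

/-- The effect of two further rows with a single deleted square, in the neighbouring columns
`a` and `b`: the ends below it become joined, and so do the ends above it, while all other
columns pass through. -/
theorem exists_extend_pair (hs : 3 ≤ s) (ht : 0 < t) (hopen : A.Open t) (hadm : A.Admissible t r)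
    {a b : ZMod s} (hab : Adjacent a b) (ha : K a) (hb : K b) :
    ∃ B : Pattern s, B.Open (t + 2) ∧ B.Admissible (t + 2) r ∧
      (∀ x y, Conn A t r K x y → Conn B (t + 2) r K x y) ∧
      Conn B (t + 2) r K (t - 1, a, false) (t - 1, b, false) ∧
      Conn B (t + 2) r K (t + 1, a, false) (t + 1, b, false) ∧
      (∀ j, j ≠ a → j ≠ b → Conn B (t + 2) r K (t - 1, j, false) (t + 1, j, false)) ∧
      ∀ i, t ≤ i → i < t + 2 → ∀ j c, ∃ j', Conn B (t + 2) r K (i, j, c) (t - 1, j', false) ∨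
        Conn B (t + 2) r K (i, j, c) (t + 1, j', false) := by
  wlog hab' : b = a + 1 generalizing a b
  · obtain ⟨B, h1, h2, h3, h4, h5, h6, h7⟩ :=
      this hab.symm hb ha (hab.resolve_left hab')
    exact ⟨B, h1, h2, h3, h4.symm, h5.symm, fun j h h' => h6 j h' h, h7⟩
  subst hab'
  have : NeZero s := ⟨by omega⟩
  have : Fact (1 < s) := ⟨by omega⟩
  set q : ZMod s → Prop := fun j => j = a with hqdef
  set B := A.extend t q with hB
  have hdis : ∀ j, ¬(q j ∧ q (j - 1)) := by
    rintro j ⟨h1, h2⟩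
    rw [hqdef] at h1 h2
    rw [h1] at h2
    simp at h2
  have hK : ∀ j, q j → K j ∧ K (j + 1) := by
    intro j hj
    have hj' : j = a := hj
    rw [hj']
    exact ⟨ha, hb⟩
  have hrow : ∀ i, t ≤ i → i < t + 2 → ∀ j j', Conn B (t + 2) r K (i, j, true) (i, j', true) := by
    intro i h1 h2 j j'
    refine conn_row h2 a ?_ j j'
    intro j hj
    simp [hB, Pattern.extend, show ¬i < t by omega, hqdef, hj]
  have hspa : ∀ i, t ≤ i → i < t + 2 → Conn B (t + 2) r K (i, a, true) (i, a, false) := by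
    intro i h1 h2
    refine Conn.of_link (GridLink.spoke i a h2 (Or.inl ?_))
    simp [hB, Pattern.extend, show ¬i < t by omega, hqdef]
  have hspb : ∀ i, t ≤ i → i < t + 2 → Conn B (t + 2) r K (i, a + 1, true) (i, a + 1, false) := by
    intro i h1 h2
    refine Conn.of_link (GridLink.spoke i (a + 1) h2 (Or.inr ?_))
    simp [hB, Pattern.extend, show ¬i < t by omega, hqdef]
  have hrise : ∀ j, Conn B (t + 2) r K (t - 1, j, false) (t, j, false) := by
    intro j
    have e1 : Conn B (t + 2) r K (t - 1, j, false) (t - 1 + 1, j, false) :=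
        Conn.of_link (GridLink.blue (t - 1) j (by omega)
          (by simpa [hB, Pattern.extend, show t - 1 < t by omega] using hopen j))
    rwa [Nat.sub_add_cancel ht] at e1
  have hthru : ∀ j, j ≠ a → j ≠ a + 1 → Conn B (t + 2) r K (t, j, false) (t + 1, j, false) := by
    intro j h1 h2
    refine Conn.of_link (GridLink.blue t j (by omega) ?_)
    have : ¬(j - 1 = a) := fun h => h2 (by rw [← h]; ring)
    simp [hB, Pattern.extend, hqdef, h1, this]
  refine ⟨B, Pattern.extend_open, hadm.extend ht hopen hdis, fun x y h => h.extend ht hK,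
    ?_, ?_, fun j h1 h2 => (hrise j).trans (hthru j h1 h2), ?_⟩
  · exact (hrise a).trans ((hspa t le_rfl (by omega)).symm.trans
      ((hrow t le_rfl (by omega) _ _).trans ((hspb t le_rfl (by omega)).trans (hrise _).symm)))
  · exact ((hspa (t + 1) (by omega) (by omega)).symm.trans
      ((hrow (t + 1) (by omega) (by omega) _ _).trans (hspb (t + 1) (by omega) (by omega))))
  · intro i h1 h2 j c
    cases c
    · refine ⟨j, ?_⟩
      rcases (show i = t ∨ i = t + 1 by omega) with h | h
      · subst h
        exact Or.inl (hrise j).symm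
      · subst h
        exact Or.inr (Conn.refl _)
    · refine ⟨a, ?_⟩
      have h3 := (hrow i h1 h2 j a).trans (hspa i h1 h2)
      rcases (show i = t ∨ i = t + 1 by omega) with h | h
      · subst h
        exact Or.inl (h3.trans (hrise a).symm)
      · subst h
        exact Or.inr h3

end ExtendOne

end Pattern

/-! ### Crossing seams -/

section Insertion

variable {s t : ℕ} {r : ZMod s} {A : Pattern s} {K : ZMod s → Prop}

/-- `B` is a pattern on `t'` rows that contains the pattern `A` on `t` rows: every spot of `B` is
joined to a spot of `A` or to the upper end of a column in `K`. -/
structure Tower (A : Pattern s) (t : ℕ) (B : Pattern s) (t' : ℕ) (r : ZMod s)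
    (K : ZMod s → Prop) : Prop where
  le : t ≤ t'
  isOpen : B.Open t'
  admissible : B.Admissible t' r
  conn : ∀ x y, Conn A t r K x y → Conn B t' r K x y
  reach : ∀ i < t', ∀ j c, ∃ x, Conn B t' r K (i, j, c) x ∧
    (x.1 < t ∨ ∃ k, K k ∧ x = (t' - 1, k, false))

theorem Tower.refl (hopen : A.Open t) (hadm : A.Admissible t r) : Tower A t A t r K :=
  ⟨le_rfl, hopen, hadm, fun _ _ h => h, fun _ hi _ _ => ⟨_, Conn.refl _, Or.inl hi⟩⟩

/-- One more square on a tower. The hypothesis `hold` says that the upper ends of the old tower are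
still reached from the base or from the new upper ends. -/
theorem Tower.step {B : Pattern s} {t' : ℕ} (h : Tower A t B t' r K) (hs : 3 ≤ s) (ht : 0 < t)
    {a b e : ZMod s} (hab : Adjacent a b) (ha : K a) (hb : K b) (hea : e ≠ a) (heb : e ≠ b)
    (hold : ∃ x, Conn B t' r K (t' - 1, a, false) x ∧ (x.1 < t ∨ x = (t' - 1, e, false))) :
    ∃ B', Tower A t B' (t' + 2) r K ∧
      (∀ x y, Conn B t' r K x y → Conn B' (t' + 2) r K x y) ∧
      Conn B' (t' + 2) r K (t' - 1, a, false) (t' - 1, b, false) ∧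
      Conn B' (t' + 2) r K (t' + 1, a, false) (t' + 1, b, false) ∧
      Conn B' (t' + 2) r K (t' - 1, e, false) (t' + 1, e, false) := by
  have hle := h.le
  obtain ⟨B', h1, h2, h3, h4, h5, h6, h7⟩ :=
    exists_extend_pair (K := K) hs (by omega) h.isOpen h.admissible hab ha hb
  have htop : ∀ k, ∃ x, Conn B' (t' + 2) r K (t' + 1, k, false) x ∧
      (x.1 < t ∨ ∃ k, K k ∧ x = (t' + 2 - 1, k, false)) := by
    intro k
    by_cases hk : K k
    · exact ⟨_, Conn.refl _, Or.inr ⟨k, hk, rfl⟩⟩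
    · exact ⟨_, Conn.of_link (GridLink.diag k (h1 k) hk), Or.inl ht⟩
  have hmid : ∀ k, ∃ x, Conn B' (t' + 2) r K (t' - 1, k, false) x ∧
      (x.1 < t ∨ ∃ k, K k ∧ x = (t' + 2 - 1, k, false)) := by
    have hA : ∃ x, Conn B' (t' + 2) r K (t' - 1, a, false) x ∧
        (x.1 < t ∨ ∃ k, K k ∧ x = (t' + 2 - 1, k, false)) := by
      obtain ⟨x, hx, hx' | rfl⟩ := hold
      · exact ⟨x, h3 _ _ hx, Or.inl hx'⟩
      · obtain ⟨y, hy, hy'⟩ := htop e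
        exact ⟨y, ((h3 _ _ hx).trans (h6 e hea heb)).trans hy, hy'⟩
    intro k
    by_cases hka : k = a
    · rwa [hka]
    by_cases hkb : k = b
    · obtain ⟨x, hx, hx'⟩ := hA
      rw [hkb]
      exact ⟨x, h4.symm.trans hx, hx'⟩
    · obtain ⟨y, hy, hy'⟩ := htop k
      exact ⟨y, (h6 k hka hkb).trans hy, hy'⟩
  refine ⟨B', ⟨by omega, h1, h2, fun x y hxy => h3 _ _ (h.conn _ _ hxy), ?_⟩, h3, h4, h5,
    h6 e hea heb⟩
  intro i hi j c
  rcases lt_or_ge i t' with hi' | hi'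
  · obtain ⟨x, hx, hx' | ⟨k, -, rfl⟩⟩ := h.reach i hi' j c
    · exact ⟨x, h3 _ _ hx, Or.inl hx'⟩
    · obtain ⟨y, hy, hy'⟩ := hmid k
      exact ⟨y, (h3 _ _ hx).trans hy, hy'⟩
  · obtain ⟨k, hk | hk⟩ := h7 i hi' hi j c
    · obtain ⟨y, hy, hy'⟩ := hmid k
      exact ⟨y, hk.trans hy, hy'⟩
    · obtain ⟨y, hy, hy'⟩ := htop k
      exact ⟨y, hk.trans hy, hy'⟩

/-- The state of a tower after an odd number of squares, alternately in the columns `a, b` and in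
the columns `b, e`. -/
def Tower.OddState (t : ℕ) (B : Pattern s) (t' : ℕ) (r : ZMod s) (K : ZMod s → Prop)
    (a b e : ZMod s) : Prop :=
  Conn B t' r K (t - 1, a, false) (t - 1, b, false) ∧
  Conn B t' r K (t' - 1, a, false) (t' - 1, b, false) ∧
  Conn B t' r K (t' - 1, e, false) (t - 1, e, false)

/-- The state of a tower after an even number of squares, alternately in the columns `a, b` and in
the columns `b, e`. -/
def Tower.EvenState (t : ℕ) (B : Pattern s) (t' : ℕ) (r : ZMod s) (K : ZMod s → Prop)
    (a b e : ZMod s) : Prop :=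
  Conn B t' r K (t - 1, a, false) (t - 1, b, false) ∧
  Conn B t' r K (t' - 1, b, false) (t' - 1, e, false) ∧
  Conn B t' r K (t' - 1, a, false) (t - 1, e, false)

section Word

variable {a b e : ZMod s}

theorem Tower.exists_evenState {B : Pattern s} {t' : ℕ} (h : Tower A t B t' r K) (hs : 3 ≤ s)
    (ht : 0 < t) (hbe : Adjacent b e) (hae : a ≠ e) (hab : a ≠ b) (hb : K b) (he : K e)
    (hB : OddState t B t' r K a b e) :
    ∃ B', Tower A t B' (t' + 2) r K ∧ EvenState t B' (t' + 2) r K a b e := by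
  obtain ⟨h1, h2, h3⟩ := hB
  obtain ⟨B', k1, k2, k3, k4, k5⟩ := h.step hs ht hbe hb he hab hae
    ⟨_, h2.symm, Or.inr rfl⟩
  exact ⟨B', k1, k2 _ _ h1, k4, k5.symm.trans ((k2 _ _ h2).trans (k3.trans (k2 _ _ h3)))⟩

theorem Tower.exists_oddState {B : Pattern s} {t' : ℕ} (h : Tower A t B t' r K) (hs : 3 ≤ s)
    (ht : 0 < t) (hab : Adjacent a b) (hae : a ≠ e) (hbe : b ≠ e) (ha : K a) (hb : K b)
    (hB : EvenState t B t' r K a b e) :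
    ∃ B', Tower A t B' (t' + 2) r K ∧ OddState t B' (t' + 2) r K a b e := by
  obtain ⟨h1, h2, h3⟩ := hB
  obtain ⟨B', k1, k2, k3, k4, k5⟩ := h.step hs ht hab ha hb hae.symm hbe.symm
    ⟨_, h3, Or.inl (by simpa using ht)⟩
  exact ⟨B', k1, k2 _ _ h1, k4,
    k5.symm.trans ((k2 _ _ h2).symm.trans (k3.symm.trans (k2 _ _ h3)))⟩

theorem exists_oddState (hs : 3 ≤ s) (ht : 0 < t) (hopen : A.Open t) (hadm : A.Admissible t r)
    (hab : Adjacent a b) (hbe : Adjacent b e) (hae : a ≠ e) (hab' : a ≠ b)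
    (hbe' : b ≠ e) (ha : K a) (hb : K b) (he : K e) (n : ℕ) :
    ∃ B, Tower A t B (t + 2 * (2 * n + 1)) r K ∧
      Tower.OddState t B (t + 2 * (2 * n + 1)) r K a b e := by
  induction n with
  | zero =>
    obtain ⟨B', k1, -, k3, k4, k5⟩ := (Tower.refl (K := K) hopen hadm).step hs ht hab ha hb
      hae.symm hbe'.symm ⟨_, Conn.refl _, Or.inl (by simpa using ht)⟩
    exact ⟨B', k1, k3, k4, k5.symm⟩
  | succ n ih =>
    obtain ⟨B, h1, h2⟩ := ih
    obtain ⟨C, k1, k2⟩ := h1.exists_evenState hs ht hbe hae hab' hb he h2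
    obtain ⟨D, l1, l2⟩ := k1.exists_oddState hs ht hab hae hbe' ha hb k2
    exact ⟨D, l1, l2⟩

theorem exists_evenState (hs : 3 ≤ s) (ht : 0 < t) (hopen : A.Open t) (hadm : A.Admissible t r)
    (hab : Adjacent a b) (hbe : Adjacent b e) (hae : a ≠ e) (hab' : a ≠ b)
    (hbe' : b ≠ e) (ha : K a) (hb : K b) (he : K e) (n : ℕ) :
    ∃ B, Tower A t B (t + 2 * (2 * n + 2)) r K ∧
      Tower.EvenState t B (t + 2 * (2 * n + 2)) r K a b e := by
  obtain ⟨B, h1, h2⟩ := exists_oddState hs ht hopen hadm hab hbe hae hab' hbe' ha hb he n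
  exact h1.exists_evenState hs ht hbe hae hab' hb he h2

end Word

/-- If only the connection between `a` and `b` is added to a relation, a path uses it or not. -/
theorem eqvGen_or_of_insert {α : Type*} {ρ ρ' : α → α → Prop} {a b : α}
    (h : ∀ x y, ρ' x y → ρ x y ∨ x = a ∧ y = b) {x y : α} (hxy : EqvGen ρ' x y) :
    EqvGen ρ x y ∨ EqvGen ρ x a ∧ EqvGen ρ b y ∨ EqvGen ρ x b ∧ EqvGen ρ a y := by
  induction hxy with
  | rel x y hxy =>
    rcases h x y hxy with h | ⟨rfl, rfl⟩
    · exact Or.inl (EqvGen.rel _ _ h)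
    · exact Or.inr (Or.inl ⟨EqvGen.refl _, EqvGen.refl _⟩)
  | refl x => exact Or.inl (EqvGen.refl _)
  | symm x y _ ih =>
    rcases ih with ih | ⟨h1, h2⟩ | ⟨h1, h2⟩
    · exact Or.inl (EqvGen.symm _ _ ih)
    · exact Or.inr (Or.inr ⟨EqvGen.symm _ _ h2, EqvGen.symm _ _ h1⟩)
    · exact Or.inr (Or.inl ⟨EqvGen.symm _ _ h2, EqvGen.symm _ _ h1⟩)
  | trans x y z _ _ ih1 ih2 =>
    have tr := fun {x y z : α} => EqvGen.trans (r := ρ) x y z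
    rcases ih1 with ih1 | ⟨h1, h2⟩ | ⟨h1, h2⟩ <;> rcases ih2 with ih2 | ⟨h3, h4⟩ | ⟨h3, h4⟩
    · exact Or.inl (tr ih1 ih2)
    · exact Or.inr (Or.inl ⟨tr ih1 h3, h4⟩)
    · exact Or.inr (Or.inr ⟨tr ih1 h3, h4⟩)
    · exact Or.inr (Or.inl ⟨h1, tr h2 ih2⟩)
    · exact Or.inr (Or.inl ⟨h1, h4⟩)
    · exact Or.inl (tr h1 h4)
    · exact Or.inr (Or.inr ⟨h1, tr h2 ih2⟩)
    · exact Or.inl (tr h1 h4)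
    · exact Or.inr (Or.inr ⟨h1, h4⟩)

/-- The columns `c` and `c + 1` form a crossing seam of an open admissible pattern: with the
diagonal edges from these two columns cut, there are two components, and each of them joins the
upper end of one of the columns to the lower end of the other one. -/
structure CrossingSeam (A : Pattern s) (t : ℕ) (r c : ZMod s) : Prop where
  isOpen : A.Open t
  admissible : A.Admissible t r
  cross_right : Conn A t r (fun j => j = c ∨ j = c + 1) (t - 1, c, false) (0, c + 1 + r, false)
  cross_left : Conn A t r (fun j => j = c ∨ j = c + 1) (t - 1, c + 1, false) (0, c + r, false)
  reach : ∀ i < t, ∀ j d, Conn A t r (fun j => j = c ∨ j = c + 1) (i, j, d) (t - 1, c, false) ∨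
    Conn A t r (fun j => j = c ∨ j = c + 1) (i, j, d) (t - 1, c + 1, false)

/-- A tower gives a tour if the base is connected in it. -/
theorem Tower.hasTour {r : ℕ} {B : Pattern s} {t' : ℕ} (h : Tower A t B t' (r : ZMod s) K)
    (ht : 0 < t) (x₀ : Spot s)
    (hbase : ∀ i < t, ∀ j c, Conn B t' (r : ZMod s) (fun _ => False) (i, j, c) x₀) :
    HasTour (gridPerm s t' r) := by
  refine hasTour_of_conn (by have := h.le; omega) h.admissible x₀ fun i hi j c => ?_
  obtain ⟨⟨i', j', c'⟩, hx, hx' | ⟨k, -, hk⟩⟩ := h.reach i hi j c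
  · exact (hx.mono fun _ h => h.elim).trans (hbase _ hx' _ _)
  · rw [hk] at hx
    exact ((hx.mono fun _ h => h.elim).trans
      (Conn.of_link (GridLink.diag k (h.isOpen k) not_false))).trans (hbase 0 ht _ _)

/-- An open admissible pattern with a crossing seam can be extended by any even number of rows. -/
theorem CrossingSeam.hasTour {r : ℕ} {c : ZMod s} (h : CrossingSeam A t (r : ZMod s) c)
    (hs : 3 ≤ s) (ht : 0 < t) (n : ℕ) : HasTour (gridPerm s (t + 2 * n) r) := by
  have : Fact (1 < s) := ⟨by omega⟩
  have h2 : (2 : ZMod s) ≠ 0 := by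
    intro h0
    have : ((2 : ℕ) : ZMod s) = 0 := by exact_mod_cast h0
    rw [ZMod.natCast_eq_zero_iff] at this
    exact absurd (Nat.le_of_dvd (by omega) this) (by omega)
  have e01 : c ≠ c + 1 := by simp
  have e12 : c + 1 ≠ c + 2 := by
    intro h0
    have h1 : (1 : ZMod s) = 2 := add_left_cancel h0
    exact one_ne_zero (α := ZMod s) (by linear_combination -h1)
  have e02 : c ≠ c + 2 := by simpa using h2
  have a01 : Adjacent c (c + 1) := Or.inl rfl
  have a12 : Adjacent (c + 1) (c + 2) := Or.inl (by ring)
  set K : ZMod s → Prop := fun j => j = c ∨ j = c + 1 ∨ j = c + 2 with hKdef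
  have K0 : K c := Or.inl rfl
  have K1 : K (c + 1) := Or.inr (Or.inl rfl)
  have K2 : K (c + 2) := Or.inr (Or.inr rfl)
  -- Cutting the diagonal edge of a third column as well.
  have hsplit : ∀ x y, Conn A t (r : ZMod s) (fun j => j = c ∨ j = c + 1) x y →
      Conn A t (r : ZMod s) K x y ∨
      Conn A t (r : ZMod s) K x (t - 1, c + 2, false) ∧
        Conn A t (r : ZMod s) K (0, c + 2 + r, false) y ∨
      Conn A t (r : ZMod s) K x (0, c + 2 + r, false) ∧
        Conn A t (r : ZMod s) K (t - 1, c + 2, false) y := by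
    intro x y hxy
    refine eqvGen_or_of_insert ?_ hxy
    rintro x y (⟨i, j, h1, h2⟩ | ⟨i, j, h1, h2⟩ | ⟨j, h1, h2⟩ | ⟨i, j, h1, h2⟩)
    · exact Or.inl (GridLink.red i j h1 h2)
    · exact Or.inl (GridLink.blue i j h1 h2)
    · by_cases hj : j = c + 2
      · exact Or.inr ⟨by rw [hj], by rw [hj]⟩
      · exact Or.inl (GridLink.diag j h1 (by simp only [hKdef]; tauto))
    · exact Or.inl (GridLink.spoke i j h1 h2)
  rcases Nat.eq_zero_or_pos n with rfl | hn
  · -- The diagonal edge at `c` joins the two components.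
    have hd : Conn A t (r : ZMod s) (fun _ => False) (t - 1, c, false) (0, c + r, false) :=
      Conn.of_link (GridLink.diag c (h.isOpen c) not_false)
    have hF : ∀ {x y : Spot s}, Conn A t (r : ZMod s) (fun j => j = c ∨ j = c + 1) x y →
      Conn A t (r : ZMod s) (fun _ => False) x y := fun h => h.mono fun _ h => h.elim
    refine hasTour_of_conn ht h.admissible (t - 1, c, false) fun i hi j d => ?_
    rcases h.reach i hi j d with h1 | h1
    · exact hF h1
    · exact (hF h1).trans ((hF h.cross_left).trans hd.symm)
  rcases Nat.even_or_odd' n with ⟨m, rfl | rfl⟩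
  · have combine : ∀ B : Pattern s, Tower A t B (t + 2 * (2 * m)) (r : ZMod s) K →
        Conn B (t + 2 * (2 * m)) (r : ZMod s) (fun _ => False)
          (t - 1, c, false) (t - 1, c + 1, false) →
        Conn B (t + 2 * (2 * m)) (r : ZMod s) (fun _ => False)
          (t - 1, c, false) (t - 1, c + 2, false) →
        Conn B (t + 2 * (2 * m)) (r : ZMod s) (fun _ => False)
          (t - 1, c, false) (0, c + 2 + r, false) →
        HasTour (gridPerm s (t + 2 * (2 * m)) r) := by
      intro B hB h1 h2 h3
      refine hB.hasTour ht (t - 1, c, false) fun i hi j d => ?_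
      have hF : ∀ {x y : Spot s}, Conn A t (r : ZMod s) K x y →
        Conn B (t + 2 * (2 * m)) (r : ZMod s) (fun _ => False) x y :=
        fun h => (hB.conn _ _ h).mono fun _ h => h.elim
      rcases h.reach i hi j d with h0 | h0 <;>
        rcases hsplit _ _ h0 with h0 | ⟨h0, -⟩ | ⟨h0, -⟩
      · exact hF h0
      · exact (hF h0).trans h2.symm
      · exact (hF h0).trans h3.symm
      · exact (hF h0).trans h1.symm
      · exact (hF h0).trans h2.symm
      · exact (hF h0).trans h3.symm
    obtain ⟨p, rfl⟩ : ∃ p, m = p + 1 := ⟨m - 1, by omega⟩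
    obtain ⟨B, hB, b1, b2, b3⟩ := exists_evenState (K := K) hs ht h.isOpen h.admissible a01 a12 e02
      e01 e12 K0 K1 K2 p
    obtain ⟨B', hB', b1', b2', b3'⟩ := exists_evenState (K := K) hs ht h.isOpen h.admissible
      a12.symm a01.symm e02.symm e12.symm e01.symm K2 K1 K0 p
    have hF : ∀ {x y : Spot s}, Conn A t (r : ZMod s) K x y →
      Conn B (t + 2 * (2 * (p + 1))) (r : ZMod s) (fun _ => False) x y :=
      fun h => (hB.conn _ _ h).mono fun _ h => h.elim
    have hF' : ∀ {x y : Spot s}, Conn A t (r : ZMod s) K x y →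
      Conn B' (t + 2 * (2 * (p + 1))) (r : ZMod s) (fun _ => False) x y :=
      fun h => (hB'.conn _ _ h).mono fun _ h => h.elim
    have dB : ∀ k, Conn B (t + 2 * (2 * (p + 1))) (r : ZMod s) (fun _ => False)
        (t + 2 * (2 * (p + 1)) - 1, k, false) (0, k + r, false) :=
      fun k => Conn.of_link (GridLink.diag k (hB.isOpen k) not_false)
    have dB' : ∀ k, Conn B' (t + 2 * (2 * (p + 1))) (r : ZMod s) (fun _ => False)
        (t + 2 * (2 * (p + 1)) - 1, k, false) (0, k + r, false) :=
      fun k => Conn.of_link (GridLink.diag k (hB'.isOpen k) not_false)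
    have A1 := b1.mono (K' := fun _ => False) fun _ h => h.elim
    have A2 := (dB _).symm.trans ((b2.mono (K' := fun _ => False) fun _ h => h.elim).trans (dB _))
    have A3 := (dB _).symm.trans (b3.mono (K' := fun _ => False) fun _ h => h.elim)
    have B1 := b1'.mono (K' := fun _ => False) fun _ h => h.elim
    have B2 := (dB' _).symm.trans
      ((b2'.mono (K' := fun _ => False) fun _ h => h.elim).trans (dB' _))
    have B3 := (dB' _).symm.trans (b3'.mono (K' := fun _ => False) fun _ h => h.elim)
    rcases hsplit _ _ h.cross_right with α | ⟨α, α'⟩ | ⟨α, α'⟩ <;>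
      rcases hsplit _ _ h.cross_left with β | ⟨β, β'⟩ | ⟨β, β'⟩
    · exact combine B hB A1 (A1.trans ((hF β).trans A3)) ((hF α).trans A2)
    · exact combine B hB A1 (A1.trans (hF β)) ((hF α).trans A2)
    · have := B3.symm.trans (hF' β).symm
      exact combine B' hB' this (this.trans B1.symm) B3.symm
    · exact combine B' hB' ((hF' α).trans B1) (hF' α) B3.symm
    · exact combine B hB A1 (hF α) ((hF α).trans (A3.symm.trans (hF β').symm))
    · exact combine B hB A1 (hF α) (A1.trans (hF β))
    all_goals exact combine B hB A1 ((hF α).trans (A2.symm.trans (hF α').symm)) (hF α)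
  · -- The third column passes through the squares, which join the two ends `c` and `c + 1`.
    obtain ⟨B, hB, b1, b2, b3⟩ := exists_oddState (K := K) hs ht h.isOpen h.admissible a01 a12 e02
      e01 e12 K0 K1 K2 m
    have hF : ∀ {x y : Spot s}, Conn A t (r : ZMod s) K x y →
      Conn B (t + 2 * (2 * m + 1)) (r : ZMod s) (fun _ => False) x y :=
      fun h => (hB.conn _ _ h).mono fun _ h => h.elim
    have d2 : Conn B (t + 2 * (2 * m + 1)) (r : ZMod s) (fun _ => False) (t - 1, c + 2, false)
        (0, c + 2 + r, false) := (b3.symm.mono fun _ h => h.elim).trans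
      (Conn.of_link (GridLink.diag _ (hB.isOpen _) not_false))
    have hG : ∀ x y, Conn A t (r : ZMod s) (fun j => j = c ∨ j = c + 1) x y →
        Conn B (t + 2 * (2 * m + 1)) (r : ZMod s) (fun _ => False) x y := by
      intro x y hxy
      rcases hsplit _ _ hxy with h0 | ⟨h0, h1⟩ | ⟨h0, h1⟩
      · exact hF h0
      · exact (hF h0).trans (d2.trans (hF h1))
      · exact (hF h0).trans (d2.symm.trans (hF h1))
    refine hB.hasTour ht (t - 1, c, false) fun i hi j d => ?_
    rcases h.reach i hi j d with h1 | h1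
    · exact hG _ _ h1
    · exact (hG _ _ h1).trans (b1.symm.mono fun _ h => h.elim)

end Insertion

/-! ### Deleting the edges of a path -/

section Path

/-- The `m`-th column to the right of the column `q`, which is skipped, where `m` is counted from
the position of `q` modulo `s - 1`. -/
def skipColumn (s q : ℕ) (m : ZMod (s - 1)) : ZMod s := q + (((m - (q : ZMod (s - 1))).val : ℕ) : ZMod s) + 1

theorem skipColumn_ne {s : ℕ} (hs : 3 ≤ s) (q : ℕ) (m : ZMod (s - 1)) :
    skipColumn s q m ≠ q := by
  have : NeZero (s - 1) := ⟨by omega⟩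
  intro h
  have hv := ZMod.val_lt (m - (q : ZMod (s - 1)))
  have h1 : (((m - (q : ZMod (s - 1))).val + 1 : ℕ) : ZMod s) = 0 := by
    unfold skipColumn at h
    push_cast
    linear_combination h
  rw [ZMod.natCast_eq_zero_iff] at h1
  exact absurd (Nat.le_of_dvd (by omega) h1) (by omega)

theorem exists_skipColumn_eq {s : ℕ} (hs : 3 ≤ s) (q : ℕ) {j : ZMod s} (hj : j ≠ q) :
    ∃ m, skipColumn s q m = j := by
  have : NeZero s := ⟨by omega⟩
  have : NeZero (s - 1) := ⟨by omega⟩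
  have h0 : (j - (q : ZMod s)).val ≠ 0 := by
    rw [Ne, ZMod.val_eq_zero, sub_eq_zero]
    exact hj
  have h1 := ZMod.val_lt (j - (q : ZMod s))
  refine ⟨(((j - (q : ZMod s)).val - 1 : ℕ) : ZMod (s - 1)) + q, ?_⟩
  unfold skipColumn
  rw [add_sub_cancel_right, ZMod.val_natCast_of_lt (by omega), Nat.cast_sub (by omega),
    ZMod.natCast_zmod_val]
  push_cast
  ring

/-- When `q` moves on by one column, so does the skipped column, and the only position that changes
is the one that is skipped next. -/
theorem skipColumn_succ {s : ℕ} (hs : 3 ≤ s) (q : ℕ) (m : ZMod (s - 1)) :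
    skipColumn s q m = skipColumn s (q + 1) m ∨
      skipColumn s q m = (q + 1 : ℕ) ∧ skipColumn s (q + 1) m = q := by
  have : NeZero (s - 1) := ⟨by omega⟩
  have hv := ZMod.val_lt (m - (q : ZMod (s - 1)))
  have hm : m - (q + 1 : ℕ) = (((m - (q : ZMod (s - 1))).val : ℕ) : ZMod (s - 1)) - 1 := by
    rw [ZMod.natCast_zmod_val]
    push_cast
    ring
  unfold skipColumn
  rw [hm]
  set v := (m - (q : ZMod (s - 1))).val
  rcases Nat.eq_zero_or_pos v with h | h
  · refine Or.inr ⟨by simp [h], ?_⟩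
    have h2 : ((v : ℕ) : ZMod (s - 1)) - 1 = ((s - 1 - 1 : ℕ) : ZMod (s - 1)) := by
      rw [h, Nat.cast_sub (by omega)]
      simp
    rw [h2, ZMod.val_natCast_of_lt (by omega), Nat.cast_sub (by omega), Nat.cast_sub (by omega)]
    push_cast
    rw [ZMod.natCast_self]
    ring
  · left
    have h2 : ((v : ℕ) : ZMod (s - 1)) - 1 = ((v - 1 : ℕ) : ZMod (s - 1)) := by
      rw [Nat.cast_sub h]
      simp
    rw [h2, ZMod.val_natCast_of_lt (by omega), Nat.cast_sub h]
    push_cast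
    ring

/-- Between two rows a path moves by one column, and the skipping enumeration of the columns
follows. -/
theorem skipColumn_step {s : ℕ} (hs : 3 ≤ s) {q q' : ℕ} (hq : q' = q + 1 ∨ q = q' + 1)
    (m : ZMod (s - 1)) :
    skipColumn s q m = skipColumn s q' m ∨
      skipColumn s q m = q' ∧ skipColumn s q' m = q := by
  rcases hq with rfl | rfl
  · exact skipColumn_succ hs q m
  · rcases skipColumn_succ hs q' m with h | ⟨h1, h2⟩
    · exact Or.inl h.symm
    · exact Or.inr ⟨h2, h1⟩

variable {s t r : ℕ}

/-- The deletions along the path that is in column `p i` in row `i` and in column `p (i + 1)` when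
it leaves this row: the edges of the path are deleted. -/
def pathPattern (s : ℕ) (p : ℕ → ℕ) : Pattern s where
  red i j := j = (min (p i) (p (i + 1)) : ℕ)
  blue i j := j = p (i + 1)

variable {p : ℕ → ℕ}

theorem pathPattern_red_or (hp : ∀ i, p (i + 1) = p i + 1 ∨ p i = p (i + 1) + 1) (i : ℕ)
    (j : ZMod s) : ((pathPattern s p).red i j ∨ (pathPattern s p).red i (j - 1)) ↔
      (j = p (i + 1) ∨ j = p i) := by
  simp only [pathPattern]
  rcases hp i with h | h
  · rw [min_eq_left (by omega), h, sub_eq_iff_eq_add, Or.comm]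
    push_cast
    exact Iff.rfl
  · rw [min_eq_right (by omega), h, sub_eq_iff_eq_add]
    push_cast
    exact Iff.rfl

/-- A path of blue and red steps that goes once around the grid upwards and moves by an amount
prime to `s - 1` leaves a tour when its edges are deleted: each row is joined to a single class of
columns, and the `s - 1` classes are permuted cyclically. -/
theorem hasTour_of_path (hs : 3 ≤ s) (ht : 0 < t)
    (hp : ∀ i, p (i + 1) = p i + 1 ∨ p i = p (i + 1) + 1) (h0 : p 0 = 0)
    (hr : ((p t + r : ℕ) : ZMod s) = 0) (hc : (p t).Coprime (s - 1)) :
    HasTour (gridPerm s t r) := by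
  have : NeZero s := ⟨by omega⟩
  have : Fact (1 < s) := ⟨by omega⟩
  have : NeZero (s - 1) := ⟨by omega⟩
  have hne : ∀ i, (p (i + 1) : ZMod s) ≠ p i := by
    intro i
    rcases hp i with h | h <;> rw [h] <;> push_cast <;> simp
  have hbelow : ∀ i < t, ∀ j : ZMod s, (pathPattern s p).below t (r : ZMod s) i j ↔ j = p i := by
    intro i hi j
    simp only [Pattern.below, pathPattern]
    split_ifs with h
    · subst h
      simp only [h0, Nat.cast_zero, Nat.sub_add_cancel ht]
      rw [sub_eq_iff_eq_add, ← Nat.cast_add, hr]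
    · rw [Nat.sub_add_cancel (by omega)]
  set C : Spot s → Spot s → Prop := Conn (pathPattern s p) t (r : ZMod s) (fun _ => False) with hC
  have hrow : ∀ i < t, ∀ j j', C (i, j, true) (i, j', true) :=
    fun i hi j j' => conn_row hi _ (fun j hj => hj) j j'
  have hspoke : ∀ i < t, ∀ j, (j = (p (i + 1) : ZMod s) ∨ j = p i) → C (i, j, true) (i, j, false) :=
    fun i hi j hj => Conn.of_link (GridLink.spoke i j hi ((pathPattern_red_or hp i j).2 hj))
  have hswap : ∀ i < t, C (i, (p (i + 1) : ZMod s), false) (i, p i, false) := fun i hi =>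
    (hspoke i hi _ (Or.inl rfl)).symm.trans ((hrow i hi _ _).trans (hspoke i hi _ (Or.inr rfl)))
  -- The connection of the classes of a row with those of the next one.
  have hstep : ∀ i < t, ∀ m, ∃ j, C (i, skipColumn s (p i) m, false) (i, j, false) ∧
      j = skipColumn s (p (i + 1)) m ∧ ¬(pathPattern s p).blue i j := by
    intro i hi m
    rcases skipColumn_step hs (hp i) m with h | ⟨h1, h2⟩
    · refine ⟨_, Conn.refl _, h, ?_⟩
      rw [h]
      exact skipColumn_ne hs _ m
    · refine ⟨p i, ?_, h2.symm, fun h => hne i h.symm⟩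
      rw [h1]
      exact hswap i hi
  have hup : ∀ i < t, ∀ m, C (0, skipColumn s (p 0) m, false) (i, skipColumn s (p i) m, false) := by
    intro i
    induction i with
    | zero => exact fun _ m => Conn.refl _
    | succ i ih =>
      intro hi m
      obtain ⟨j, h1, h2, h3⟩ := hstep i (by omega) m
      rw [← h2]
      exact (ih (by omega) m).trans (h1.trans (Conn.of_link (GridLink.blue i j hi h3)))
  have hround : ∀ m, C (0, skipColumn s (p 0) m, false) (0, skipColumn s (p 0) (m - p t), false) := by
    intro m
    obtain ⟨j, h1, h2, h3⟩ := hstep (t - 1) (by omega) m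
    have h4 : skipColumn s (p 0) (m - p t) = j + r := by
      rw [h2, Nat.sub_add_cancel ht, h0]
      unfold skipColumn
      push_cast at hr ⊢
      rw [sub_zero]
      linear_combination -hr
    rw [h4]
    exact (hup (t - 1) (by omega) m).trans (h1.trans (Conn.of_link (GridLink.diag j h3 not_false)))
  have hround' : ∀ n : ℕ, ∀ m, C (0, skipColumn s (p 0) m, false)
      (0, skipColumn s (p 0) (m - n * p t), false) := by
    intro n m
    induction n with
    | zero => simpa using Conn.refl _
    | succ n ih =>
      have := hround (m - n * p t)
      rw [sub_sub, ← add_one_mul] at this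
      push_cast
      exact ih.trans this
  have hbase : ∀ m, C (0, skipColumn s (p 0) m, false) (0, skipColumn s (p 0) 0, false) := by
    intro m
    let u := ZMod.unitOfCoprime (p t) hc
    have h1 := hround' (m * (u⁻¹ : (ZMod (s - 1))ˣ)).val m
    rw [ZMod.natCast_zmod_val, mul_assoc] at h1
    have h2 : ((u⁻¹ : (ZMod (s - 1))ˣ) : ZMod (s - 1)) * (p t : ZMod (s - 1)) = 1 := by
      rw [← ZMod.coe_unitOfCoprime (p t) hc]
      exact Units.inv_mul u
    rwa [h2, mul_one, sub_self] at h1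
  have hblue : ∀ i < t, ∀ j, j ≠ (p i : ZMod s) →
      C (i, j, false) (0, skipColumn s (p 0) 0, false) := by
    intro i hi j hj
    obtain ⟨m, rfl⟩ := exists_skipColumn_eq hs (p i) hj
    exact (hup i hi m).symm.trans (hbase m)
  refine hasTour_of_conn (A := pathPattern s p) ht ?_ (0, skipColumn s (p 0) 0, false) ?_
  · intro i hi j
    rw [pathPattern_red_or hp, hbelow i hi]
    refine ⟨?_, ?_, Iff.rfl⟩
    · rintro ⟨h1, h2⟩
      simp only [pathPattern] at h1 h2
      rw [h1] at h2
      simp at h2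
    · rintro ⟨h1, h2⟩
      exact hne i (h1.symm.trans h2)
  · intro i hi j c
    have h1 := hblue i hi _ (hne i)
    cases c
    · by_cases hj : j = p i
      · rw [hj]
        exact (hswap i hi).symm.trans h1
      · exact hblue i hi j hj
    · exact (hrow i hi _ _).trans ((hspoke i hi _ (Or.inl rfl)).trans h1)

/-- The path climbs to column `c` and then moves to and fro between the columns `c` and `c + 1`. -/
theorem hasTour_of_coprime (hs : 3 ≤ s) (ht : 0 < t) {c : ℕ} (hct : c ≤ t)
    (hpar : c % 2 = t % 2) (hr : ((c + r : ℕ) : ZMod s) = 0) (hc : c.Coprime (s - 1)) :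
    HasTour (gridPerm s t r) := by
  obtain ⟨p, hp⟩ : ∃ p : ℕ → ℕ, ∀ i, p i = if i ≤ c then i else c + (i - c) % 2 :=
    ⟨_, fun _ => rfl⟩
  have hpt : p t = c := by
    rw [hp]
    split_ifs <;> omega
  refine hasTour_of_path (p := p) hs ht ?_ (by simp [hp]) (by rwa [hpt]) (by rwa [hpt])
  intro i
  rw [hp, hp]
  split_ifs <;> omega

end Path

/-! ### Deleting the sides of squares -/

section Class

variable {s t : ℕ} {r : ZMod s} {A : Pattern s} {K : ZMod s → Prop}

/-- The component of a spot in the split graph that a pattern leaves, with the diagonal edges from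
the columns in `K` cut. -/
def component (A : Pattern s) (t : ℕ) (r : ZMod s) (K : ZMod s → Prop) (x : Spot s) :
    Quot (GridLink A t r K) := Quot.mk _ x

theorem component_eq_iff {x y : Spot s} :
    component A t r K x = component A t r K y ↔ Conn A t r K x y :=
  ⟨Quot.eqvGen_exact, Quot.eqvGen_sound⟩

/-- The component of the blue copy of the vertex in row `i` and column `n`. -/
def blueClass (A : Pattern s) (t : ℕ) (r : ZMod s) (K : ZMod s → Prop) (i n : ℕ) :
    Quot (GridLink A t r K) := component A t r K (i, (n : ZMod s), false)

theorem blueClass_add_width (i n : ℕ) :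
    blueClass A t r K i (n + s) = blueClass A t r K i n := by
  simp [blueClass]

theorem conn_span {i : ℕ} (hi : i < t) {a b : ℕ} (hab : a ≤ b)
    (h : ∀ k, a ≤ k → k < b → ¬A.red i (k : ZMod s)) :
    Conn A t r K (i, (a : ZMod s), true) (i, (b : ZMod s), true) := by
  induction b, hab using Nat.le_induction with
  | base => exact Conn.refl _
  | succ b hab ih =>
    refine (ih fun k h1 h2 => h k h1 (by omega)).trans ?_
    push_cast
    exact Conn.of_link (GridLink.red i _ hi (h b hab (by omega)))

/-- In a row with a deleted edge, every red copy is joined to a blue one. -/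
theorem exists_conn_blue [NeZero s] {i : ℕ} (hi : i < t) (h : ∃ d, A.red i d) (j : ZMod s) :
    ∃ j', Conn A t r K (i, j, true) (i, j', false) := by
  classical
  have hex : ∃ n : ℕ, A.red i (j + n) := by
    obtain ⟨d, hd⟩ := h
    exact ⟨(d - j).val, by rwa [ZMod.natCast_zmod_val, add_sub_cancel]⟩
  have hn : ∀ n ≤ Nat.find hex, Conn A t r K (i, j, true) (i, j + n, true) := by
    intro n
    induction n with
    | zero =>
      intro _
      simpa using Conn.refl _
    | succ n ih =>
      intro h1
      refine (ih (by omega)).trans ?_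
      push_cast
      rw [← add_assoc]
      exact Conn.of_link (GridLink.red i _ hi (Nat.find_min hex (by omega)))
  exact ⟨_, (hn _ le_rfl).trans
    (Conn.of_link (GridLink.spoke i _ hi (Or.inl (Nat.find_spec hex))))⟩

theorem exists_component_eq_blueClass [NeZero s] (h : ∀ i < t, ∃ d, A.red i d) {i : ℕ} (hi : i < t)
    (j : ZMod s) (c : Bool) : ∃ n < s, component A t r K (i, j, c) = blueClass A t r K i n := by
  have key : ∀ j : ZMod s, ∃ n < s, component A t r K (i, j, false) = blueClass A t r K i n :=
    fun j => ⟨j.val, ZMod.val_lt j, by rw [blueClass, ZMod.natCast_zmod_val]⟩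
  cases c
  · exact key j
  · obtain ⟨j', hj'⟩ := exists_conn_blue (r := r) (K := K) hi (h i hi) j
    obtain ⟨n, hn, h1⟩ := key j'
    exact ⟨n, hn, (component_eq_iff.2 hj').trans h1⟩

theorem blueClass_diag (hopen : A.Open t) {R n : ℕ} (hn : ¬K n) :
    blueClass A t (R : ZMod s) K (t - 1) n = blueClass A t (R : ZMod s) K 0 (n + R) := by
  unfold blueClass
  push_cast
  exact component_eq_iff.2 (Conn.of_link (GridLink.diag _ (hopen _) hn))

end Class

section Squares

variable {s t : ℕ} {r : ZMod s} {K : ZMod s → Prop} {q : ℕ → ℕ → Prop}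

/-- The pattern that deletes the four sides of every square whose lower left corner `(i, c)`
satisfies `q i c`. -/
def squares (s : ℕ) (q : ℕ → ℕ → Prop) : Pattern s where
  red i j := q i j.val ∨ i ≠ 0 ∧ q (i - 1) j.val
  blue i j := q i j.val ∨ j.val ≠ 0 ∧ q i (j.val - 1)

/-- The squares lie in the rows `i < t` and in the columns `j < s`, and no two of them have a
common vertex. -/
structure DisjointSquares (s t : ℕ) (q : ℕ → ℕ → Prop) : Prop where
  bound : ∀ i c, q i c → c + 1 < s ∧ i + 1 < t
  right : ∀ i c, q i c → ¬q i (c + 1)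
  up : ∀ i c, q i c → ¬q (i + 1) c
  up_right : ∀ i c, q i c → ¬q (i + 1) (c + 1)
  up_left : ∀ i c, q i (c + 1) → ¬q (i + 1) c

theorem DisjointSquares.isOpen (hq : DisjointSquares s t q) (ht : 0 < t) :
    (squares s q).Open t := by
  rintro j (h | ⟨-, h⟩)
  · have := hq.bound _ _ h
    omega
  · have := hq.bound _ _ h
    omega

theorem val_sub_one {s : ℕ} (hs : 2 ≤ s) (j : ZMod s) :
    (j - 1).val = if j.val = 0 then s - 1 else j.val - 1 := by
  have : NeZero s := ⟨by omega⟩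
  have h1 := ZMod.val_lt j
  split_ifs with h
  · have h0 : j = 0 := (ZMod.val_eq_zero j).1 h
    have h2 : j - 1 = ((s - 1 : ℕ) : ZMod s) := by
      rw [h0, Nat.cast_sub (by omega)]
      simp
    rw [h2, ZMod.val_natCast_of_lt (by omega)]
  · have h2 : j - 1 = ((j.val - 1 : ℕ) : ZMod s) := by
      rw [Nat.cast_sub (by omega)]
      simp
    rw [h2, ZMod.val_natCast_of_lt (by omega)]

/-- A vertex of a square loses a red and a blue side of it, and no other edges. -/
theorem DisjointSquares.admissible (hq : DisjointSquares s t q) (hs : 2 ≤ s) (ht : 0 < t) :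
    (squares s q).Admissible t r := by
  have : NeZero s := ⟨by omega⟩
  intro i hi j
  have hv := ZMod.val_lt j
  have hbelow : (squares s q).below t r i j ↔
      i ≠ 0 ∧ (q (i - 1) j.val ∨ j.val ≠ 0 ∧ q (i - 1) (j.val - 1)) := by
    unfold Pattern.below
    split_ifs with h
    · simp only [h, ne_eq, not_true_eq_false, false_and, iff_false]
      exact hq.isOpen ht _
    · simp only [ne_eq, h, not_false_eq_true, true_and]
      exact Iff.rfl
  have hleft : (squares s q).red i (j - 1) ↔
      j.val ≠ 0 ∧ (q i (j.val - 1) ∨ i ≠ 0 ∧ q (i - 1) (j.val - 1)) := by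
    simp only [squares, val_sub_one hs]
    split_ifs with h
    · have h1 : ∀ i, ¬q i (s - 1) := fun i h => by
        have := hq.bound _ _ h
        omega
      simp [h1, h]
    · simp [h]
  rw [hbelow, hleft]
  simp only [squares]
  generalize j.val = v at *
  rcases v with _ | v <;> rcases i with _ | i <;> simp only [ne_eq, not_true_eq_false, false_and,
    or_false, and_false, not_false_eq_true, Nat.add_eq_zero_iff, one_ne_zero, true_and,
    Nat.add_sub_cancel]
  · have := hq.up i 0
    grind
  · have := hq.right 0 v
    grind
  · have h1 := hq.right i v
    have h2 := hq.right (i + 1) v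
    have h3 := hq.up i v
    have h4 := hq.up i (v + 1)
    have h5 := hq.up_right i v
    have h6 := hq.up_left i v
    clear hbelow hleft
    grind

/-- The edge from `(i, n)` to `(i, n + 1)` is a side of a square. -/
def Cut (q : ℕ → ℕ → Prop) (i n : ℕ) : Prop := q i n ∨ i ≠ 0 ∧ q (i - 1) n

theorem squares_red_natCast {i n : ℕ} (hn : n < s) :
    (squares s q).red i (n : ZMod s) ↔ Cut q i n := by
  simp [squares, Cut, ZMod.val_natCast_of_lt hn]

theorem squares_rise {i n : ℕ} (hi : i + 1 < t) (hn : n < s) (h1 : ¬q i n)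
    (h2 : n = 0 ∨ ¬q i (n - 1)) :
    blueClass (squares s q) t r K i n = blueClass (squares s q) t r K (i + 1) n := by
  refine component_eq_iff.2 (Conn.of_link (GridLink.blue i _ hi ?_))
  simp only [squares, ZMod.val_natCast_of_lt hn]
  tauto

theorem squares_spoke_left {i n : ℕ} (hi : i < t) (hn : n < s) (h : Cut q i n) :
    Conn (squares s q) t r K (i, (n : ZMod s), true) (i, (n : ZMod s), false) :=
  Conn.of_link (GridLink.spoke i _ hi (Or.inl ((squares_red_natCast hn).2 h)))

theorem squares_spoke_right {i n : ℕ} (hi : i < t) (hn : n < s) (h : Cut q i n) :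
    Conn (squares s q) t r K (i, ((n + 1 : ℕ) : ZMod s), true)
      (i, ((n + 1 : ℕ) : ZMod s), false) := by
  refine Conn.of_link (GridLink.spoke i _ hi (Or.inr ?_))
  have h1 : (((n + 1 : ℕ) : ZMod s) - 1) = (n : ZMod s) := by
    push_cast
    ring
  rw [h1]
  exact (squares_red_natCast hn).2 h

/-- Between two consecutive squares, a row joins their facing corners. -/
theorem squares_between {i a b : ℕ} (hi : i < t) (hab : a < b) (hb : b < s) (ha : Cut q i a)
    (hb' : Cut q i b) (h : ∀ k, a < k → k < b → ¬Cut q i k) :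
    blueClass (squares s q) t r K i (a + 1) = blueClass (squares s q) t r K i b := by
  refine component_eq_iff.2 ((squares_spoke_right hi (by omega) ha).symm.trans
    (Conn.trans (conn_span hi hab fun k h1 h2 => ?_) (squares_spoke_left hi hb hb')))
  rw [squares_red_natCast (by omega)]
  exact h k (by omega) h2

/-- Around the end of a row, the last square is joined to the first one. -/
theorem squares_around {i a b : ℕ} (hi : i < t) (hab : a ≤ b) (hb : b < s) (ha : Cut q i a)
    (hb' : Cut q i b) (h1 : ∀ k < a, ¬Cut q i k) (h2 : ∀ k, b < k → k < s → ¬Cut q i k) :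
    blueClass (squares s q) t r K i (b + 1) = blueClass (squares s q) t r K i a := by
  have h3 : Conn (squares s q) t r K (i, ((b + 1 : ℕ) : ZMod s), true)
      (i, ((a + s : ℕ) : ZMod s), true) := by
    refine conn_span hi (by omega) fun k h3 h4 => ?_
    rcases lt_or_ge k s with hk | hk
    · rw [squares_red_natCast hk]
      exact h2 k (by omega) hk
    · obtain ⟨k, rfl⟩ := Nat.exists_eq_add_of_le' hk
      rw [Nat.cast_add, ZMod.natCast_self, add_zero, squares_red_natCast (by omega)]
      exact h1 k (by omega)
  rw [Nat.cast_add, Nat.cast_add a, ZMod.natCast_self, add_zero, ← Nat.cast_add] at h3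
  exact component_eq_iff.2 ((squares_spoke_right hi (by omega) hb').symm.trans
    (h3.trans (squares_spoke_left hi (by omega) ha)))

theorem squares_reach (hs : 0 < s) (h : ∀ i < t, ∃ n < s, Cut q i n) {i : ℕ} (hi : i < t)
    (j : ZMod s) (c : Bool) :
    ∃ n < s, component (squares s q) t r K (i, j, c) = blueClass (squares s q) t r K i n := by
  have : NeZero s := ⟨by omega⟩
  refine exists_component_eq_blueClass (fun i hi => ?_) hi j c
  obtain ⟨n, hn, h1⟩ := h i hi
  exact ⟨n, (squares_red_natCast hn).2 h1⟩

/-- A crossing seam in terms of classes. -/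
theorem crossingSeam_squares {R c : ℕ} (hs : 2 ≤ s) (ht : 0 < t) (hq : DisjointSquares s t q)
    (hrow : ∀ i < t, ∃ n < s, Cut q i n)
    (K : ZMod s → Prop) (hK : K = fun j => j = (c : ZMod s) ∨ j = (c : ZMod s) + 1)
    (h1 : blueClass (squares s q) t (R : ZMod s) K (t - 1) c =
      blueClass (squares s q) t (R : ZMod s) K 0 (c + 1 + R))
    (h2 : blueClass (squares s q) t (R : ZMod s) K (t - 1) (c + 1) =
      blueClass (squares s q) t (R : ZMod s) K 0 (c + R))
    (h3 : ∀ i < t, ∀ n < s, blueClass (squares s q) t (R : ZMod s) K i n =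
      blueClass (squares s q) t (R : ZMod s) K (t - 1) c ∨
      blueClass (squares s q) t (R : ZMod s) K i n =
        blueClass (squares s q) t (R : ZMod s) K (t - 1) (c + 1)) :
    CrossingSeam (squares s q) t (R : ZMod s) (c : ZMod s) := by
  subst hK
  refine ⟨hq.isOpen ht, hq.admissible hs ht, ?_, ?_, ?_⟩
  · have := component_eq_iff.1 h1
    push_cast at this
    exact this
  · have := component_eq_iff.1 h2
    push_cast at this
    exact this
  · intro i hi j d
    obtain ⟨n, hn, h⟩ := squares_reach (r := (R : ZMod s))
      (K := fun j => j = (c : ZMod s) ∨ j = (c : ZMod s) + 1) (by omega) hrow hi j d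
    rcases h3 i hi n hn with h4 | h4
    · exact Or.inl (component_eq_iff.1 (h.trans h4))
    · have := component_eq_iff.1 (h.trans h4)
      push_cast at this
      exact Or.inr this

end Squares

/-! ### Strands -/

section Strands

variable {β : Type*}

/-- The combinatorial core of the crossing seams: `ρ` upper ends `U n` and `ρ` lower ends `B n`,
with `U n` joined to `B (n - d)` modulo `ρ`, except that `U (d - 1)` ends in `Z`, and with
neighbours joined in pairs on both sides, except that `U (ρ - 1)` ends in `X`. As `d` is odd, the
resulting two paths run through everything. -/
theorem folded_strands {ρ d : ℕ} {U B : ℕ → β} {Z X : β} (hρ : ρ % 2 = 0) (hd : d % 2 = 1)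
    (hdρ : d < ρ) (chain_lt : ∀ n, n + 1 < d → U n = B (n + ρ - d)) (chain_end : U (d - 1) = Z)
    (chain_ge : ∀ n, d ≤ n → n < ρ → U n = B (n - d))
    (hB : ∀ i, 0 < i → 2 * i < ρ → B (2 * i - 1) = B (2 * i)) (hB0 : B (ρ - 1) = B 0)
    (hU : ∀ i, 0 < i → 2 * i < ρ → U (2 * i - 1) = U (2 * i)) (hU0 : U (ρ - 1) = X) :
    U 0 = Z ∧ B (ρ - 1) = X ∧ ∀ n < ρ, (U n = Z ∨ U n = X) ∧ (B n = Z ∨ B n = X) := by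
  have first : ∀ i, 2 * i < d → U (2 * i) = U 0 := by
    intro i
    induction i with
    | zero => exact fun _ => rfl
    | succ i ih =>
      intro hi
      have h1 := chain_lt (2 * i) (by omega)
      have h2 := hB ((2 * i + ρ - d + 1) / 2) (by omega) (by omega)
      have h3 := chain_lt (2 * i + 1) (by omega)
      have h4 := hU (i + 1) (by omega) (by omega)
      rw [show 2 * ((2 * i + ρ - d + 1) / 2) - 1 = 2 * i + ρ - d by omega,
        show 2 * ((2 * i + ρ - d + 1) / 2) = 2 * i + 1 + ρ - d by omega] at h2
      rw [show 2 * (i + 1) - 1 = 2 * i + 1 by omega] at h4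
      rw [← h4, h3, ← h2, ← h1, ih (by omega)]
  have second : ∀ i, d + 2 * i < ρ → U (d + 2 * i) = B (ρ - 1) := by
    intro i
    induction i with
    | zero =>
      intro hi
      rw [chain_ge (d + 2 * 0) (by omega) hi, show d + 2 * 0 - d = 0 by omega, hB0]
    | succ i ih =>
      intro hi
      have h1 := hU ((d + 2 * i + 1) / 2) (by omega) (by omega)
      have h2 := chain_ge (d + 2 * i + 1) (by omega) (by omega)
      have h3 := hB (i + 1) (by omega) (by omega)
      have h4 := chain_ge (d + 2 * (i + 1)) (by omega) hi
      rw [show 2 * ((d + 2 * i + 1) / 2) - 1 = d + 2 * i by omega,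
        show 2 * ((d + 2 * i + 1) / 2) = d + 2 * i + 1 by omega] at h1
      rw [show d + 2 * i + 1 - d = 2 * (i + 1) - 1 by omega] at h2
      rw [show d + 2 * (i + 1) - d = 2 * (i + 1) by omega] at h4
      rw [h4, ← h3, ← h2, ← h1, ih (by omega)]
  have hUZ : U 0 = Z := by
    have := first ((d - 1) / 2) (by omega)
    rw [show 2 * ((d - 1) / 2) = d - 1 by omega] at this
    rw [← this, chain_end]
  have hBX : B (ρ - 1) = X := by
    have := second ((ρ - 1 - d) / 2) (by omega)
    rw [show d + 2 * ((ρ - 1 - d) / 2) = ρ - 1 by omega] at this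
    rw [← this, hU0]
  have allU : ∀ n < ρ, U n = Z ∨ U n = X := by
    intro n hn
    rcases lt_or_ge n d with h | h
    · left
      rcases Nat.even_or_odd' n with ⟨k, rfl | rfl⟩
      · rw [first k h, hUZ]
      · have h1 := hU (k + 1) (by omega) (by omega)
        rw [show 2 * k + 1 = 2 * (k + 1) - 1 by omega, h1, first (k + 1) (by omega), hUZ]
    · right
      rcases Nat.even_or_odd' n with ⟨k, rfl | rfl⟩
      · have h1 := second ((2 * k - 1 - d) / 2) (by omega)
        rw [show d + 2 * ((2 * k - 1 - d) / 2) = 2 * k - 1 by omega,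
          hU k (by omega) (by omega)] at h1
        rw [h1, hBX]
      · have h1 := second ((2 * k + 1 - d) / 2) (by omega)
        rw [show d + 2 * ((2 * k + 1 - d) / 2) = 2 * k + 1 by omega] at h1
        rw [h1, hBX]
  refine ⟨hUZ, hBX, fun n hn => ⟨allU n hn, ?_⟩⟩
  rcases lt_or_ge (n + d) ρ with h | h
  · have := chain_ge (n + d) (by omega) h
    rw [Nat.add_sub_cancel] at this
    rw [← this]
    exact allU _ h
  · rcases eq_or_ne n (ρ - 1) with rfl | h1
    · exact Or.inr hBX
    · have := chain_lt (n + d - ρ) (by omega)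
      rw [show n + d - ρ + ρ - d = n by omega] at this
      rw [← this]
      exact allU _ (by omega)

/-- The strands of a pattern with `m` columns: the upper end of column `n` is joined to the lower
end of the column that is `ρ` further, cyclically, except for `n = 0` and `n = m - 1`. -/
def Strands (m ρ : ℕ) (T B : ℕ → β) : Prop :=
  ∀ n, 0 < n → n + 1 < m → (n + ρ < m → T n = B (n + ρ)) ∧ (m ≤ n + ρ → T n = B (n + ρ - m))

variable {m ρ : ℕ} {T B : ℕ → β}

theorem Strands.walk (h : Strands m ρ T B) {a : ℕ} (hρ : 0 < ρ)
    (hfree : ∀ n, ρ + a ≤ n → n < m → B n = T n) (k : ℕ) {n : ℕ} (h0 : 0 < n) (ha : a ≤ n)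
    (hn : n + k * ρ < m) : T n = T (n + k * ρ) := by
  induction k with
  | zero => simp
  | succ k ih =>
    rw [Nat.succ_mul] at hn ⊢
    have h1 := (h (n + k * ρ) (by omega) (by omega)).1 (by omega)
    rw [ih (by omega), h1, hfree (n + k * ρ + ρ) (by omega) (by omega)]
    rw [add_assoc]

/-- Squares in the columns `0, 1, …, ρ - 1` of a single level. -/
theorem Strands.cross_of_row (h : Strands m ρ T B) (hm : m % 2 = 1) (hρ : ρ % 2 = 0) (h0 : 0 < ρ)
    (hρm : ρ < m) (hfree : ∀ n, ρ ≤ n → n < m → B n = T n)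
    (hB : ∀ i, 0 < i → 2 * i < ρ → B (2 * i - 1) = B (2 * i)) (hB0 : B (ρ - 1) = B 0)
    (hT : ∀ i, 0 < i → 2 * i < ρ → T (2 * i - 1) = T (2 * i)) (hT0 : T (ρ - 1) = T 0) :
    T (m - 1) = B ρ ∧ T 0 = B (ρ - 1) ∧ ∀ n < m, (T n = T (m - 1) ∨ T n = T 0) ∧
      (B n = T (m - 1) ∨ B n = T 0) := by
  obtain ⟨g, e, d, hd, hg, rfl⟩ : ∃ g e d, d < ρ ∧ g = e * ρ ∧ m = g + ρ + d := by
    refine ⟨_, m / ρ - 1, m % ρ, Nat.mod_lt _ h0, rfl, ?_⟩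
    have h1 := Nat.div_add_mod' m ρ
    have h2 : 1 ≤ m / ρ := (Nat.one_le_div_iff h0).2 hρm.le
    obtain ⟨k, hk⟩ := Nat.exists_eq_add_of_le' h2
    rw [hk] at h1 ⊢
    rw [Nat.succ_mul] at h1
    simp only [Nat.add_sub_cancel]
    omega
  have hgpar : g % 2 = 0 := by
    rw [hg, Nat.mul_mod, hρ]
    simp
  have hg' : g + ρ = (e + 1) * ρ := by rw [hg, Nat.succ_mul]
  have walk := fun k n => h.walk (a := 0) h0 (by simpa using hfree) k (n := n)
  have walk_g : ∀ n, 0 < n → n < ρ + d → T n = T (n + g) := by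
    intro n h1 h2
    have := walk e n h1 (Nat.zero_le _) (by rw [← hg]; omega)
    rwa [← hg] at this
  have walk_gρ : ∀ n, 0 < n → n < d → T n = T (n + (g + ρ)) := by
    intro n h1 h2
    have := walk (e + 1) n h1 (Nat.zero_le _) (by rw [← hg']; omega)
    rwa [← hg'] at this
  refine And.elim ?_ (folded_strands (ρ := ρ) (d := d) (U := fun n => if n = 0 then B ρ else T n)
    (B := B) (Z := T (g + ρ + d - 1)) (X := T 0) hρ (by omega) hd ?_ ?_ ?_ hB hB0 ?_ ?_)
  · rintro h1 ⟨h2, h3⟩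
    rw [if_pos rfl] at h1
    refine ⟨h1.symm, h2.symm, ?_⟩
    have hTall : ∀ k n, n + k = g + ρ + d - 1 → (T n = T (g + ρ + d - 1) ∨ T n = T 0) := by
      intro k
      induction k using Nat.strong_induction_on with
      | _ k ih =>
        intro n hn
        rcases eq_or_ne n 0 with rfl | hn0
        · exact Or.inr rfl
        rcases eq_or_ne k 0 with rfl | hk0
        · rw [← hn]
          exact Or.inl rfl
        rcases lt_or_ge (n + ρ) (g + ρ + d) with h4 | h4
        · rw [(h n (by omega) (by omega)).1 h4, hfree _ (by omega) h4]
          exact ih (k - ρ) (by omega) _ (by omega)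
        · rw [(h n (by omega) (by omega)).2 h4]
          exact (h3 _ (by omega)).2
    intro n hn
    refine ⟨hTall (g + ρ + d - 1 - n) n (by omega), ?_⟩
    rcases lt_or_ge n ρ with h4 | h4
    · exact (h3 n h4).2
    · rw [hfree n h4 hn]
      exact hTall (g + ρ + d - 1 - n) n (by omega)
  · intro n hn
    split_ifs with h4
    · rw [hfree ρ le_rfl hρm, walk_g ρ h0 (by omega), (h _ (by omega) (by omega)).2 (by omega)]
      congr 1
      omega
    · rw [walk_gρ n (by omega) (by omega), (h _ (by omega) (by omega)).2 (by omega)]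
      congr 1
      omega
  · split_ifs with h4
    · rw [hfree ρ le_rfl hρm, walk_g ρ h0 (by omega)]
      congr 1
      omega
    · rw [walk_gρ _ (by omega) (by omega)]
      congr 1
      omega
  · intro n h4 h5
    rw [if_neg (by omega), walk_g n (by omega) (by omega), (h _ (by omega) (by omega)).2 (by omega)]
    congr 1
    omega
  · intro i h4 h5
    rw [if_neg (by omega), if_neg (by omega), hT i h4 h5]
  · rw [if_neg (by omega), hT0]

/-- Squares in the columns `0, 1, …, ρ - 1` of the lower level, and one in the columns `ρ + 1` and
`ρ + 2` of the upper level. The columns `ρ + 1` and `ρ + 2` take the role that the columns `1` and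
`2` have without the last square. -/
theorem Strands.cross_of_two_rows (h : Strands m ρ T B) (hm : m % 2 = 1) (hρ : ρ % 2 = 0)
    (h0 : 4 ≤ ρ) (hρm : ρ + 3 ≤ m) (hfree : ∀ n, ρ + 3 ≤ n → n < m → B n = T n)
    (hfree' : B ρ = T ρ)
    (hB : ∀ i, 0 < i → 2 * i < ρ → B (2 * i - 1) = B (2 * i)) (hB0 : B (ρ - 1) = B 0)
    (hT : ∀ i, 0 < i → 2 * i < ρ → T (2 * i - 1) = T (2 * i)) (hT1 : T (ρ - 1) = B (ρ + 1))
    (hT2 : B (ρ + 2) = T 0) (hT3 : T (ρ + 1) = T (ρ + 2)) :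
    T (m - 1) = B ρ ∧ T 0 = B (ρ - 1) ∧ ∀ n < m, (T n = T (m - 1) ∨ T n = T 0) ∧
      (B n = T (m - 1) ∨ B n = T 0) := by
  obtain ⟨g, e, d, hd, hg, rfl⟩ : ∃ g e d, d < ρ ∧ g = e * ρ ∧ m = g + ρ + d := by
    refine ⟨_, m / ρ - 1, m % ρ, Nat.mod_lt _ (by omega), rfl, ?_⟩
    have h1 := Nat.div_add_mod' m ρ
    have h2 : 1 ≤ m / ρ := (Nat.one_le_div_iff (by omega)).2 (by omega)
    obtain ⟨k, hk⟩ := Nat.exists_eq_add_of_le' h2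
    rw [hk] at h1 ⊢
    rw [Nat.succ_mul] at h1
    simp only [Nat.add_sub_cancel]
    omega
  have hgpar : g % 2 = 0 := by
    rw [hg, Nat.mul_mod, hρ]
    simp
  have hg' : g + ρ = (e + 1) * ρ := by rw [hg, Nat.succ_mul]
  have hge : d = 1 → ∃ g', g = g' + ρ ∧ g' = (e - 1) * ρ := by
    intro hd1
    rcases e with _ | e
    · simp at hg
      omega
    · exact ⟨e * ρ, by rw [hg, Nat.succ_mul], by simp⟩
  have walk := fun k n => h.walk (a := 3) (by omega) hfree k (n := n)
  have walk_g : ∀ n, 3 ≤ n → n < ρ + d → T n = T (n + g) := by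
    intro n h1 h2
    have := walk e n (by omega) h1 (by rw [← hg]; omega)
    rwa [← hg] at this
  have walk_gρ : ∀ n, 3 ≤ n → n < d → T n = T (n + (g + ρ)) := by
    intro n h1 h2
    have := walk (e + 1) n (by omega) h1 (by rw [← hg']; omega)
    rwa [← hg'] at this
  have h12 : B (ρ + 1) = T 0 := by
    rw [← hT2]
    have e1 := (h 1 (by omega) (by omega)).1 (by omega)
    have e2 := (h 2 (by omega) (by omega)).1 (by omega)
    have e3 := hT 1 (by omega) (by omega)
    rw [show ρ + 1 = 1 + ρ by omega, show ρ + 2 = 2 + ρ by omega, ← e1, ← e2]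
    exact e3
  refine And.elim ?_ (folded_strands (ρ := ρ) (d := d)
    (U := fun n => if n = 0 then B ρ else if n < 3 then T (ρ + n) else T n)
    (B := B) (Z := T (g + ρ + d - 1)) (X := T 0) hρ (by omega) hd ?_ ?_ ?_ hB hB0 ?_ ?_)
  · rintro h1 ⟨h2, h3⟩
    rw [if_pos rfl] at h1
    refine ⟨h1.symm, h2.symm, ?_⟩
    have hTall : ∀ k n, n + k = g + ρ + d - 1 → (T n = T (g + ρ + d - 1) ∨ T n = T 0) := by
      intro k
      induction k using Nat.strong_induction_on with
      | _ k ih =>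
        intro n hn
        rcases eq_or_ne n 0 with rfl | hn0
        · exact Or.inr rfl
        rcases eq_or_ne k 0 with rfl | hk0
        · rw [← hn]
          exact Or.inl rfl
        rcases lt_or_ge (n + ρ) (g + ρ + d) with h4 | h4
        · rw [(h n (by omega) (by omega)).1 h4]
          rcases eq_or_ne n 1 with rfl | hn1
          · rw [add_comm, h12]
            exact Or.inr rfl
          rcases eq_or_ne n 2 with rfl | hn2
          · rw [add_comm, hT2]
            exact Or.inr rfl
          rw [hfree _ (by omega) h4]
          exact ih (k - ρ) (by omega) _ (by omega)
        · rw [(h n (by omega) (by omega)).2 h4]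
          exact (h3 _ (by omega)).2
    intro n hn
    refine ⟨hTall (g + ρ + d - 1 - n) n (by omega), ?_⟩
    rcases lt_or_ge n ρ with h4 | h4
    · exact (h3 n h4).2
    rcases eq_or_ne n ρ with rfl | h5
    · exact Or.inl h1
    rcases eq_or_ne n (ρ + 1) with rfl | h6
    · exact Or.inr h12
    rcases eq_or_ne n (ρ + 2) with rfl | h7
    · exact Or.inr hT2
    · rw [hfree n (by omega) hn]
      exact hTall (g + ρ + d - 1 - n) n (by omega)
  · intro n hn
    split_ifs with h4 h5
    · rw [hfree', walk_g ρ (by omega) (by omega), (h _ (by omega) (by omega)).2 (by omega)]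
      congr 1
      omega
    · rw [walk_g _ (by omega) (by omega), (h _ (by omega) (by omega)).2 (by omega)]
      congr 1
      omega
    · rw [walk_gρ n (by omega) (by omega), (h _ (by omega) (by omega)).2 (by omega)]
      congr 1
      omega
  · split_ifs with h4 h5
    · rw [hfree', walk_g ρ (by omega) (by omega)]
      congr 1
      omega
    · rw [walk_g _ (by omega) (by omega)]
      congr 1
      omega
    · rw [walk_gρ _ (by omega) (by omega)]
      congr 1
      omega
  · intro n h4 h5
    rw [if_neg (by omega)]
    split_ifs with h6
    · obtain ⟨g', hg1, hg2⟩ := hge (by omega)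
      have := walk (e - 1) (ρ + n) (by omega) (by omega) (by omega)
      rw [this, ← hg2, (h _ (by omega) (by omega)).2 (by omega)]
      congr 1
      omega
    · rw [walk_g n (by omega) (by omega), (h _ (by omega) (by omega)).2 (by omega)]
      congr 1
      omega
  · intro i h4 h5
    rcases eq_or_ne i 1 with rfl | h6
    · simpa using hT3
    · simp only [show 2 * i - 1 ≠ 0 by omega, show 2 * i ≠ 0 by omega, show ¬2 * i - 1 < 3 by omega,
        show ¬2 * i < 3 by omega, if_false]
      exact hT i h4 h5
  · simp only [show ρ - 1 ≠ 0 by omega, show ¬ρ - 1 < 3 by omega, if_false]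
    rw [hT1, h12]

end Strands

/-! ### Odd numbers of columns and one or two levels of squares -/

section WideStrands

variable {β : Type*} {s m R ρ : ℕ} {T B : ℕ → β}

/-- Two ways in which the diagonal edges with shift `R` join the columns like a shift by `ρ` of `m`
columns: directly, or, if the columns from `m` on are free, after passing twice. -/
def Wide (s m R ρ : ℕ) : Prop := m = s ∧ R = ρ ∨ m < s ∧ R = m ∧ s + ρ = 2 * m

/-- The upper end of column `n` is joined to the lower end of column `n + ρ` modulo `m`, provided
that neither `n` nor `n + m` is cut. -/
theorem Wide.diag (hw : Wide s m R ρ) (hB : ∀ n, B (n + s) = B n)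
    (hfree : ∀ n, m ≤ n → n < s → B n = T n) {n : ℕ} (hn : n < m) (h1 : T n = B (n + R))
    (h2 : n + m < s → T (n + m) = B (n + m + R)) :
    (n + ρ < m → T n = B (n + ρ)) ∧ (m ≤ n + ρ → T n = B (n + ρ - m)) := by
  rcases hw with ⟨rfl, rfl⟩ | ⟨hm, rfl, hs⟩
  · refine ⟨fun _ => h1, fun h => ?_⟩
    rw [h1, ← hB (n + R - m), Nat.sub_add_cancel h]
  · refine ⟨fun h => ?_, fun h => ?_⟩
    · rw [h1, hfree (n + R) (by omega) (by omega), h2 (by omega), ← hB (n + ρ)]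
      congr 1
      omega
    · rw [h1, ← hB (n + ρ - R)]
      congr 1
      omega

theorem Wide.add_eq (hw : Wide s m R ρ) (hB : ∀ n, B (n + s) = B n) {n k : ℕ}
    (h : n + ρ = k + m) : B (n + R) = B k := by
  rw [← hB k]
  congr 1
  rcases hw with ⟨rfl, rfl⟩ | ⟨hm, rfl, hs⟩ <;> omega

end WideStrands

section Seam

variable {s t : ℕ}

/-- The two columns of a seam. -/
def seam (s c : ℕ) (j : ZMod s) : Prop := j = (c : ZMod s) ∨ j = (c : ZMod s) + 1

theorem not_seam {c n : ℕ} (hn : n < s) (hc : c < s) (h1 : n ≠ c) (h2 : n ≠ c + 1)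
    (h3 : c + 1 = s → n ≠ 0) : ¬seam s c (n : ZMod s) := by
  have : NeZero s := ⟨by omega⟩
  rintro (h | h)
  · rw [ZMod.natCast_eq_natCast_iff', Nat.mod_eq_of_lt hn, Nat.mod_eq_of_lt hc] at h
    exact h1 h
  · rw [← Nat.cast_add_one, ZMod.natCast_eq_natCast_iff', Nat.mod_eq_of_lt hn] at h
    rcases eq_or_ne (c + 1) s with h4 | h4
    · rw [h4, Nat.mod_self] at h
      exact h3 h4 h
    · rw [Nat.mod_eq_of_lt (by omega)] at h
      exact h2 h

/-- The seam in the columns `m - 1` and `m` crosses if the strands do. -/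
theorem Wide.crossingSeam {m R ρ : ℕ} (hw : Wide s m R ρ) {q : ℕ → ℕ → Prop} (ht : 0 < t)
    (hq : DisjointSquares s t q) (hrow : ∀ i < t, ∃ n < s, Cut q i n) (hm : 3 ≤ m) (hρ : 0 < ρ)
    {T B : ℕ → Quot (GridLink (squares s q) t (R : ZMod s) (seam s (m - 1)))}
    (hT : T = blueClass (squares s q) t (R : ZMod s) (seam s (m - 1)) (t - 1))
    (hB : B = blueClass (squares s q) t (R : ZMod s) (seam s (m - 1)) 0)
    (hfree : ∀ n, m ≤ n → n < s → B n = T n)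
    (hcross : Strands m ρ T B → T (m - 1) = B ρ ∧ T 0 = B (ρ - 1) ∧
      ∀ n < m, (T n = T (m - 1) ∨ T n = T 0) ∧ (B n = T (m - 1) ∨ B n = T 0))
    (hreach : ∀ i < t, ∀ n < s, ∃ n' < s,
      blueClass (squares s q) t (R : ZMod s) (seam s (m - 1)) i n = T n' ∨
      blueClass (squares s q) t (R : ZMod s) (seam s (m - 1)) i n = B n') :
    CrossingSeam (squares s q) t (R : ZMod s) ((m - 1 : ℕ) : ZMod s) := by
  have hms : m ≤ s := by
    rcases hw with h | h <;> omega
  have perB : ∀ n, B (n + s) = B n := fun n => by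
    rw [hB]
    exact blueClass_add_width 0 n
  have perT : ∀ n, T (n + s) = T n := fun n => by
    rw [hT]
    exact blueClass_add_width (t - 1) n
  have diag : ∀ n < s, n ≠ m - 1 → n ≠ m → (m = s → n ≠ 0) → T n = B (n + R) := by
    intro n hn h1 h2 h3
    rw [hT, hB]
    exact blueClass_diag (hq.isOpen ht) (not_seam hn (by omega) h1 (by omega) fun h =>
      h3 (by omega))
  have hstr : Strands m ρ T B := fun n h1 h2 =>
    hw.diag perB hfree (by omega) (diag n (by omega) (by omega) (by omega) (by omega))
      fun h => diag (n + m) h (by omega) (by omega) (by omega)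
  obtain ⟨h1, h2, h3⟩ := hcross hstr
  have hTm : T m = T 0 := by
    rcases hw with ⟨rfl, rfl⟩ | ⟨hm', rfl, hs⟩
    · have := perT 0
      rwa [Nat.zero_add] at this
    · rw [← hfree _ le_rfl hm', diag 0 (by omega) (by omega) (by omega) (by omega), Nat.zero_add]
  have hTall : ∀ n < s, T n = T (m - 1) ∨ T n = T 0 := by
    intro n hn
    rcases lt_or_ge n m with h4 | h4
    · exact (h3 n h4).1
    rcases eq_or_ne n m with rfl | h5
    · exact Or.inr hTm
    rw [diag n hn (by omega) h5 (by omega)]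
    rcases hw with ⟨rfl, rfl⟩ | ⟨hm', rfl, hs⟩
    · omega
    · have := perB (n + R - s)
      rw [Nat.sub_add_cancel (by omega)] at this
      rw [this]
      exact (h3 _ (by omega)).2
  have hBall : ∀ n < s, B n = T (m - 1) ∨ B n = T 0 := by
    intro n hn
    rcases lt_or_ge n m with h4 | h4
    · exact (h3 n h4).2
    · rw [hfree n h4 hn]
      exact hTall n hn
  refine crossingSeam_squares (by omega) ht hq hrow (seam s (m - 1)) rfl ?_ ?_ ?_
  · rw [← hT, ← hB, h1, Nat.sub_add_cancel (by omega)]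
    exact (hw.add_eq perB (by omega)).symm
  · rw [← hT, ← hB, Nat.sub_add_cancel (by omega), hTm, h2]
    exact (hw.add_eq perB (by omega)).symm
  · intro i hi n hn
    rw [← hT, Nat.sub_add_cancel (by omega), hTm]
    obtain ⟨n', hn', h4 | h4⟩ := hreach i hi n hn
    · rw [h4]
      exact hTall n' hn'
    · rw [h4]
      exact hBall n' hn'

end Seam

section TwoRows

variable {s : ℕ} {r : ZMod s} {K : ZMod s → Prop} {a b : ℕ}

/-- Squares in the first `a` columns of the lowest level, and one square in column `b` of the next
level. -/
def twoRowSquares (a b : ℕ) (i c : ℕ) : Prop := i = 0 ∧ c % 2 = 0 ∧ c < a ∨ i = 1 ∧ c = b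

theorem twoRowSquares_disjoint (ha : a % 2 = 0) (hab : a ≤ b) (hb : b + 1 < s) :
    DisjointSquares s 3 (twoRowSquares a b) := by
  refine ⟨?_, ?_, ?_, ?_, ?_⟩ <;> unfold twoRowSquares <;> omega

theorem twoRowSquares_row (ha : 0 < a) (hb : b + 1 < s) :
    ∀ i < 3, ∃ n < s, Cut (twoRowSquares a b) i n := by
  intro i hi
  unfold Cut twoRowSquares
  interval_cases i
  · exact ⟨0, by omega, by omega⟩
  · exact ⟨0, by omega, by omega⟩
  · exact ⟨b, by omega, by omega⟩

/-- The connections inside the rows and columns for `twoRowSquares`; `B`, `C` and `T` are the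
components of the blue copies of the three rows. -/
structure TwoRowRelations {β : Type*} (s a b : ℕ) (B C T : ℕ → β) : Prop where
  low : ∀ i, 0 < i → 2 * i < a → B (2 * i - 1) = B (2 * i)
  low_around : B (a - 1) = B 0
  mid : ∀ i, 0 < i → 2 * i < a → C (2 * i - 1) = C (2 * i)
  mid_between : C (a - 1) = C b
  mid_around : C (b + 1) = C 0
  high_around : T (b + 1) = T b
  rise_low : ∀ n, a ≤ n → n < s → B n = C n
  rise_high : ∀ n, n ≠ b → n ≠ b + 1 → n < s → C n = T n

theorem twoRowSquares_relations (ha : a % 2 = 0) (ha0 : 0 < a) (hab : a ≤ b) (hb : b + 1 < s) :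
    TwoRowRelations s a b (blueClass (squares s (twoRowSquares a b)) 3 r K 0)
      (blueClass (squares s (twoRowSquares a b)) 3 r K 1)
      (blueClass (squares s (twoRowSquares a b)) 3 r K 2) where
  low i h1 h2 := by
    have := squares_between (s := s) (t := 3) (r := r) (K := K) (q := twoRowSquares a b) (i := 0)
      (a := 2 * i - 2) (b := 2 * i) (by omega) (by omega) (by omega)
    rw [show 2 * i - 2 + 1 = 2 * i - 1 by omega] at this
    apply this <;> unfold Cut twoRowSquares <;> omega
  low_around := by
    have := squares_around (s := s) (t := 3) (r := r) (K := K) (q := twoRowSquares a b) (i := 0)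
      (a := 0) (b := a - 2) (by omega) (by omega) (by omega)
    rw [show a - 2 + 1 = a - 1 by omega] at this
    apply this <;> unfold Cut twoRowSquares <;> omega
  mid i h1 h2 := by
    have := squares_between (s := s) (t := 3) (r := r) (K := K) (q := twoRowSquares a b) (i := 1)
      (a := 2 * i - 2) (b := 2 * i) (by omega) (by omega) (by omega)
    rw [show 2 * i - 2 + 1 = 2 * i - 1 by omega] at this
    apply this <;> unfold Cut twoRowSquares <;> omega
  mid_between := by
    have := squares_between (s := s) (t := 3) (r := r) (K := K) (q := twoRowSquares a b) (i := 1)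
      (a := a - 2) (b := b) (by omega) (by omega) (by omega)
    rw [show a - 2 + 1 = a - 1 by omega] at this
    apply this <;> unfold Cut twoRowSquares <;> omega
  mid_around := by
    apply squares_around (by omega) (by omega) (by omega) <;> unfold Cut twoRowSquares <;> omega
  high_around := by
    apply squares_around (by omega) le_rfl (by omega) <;> unfold Cut twoRowSquares <;> omega
  rise_low n h1 h2 := by
    apply squares_rise (by omega) h2 <;> unfold twoRowSquares <;> omega
  rise_high n h1 h2 h3 := by
    apply squares_rise (by omega) h3 <;> unfold twoRowSquares <;> omega

/-- The seam for a shift `ρ` of at least `4` on three rows. -/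
theorem crossingSeam_twoRowSquares {m R ρ : ℕ} (hw : Wide s m R ρ) (hm : m % 2 = 1)
    (hρ : ρ % 2 = 0) (h4 : 4 ≤ ρ) (hρm : ρ + 3 ≤ m) :
    CrossingSeam (squares s (twoRowSquares ρ (ρ + 1))) 3 (R : ZMod s) ((m - 1 : ℕ) : ZMod s) := by
  have hms : m ≤ s := by
    rcases hw with h | h <;> omega
  have rel := twoRowSquares_relations (s := s) (r := (R : ZMod s)) (K := seam s (m - 1)) hρ
    (by omega) (Nat.le_succ ρ) (by omega)
  refine hw.crossingSeam (by omega) (twoRowSquares_disjoint hρ (by omega) (by omega))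
    (twoRowSquares_row (by omega) (by omega)) (by omega) (by omega) rfl rfl ?_ ?_ ?_
  · intro n h1 h2
    exact (rel.rise_low n (by omega) h2).trans (rel.rise_high n (by omega) (by omega) h2)
  · intro hstr
    refine hstr.cross_of_two_rows hm hρ h4 hρm ?_ ?_ rel.low rel.low_around ?_ ?_ ?_ ?_
    · intro n h1 h2
      exact (rel.rise_low n (by omega) (by omega)).trans
        (rel.rise_high n (by omega) (by omega) (by omega))
    · exact (rel.rise_low ρ (by omega) (by omega)).trans
        (rel.rise_high ρ (by omega) (by omega) (by omega))
    · intro i h1 h2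
      exact (rel.rise_high _ (by omega) (by omega) (by omega)).symm.trans
        ((rel.mid i h1 h2).trans (rel.rise_high _ (by omega) (by omega) (by omega)))
    · exact (rel.rise_high _ (by omega) (by omega) (by omega)).symm.trans
        (rel.mid_between.trans (rel.rise_low _ (by omega) (by omega)).symm)
    · exact (rel.rise_low _ (by omega) (by omega)).trans
        (rel.mid_around.trans (rel.rise_high _ (by omega) (by omega) (by omega)))
    · exact rel.high_around.symm
  · intro i hi n hn
    refine ⟨n, hn, ?_⟩
    interval_cases i
    · exact Or.inr rfl
    · by_cases h : n = ρ + 1 ∨ n = ρ + 1 + 1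
      · exact Or.inr (rel.rise_low n (by omega) hn).symm
      · exact Or.inl (rel.rise_high n (by omega) (by omega) hn)
    · exact Or.inl rfl

/-- The seam for the shift `2` on three rows. -/
theorem crossingSeam_twoRowSquares_two {m R : ℕ} (hw : Wide s m R 2) (hm : m % 2 = 1)
    (h7 : 7 ≤ m) :
    CrossingSeam (squares s (twoRowSquares 4 4)) 3 (R : ZMod s) ((2 : ℕ) : ZMod s) := by
  have hms : m ≤ s := by
    rcases hw with h | h <;> omega
  have rel := twoRowSquares_relations (s := s) (a := 4) (b := 4) (r := (R : ZMod s))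
    (K := seam s 2) rfl (by omega) le_rfl (by omega)
  have hq : DisjointSquares s 3 (twoRowSquares 4 4) :=
    twoRowSquares_disjoint rfl le_rfl (by omega)
  set B := blueClass (squares s (twoRowSquares 4 4)) 3 (R : ZMod s) (seam s 2) 0 with hB
  set C := blueClass (squares s (twoRowSquares 4 4)) 3 (R : ZMod s) (seam s 2) 1 with hC
  set T := blueClass (squares s (twoRowSquares 4 4)) 3 (R : ZMod s) (seam s 2) 2 with hT
  have perB : ∀ n, B (n + s) = B n := fun n => blueClass_add_width 0 n
  have hfree : ∀ n, 6 ≤ n → n < s → B n = T n := fun n h1 h2 =>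
    (rel.rise_low n (by omega) h2).trans (rel.rise_high n (by omega) (by omega) h2)
  have diag : ∀ n < s, n ≠ 2 → n ≠ 3 → T n = B (n + R) := fun n hn h1 h2 =>
    blueClass_diag (hq.isOpen (by omega)) (not_seam hn (by omega) h1 h2 (by omega))
  have hstr : ∀ n, n ≠ 2 → n ≠ 3 → n < m →
      (n + 2 < m → T n = B (n + 2)) ∧ (m ≤ n + 2 → T n = B (n + 2 - m)) := fun n h1 h2 h3 =>
    hw.diag perB (fun n h4 h5 => hfree n (by omega) h5) h3 (diag n (by omega) h1 h2)
      fun h => diag (n + m) h (by omega) (by omega)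
  have walk : ∀ k n, 4 ≤ n → n + 2 * k < m → T (n + 2 * k) = T n := by
    intro k n hn
    induction k with
    | zero => exact fun _ => rfl
    | succ k ih =>
      intro hk
      rw [← ih (by omega), (hstr (n + 2 * k) (by omega) (by omega) (by omega)).1 (by omega),
        hfree _ (by omega) (by omega)]
      rfl
  have t4 : T 4 = B 1 := by
    have h1 := walk ((m - 1 - 4) / 2) 4 le_rfl (by omega)
    rw [show 4 + 2 * ((m - 1 - 4) / 2) = m - 1 by omega] at h1
    rw [← h1, (hstr (m - 1) (by omega) (by omega) (by omega)).2 (by omega)]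
    congr 1
    omega
  have t5 : T 5 = B 0 := by
    have h1 := walk ((m - 2 - 5) / 2) 5 (by omega) (by omega)
    rw [show 5 + 2 * ((m - 2 - 5) / 2) = m - 2 by omega] at h1
    rw [← h1, (hstr (m - 2) (by omega) (by omega) (by omega)).2 (by omega)]
    congr 1
    omega
  have t0 : T 0 = B 2 := (hstr 0 (by omega) (by omega) (by omega)).1 (by omega)
  have t1 : T 1 = B 3 := (hstr 1 (by omega) (by omega) (by omega)).1 (by omega)
  have b12 : B 1 = B 2 := rel.low 1 (by omega) (by omega)
  have b30 : B 3 = B 0 := rel.low_around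
  have t12 : T 1 = T 2 := (rel.rise_high 1 (by omega) (by omega) (by omega)).symm.trans
    ((rel.mid 1 (by omega) (by omega)).trans
      (rel.rise_high 2 (by omega) (by omega) (by omega)))
  have t3 : T 3 = B 4 := (rel.rise_high 3 (by omega) (by omega) (by omega)).symm.trans
    (rel.mid_between.trans (rel.rise_low 4 (by omega) (by omega)).symm)
  have b5 : B 5 = T 0 := (rel.rise_low 5 (by omega) (by omega)).trans
    (rel.mid_around.trans (rel.rise_high 0 (by omega) (by omega) (by omega)))
  have t54 : T 5 = T 4 := rel.high_around
  -- All of these classes, with the exception of `T 3 = B 4`, are equal.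
  have e0 : T 0 = T 2 := by rw [t0, ← b12, ← t4, ← t54, t5, ← b30, ← t1, t12]
  have e4 : T 4 = T 2 := by rw [t4, b12, ← t0, e0]
  have e5 : T 5 = T 2 := by rw [t54, e4]
  have hB2 : ∀ k, k < 2 → B (k + 2 + R) = B (k + 4) := by
    intro k hk
    rcases hw with ⟨rfl, rfl⟩ | ⟨hm', rfl, hs⟩
    · rfl
    · rw [hfree _ (by omega) (by omega), diag _ (by omega) (by omega) (by omega), ← perB (k + 4)]
      congr 1
      omega
  have hTm : ∀ n < m, T n = T 2 ∨ T n = T 3 := by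
    intro n hn
    rcases lt_or_ge n 4 with h | h
    · interval_cases n
      · exact Or.inl e0
      · exact Or.inl t12
      · exact Or.inl rfl
      · exact Or.inr rfl
    · left
      rcases Nat.even_or_odd' n with ⟨k, rfl | rfl⟩
      · have := walk (k - 2) 4 le_rfl (by omega)
        rwa [show 4 + 2 * (k - 2) = 2 * k by omega, e4] at this
      · have := walk (k - 2) 5 (by omega) (by omega)
        rwa [show 5 + 2 * (k - 2) = 2 * k + 1 by omega, e5] at this
  have hBm : ∀ n < m, B n = T 2 ∨ B n = T 3 := by
    intro n hn
    rcases lt_or_ge n 6 with h | h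
    · interval_cases n
      · exact Or.inl (t5.symm.trans e5)
      · exact Or.inl (t4.symm.trans e4)
      · exact Or.inl (t0.symm.trans e0)
      · exact Or.inl (t1.symm.trans t12)
      · exact Or.inr t3.symm
      · exact Or.inl (b5.trans e0)
    · rw [hfree n h (by omega)]
      exact hTm n hn
  have hTall : ∀ n < s, T n = T 2 ∨ T n = T 3 := by
    intro n hn
    rcases lt_or_ge n m with h4 | h4
    · exact hTm n h4
    rw [diag n hn (by omega) (by omega)]
    rcases hw with ⟨rfl, rfl⟩ | ⟨hm', rfl, hs⟩
    · omega
    · have := perB (n + R - s)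
      rw [Nat.sub_add_cancel (by omega)] at this
      rw [this]
      exact hBm _ (by omega)
  have hBall : ∀ n < s, B n = T 2 ∨ B n = T 3 := by
    intro n hn
    rcases lt_or_ge n m with h4 | h4
    · exact hBm n h4
    · rw [hfree n (by omega) hn]
      exact hTall n hn
  refine crossingSeam_squares (by omega) (by omega) hq (twoRowSquares_row (by omega) (by omega))
    (seam s 2) rfl ?_ ?_ ?_
  · exact e0.symm.trans (b5.symm.trans (hB2 1 (by omega)).symm)
  · exact t3.trans (hB2 0 (by omega)).symm
  · intro i hi n hn
    interval_cases i
    · exact hBall n hn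
    · by_cases h : n = 4 ∨ n = 5
      · have := hBall n hn
        rwa [rel.rise_low n (by omega) hn] at this
      · have := hTall n hn
        rwa [← rel.rise_high n (by omega) (by omega) hn] at this
    · exact hTall n hn

/-- Squares in the first `a` columns of the lowest level. -/
def rowSquares (a : ℕ) (i c : ℕ) : Prop := i = 0 ∧ c % 2 = 0 ∧ c < a

/-- The seam for two rows. -/
theorem crossingSeam_rowSquares {ρ : ℕ} (hs : s % 2 = 1) (hρ : ρ % 2 = 0) (h0 : 0 < ρ)
    (hρs : ρ < s) :
    CrossingSeam (squares s (rowSquares ρ)) 2 (ρ : ZMod s) ((s - 1 : ℕ) : ZMod s) := by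
  have hq : DisjointSquares s 2 (rowSquares ρ) := by
    refine ⟨?_, ?_, ?_, ?_, ?_⟩ <;> unfold rowSquares <;> omega
  have between : ∀ j < 2, ∀ i, 0 < i → 2 * i < ρ →
      blueClass (squares s (rowSquares ρ)) 2 (ρ : ZMod s) (seam s (s - 1)) j (2 * i - 1) =
        blueClass (squares s (rowSquares ρ)) 2 (ρ : ZMod s) (seam s (s - 1)) j (2 * i) := by
    intro j hj i h1 h2
    have := squares_between (s := s) (t := 2) (r := (ρ : ZMod s)) (K := seam s (s - 1))
      (q := rowSquares ρ) (i := j) (a := 2 * i - 2) (b := 2 * i) hj (by omega) (by omega)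
    rw [show 2 * i - 2 + 1 = 2 * i - 1 by omega] at this
    apply this <;> unfold Cut rowSquares <;> omega
  have around : ∀ j < 2,
      blueClass (squares s (rowSquares ρ)) 2 (ρ : ZMod s) (seam s (s - 1)) j (ρ - 1) =
        blueClass (squares s (rowSquares ρ)) 2 (ρ : ZMod s) (seam s (s - 1)) j 0 := by
    intro j hj
    have := squares_around (s := s) (t := 2) (r := (ρ : ZMod s)) (K := seam s (s - 1))
      (q := rowSquares ρ) (i := j) (a := 0) (b := ρ - 2) hj (by omega) (by omega)
    rw [show ρ - 2 + 1 = ρ - 1 by omega] at this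
    apply this <;> unfold Cut rowSquares <;> omega
  refine Wide.crossingSeam (Or.inl ⟨rfl, rfl⟩) (by omega) hq ?_ (by omega) h0 rfl rfl ?_ ?_ ?_
  · intro i hi
    refine ⟨0, by omega, ?_⟩
    unfold Cut rowSquares
    omega
  · intro n h1 h2
    omega
  · intro hstr
    refine hstr.cross_of_row hs hρ h0 hρs ?_ (between 0 (by omega)) (around 0 (by omega))
      (between 1 (by omega)) (around 1 (by omega))
    intro n h1 h2
    apply squares_rise (by omega) h2 <;> unfold rowSquares <;> omega
  · intro i hi n hn
    refine ⟨n, hn, ?_⟩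
    interval_cases i
    · exact Or.inr rfl
    · exact Or.inl rfl

end TwoRows

/-! ### Odd numbers of columns and shift zero -/

section FourRows

variable {s : ℕ}

/-- Squares in the columns `0, 1`, the columns `2, 3`, and so on, alternately in level `1` and in
level `0`, and two squares that share the column `s - 2` in the last three columns. -/
def zigzagSquares (s i c : ℕ) : Prop :=
  c % 2 = 0 ∧ c + 3 < s ∧ (i = 1 ∧ c % 4 = 0 ∨ i = 0 ∧ c % 4 = 2) ∨ i = 0 ∧ c + 2 = s ∨
    i = 2 ∧ c + 3 = s

theorem zigzagSquares_disjoint (hs : s % 2 = 1) :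
    DisjointSquares s 4 (zigzagSquares s) := by
  refine ⟨?_, ?_, ?_, ?_, ?_⟩ <;> unfold zigzagSquares <;> omega

theorem zigzagSquares_row (h3 : 3 ≤ s) :
    ∀ i < 4, ∃ n < s, Cut (zigzagSquares s) i n := by
  intro i hi
  unfold Cut zigzagSquares
  interval_cases i
  · exact ⟨s - 2, by omega, by omega⟩
  · exact ⟨s - 2, by omega, by omega⟩
  · exact ⟨s - 3, by omega, by omega⟩
  · exact ⟨s - 3, by omega, by omega⟩

/-- The seam for the shift `0` on four rows. -/
theorem crossingSeam_zigzagSquares (hs : s % 2 = 1) (h5 : 5 ≤ s) :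
    CrossingSeam (squares s (zigzagSquares s)) 4 ((0 : ℕ) : ZMod s) ((s - 1 : ℕ) : ZMod s) := by
  have hq := zigzagSquares_disjoint hs
  set C := blueClass (squares s (zigzagSquares s)) 4 ((0 : ℕ) : ZMod s) (seam s (s - 1)) with hC
  have per : ∀ i, C i s = C i 0 := fun i => by
    have := blueClass_add_width (A := squares s (zigzagSquares s)) (t := 4)
      (r := ((0 : ℕ) : ZMod s)) (K := seam s (s - 1)) i 0
    rwa [Nat.zero_add] at this
  have diag : ∀ n, 0 < n → n + 1 < s → C 3 n = C 0 n := fun n h1 h2 =>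
    blueClass_diag (hq.isOpen (by omega)) (not_seam (by omega) (by omega) (by omega) (by omega)
      (by omega))
  have rise : ∀ i n, i < 3 → n < s → ¬zigzagSquares s i n →
      (n = 0 ∨ ¬zigzagSquares s i (n - 1)) → C i n = C (i + 1) n := fun i n hi hn h1 h2 =>
    squares_rise (by omega) hn h1 h2
  -- The four copies in a column between the first and the last three columns form one class.
  have col : ∀ i < 4, ∀ n, 0 < n → n + 3 < s → C i n = C 0 n := by
    intro i hi n h1 h2
    have e3 := diag n h1 (by omega)
    have e2 : C 2 n = C 3 n := by
      apply rise 2 <;> (try unfold zigzagSquares) <;> omega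
    by_cases h : n % 4 < 2
    · have e0 : C 0 n = C 1 n := by
        apply rise 0 <;> (try unfold zigzagSquares) <;> omega
      interval_cases i
      · rfl
      · exact e0.symm
      · exact e2.trans e3
      · exact e3
    · have e1 : C 1 n = C 2 n := by
        apply rise 1 <;> (try unfold zigzagSquares) <;> omega
      interval_cases i
      · rfl
      · exact e1.trans (e2.trans e3)
      · exact e2.trans e3
      · exact e3
  have row0 : ∀ k, k % 2 = 1 → 2 * k + 7 < s → C 0 (2 * k + 1) = C 0 (2 * k + 4) := by
    intro k h1 h2
    apply squares_between <;> (try unfold Cut zigzagSquares) <;> omega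
  have row0' : ∀ k, k % 2 = 1 → 2 * k + 3 < s → s ≤ 2 * k + 7 → C 0 (2 * k + 1) = C 0 (s - 2) := by
    intro k h1 h2 h3
    apply squares_between <;> (try unfold Cut zigzagSquares) <;> omega
  have row1 : ∀ k, 2 * k + 5 < s → C 1 (2 * k + 1) = C 1 (2 * k + 2) := by
    intro k h2
    apply squares_between <;> (try unfold Cut zigzagSquares) <;> omega
  have row1' : ∀ k, 2 * k + 5 = s → C 1 (2 * k + 1) = C 1 (s - 2) := by
    intro k h2
    apply squares_between <;> (try unfold Cut zigzagSquares) <;> omega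
  have row2 : ∀ k, k % 2 = 0 → 2 * k + 7 < s → C 2 (2 * k + 1) = C 2 (2 * k + 4) := by
    intro k h1 h2
    apply squares_between <;> (try unfold Cut zigzagSquares) <;> omega
  have row2' : ∀ k, k % 2 = 0 → 2 * k + 3 < s → s ≤ 2 * k + 7 → C 2 (2 * k + 1) = C 2 (s - 3) := by
    intro k h1 h2 h3
    apply squares_between <;> (try unfold Cut zigzagSquares) <;> omega
  have around0 : 7 ≤ s → C 0 (s - 1) = C 0 2 := by
    intro h7
    have := squares_around (s := s) (t := 4) (r := ((0 : ℕ) : ZMod s)) (K := seam s (s - 1))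
      (q := zigzagSquares s) (i := 0) (a := 2) (b := s - 2) (by omega) (by omega) (by omega)
    rw [show s - 2 + 1 = s - 1 by omega] at this
    apply this <;> (try unfold Cut zigzagSquares) <;> omega
  have around0' : s = 5 → C 0 (s - 1) = C 0 (s - 2) := by
    intro h7
    have := squares_around (s := s) (t := 4) (r := ((0 : ℕ) : ZMod s)) (K := seam s (s - 1))
      (q := zigzagSquares s) (i := 0) (a := s - 2) (b := s - 2) (by omega) (by omega) (by omega)
    rw [show s - 2 + 1 = s - 1 by omega] at this
    apply this <;> (try unfold Cut zigzagSquares) <;> omega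
  have around1 : C 1 (s - 1) = C 1 0 := by
    have := squares_around (s := s) (t := 4) (r := ((0 : ℕ) : ZMod s)) (K := seam s (s - 1))
      (q := zigzagSquares s) (i := 1) (a := 0) (b := s - 2) (by omega) (by omega) (by omega)
    rw [show s - 2 + 1 = s - 1 by omega] at this
    apply this <;> (try unfold Cut zigzagSquares) <;> omega
  have around2 : C 2 (s - 2) = C 2 0 := by
    have := squares_around (s := s) (t := 4) (r := ((0 : ℕ) : ZMod s)) (K := seam s (s - 1))
      (q := zigzagSquares s) (i := 2) (a := 0) (b := s - 3) (by omega) (by omega) (by omega)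
    rw [show s - 3 + 1 = s - 2 by omega] at this
    apply this <;> (try unfold Cut zigzagSquares) <;> omega
  have around3 : C 3 (s - 2) = C 3 (s - 3) := by
    have := squares_around (s := s) (t := 4) (r := ((0 : ℕ) : ZMod s)) (K := seam s (s - 1))
      (q := zigzagSquares s) (i := 3) (a := s - 3) (b := s - 3) (by omega) (by omega) (by omega)
    rw [show s - 3 + 1 = s - 2 by omega] at this
    apply this <;> (try unfold Cut zigzagSquares) <;> omega
  have first01 : C 0 0 = C 1 0 := by
    apply rise 0 <;> (try unfold zigzagSquares) <;> omega
  have first23 : C 2 0 = C 3 0 := by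
    apply rise 2 <;> (try unfold zigzagSquares) <;> omega
  have third01 : C 0 (s - 3) = C 1 (s - 3) := by
    apply rise 0 <;> (try unfold zigzagSquares) <;> omega
  have third12 : C 1 (s - 3) = C 2 (s - 3) := by
    apply rise 1 <;> (try unfold zigzagSquares) <;> omega
  have second12 : C 1 (s - 2) = C 2 (s - 2) := by
    apply rise 1 <;> (try unfold zigzagSquares) <;> omega
  have last12 : C 1 (s - 1) = C 2 (s - 1) := by
    apply rise 1 <;> (try unfold zigzagSquares) <;> omega
  have last23 : C 2 (s - 1) = C 3 (s - 1) := by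
    apply rise 2 <;> (try unfold zigzagSquares) <;> omega
  have third3 := diag (s - 3) (by omega) (by omega)
  have second3 := diag (s - 2) (by omega) (by omega)
  -- All middle columns belong to the class of column `s - 3`.
  have odd : ∀ d k, 2 * k + 5 + 2 * d = s → C 0 (2 * k + 1) = C 0 (s - 3) := by
    intro d
    induction d with
    | zero =>
      intro k hk
      rcases Nat.mod_two_eq_zero_or_one k with h | h
      · rw [← col 2 (by omega) (2 * k + 1) (by omega) (by omega),
          row2' k h (by omega) (by omega), third01, third12]
      · rw [row0' k h (by omega) (by omega), ← second3, around3, third3]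
    | succ d ih =>
      intro k hk
      rcases d with _ | d
      · rcases Nat.mod_two_eq_zero_or_one k with h | h
        · rw [← col 2 (by omega) (2 * k + 1) (by omega) (by omega),
            row2' k h (by omega) (by omega), third01, third12]
        · rw [row0' k h (by omega) (by omega), ← second3, around3, third3]
      · have h1 := row1 (k + 1) (by omega)
        rw [show 2 * (k + 1) + 2 = 2 * k + 4 by omega] at h1
        rw [col 1 (by omega) _ (by omega) (by omega), col 1 (by omega) _ (by omega) (by omega),
          ih (k + 1) (by omega)] at h1
        rcases Nat.mod_two_eq_zero_or_one k with h | h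
        · rw [← col 2 (by omega) (2 * k + 1) (by omega) (by omega), row2 k h (by omega),
            col 2 (by omega) _ (by omega) (by omega), h1]
        · rw [row0 k h (by omega), h1]
  have middle : ∀ n, 0 < n → n + 3 < s → C 0 n = C 0 (s - 3) := by
    intro n h1 h2
    rcases Nat.even_or_odd' n with ⟨k, rfl | rfl⟩
    · have h3 := row1 (k - 1) (by omega)
      rw [col 1 (by omega) _ (by omega) (by omega), col 1 (by omega) _ (by omega) (by omega),
        odd ((s - (2 * (k - 1) + 5)) / 2) (k - 1) (by omega)] at h3
      rw [h3]
      congr 1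
      omega
    · exact odd ((s - (2 * k + 5)) / 2) k (by omega)
  have hf : C 1 (s - 2) = C 0 (s - 3) := by
    rw [← row1' ((s - 5) / 2) (by omega), col 1 (by omega) _ (by omega) (by omega),
      middle _ (by omega) (by omega)]
  have hT0 : C 3 0 = C 0 (s - 3) := by rw [← first23, ← around2, ← second12, hf]
  have hf3 : C 3 (s - 2) = C 0 (s - 3) := around3.trans third3
  have hBg : C 0 (s - 1) = C 0 (s - 3) := by
    rcases eq_or_ne s 5 with h | h
    · rw [around0' h, ← second3, hf3]
    · rw [around0 (by omega), middle 2 (by omega) (by omega)]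
  have hTg : C 3 (s - 1) = C 0 0 := by rw [← last23, ← last12, around1, first01]
  have hs1 : s - 1 + 1 = s := by omega
  refine crossingSeam_squares (by omega) (by omega) hq (zigzagSquares_row (by omega))
    (seam s (s - 1)) rfl ?_ ?_ ?_
  · change C 3 (s - 1) = C 0 (s - 1 + 1 + 0)
    rw [Nat.add_zero, hs1, per, hTg]
  · change C 3 (s - 1 + 1) = C 0 (s - 1 + 0)
    rw [hs1, Nat.add_zero, per, hT0, hBg]
  · intro i hi n hn
    change C i n = C 3 (s - 1) ∨ C i n = C 3 (s - 1 + 1)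
    rw [hs1, per, hT0, hTg]
    rcases eq_or_ne n 0 with rfl | h0
    · interval_cases i
      · exact Or.inl rfl
      · exact Or.inl first01.symm
      · exact Or.inr (first23.trans hT0)
      · exact Or.inr hT0
    rcases lt_or_ge (n + 3) s with h1 | h1
    · exact Or.inr ((col i hi n (by omega) h1).trans (middle n (by omega) h1))
    rcases (show n = s - 3 ∨ n = s - 2 ∨ n = s - 1 by omega) with rfl | rfl | rfl
    · interval_cases i
      · exact Or.inr rfl
      · exact Or.inr third01.symm
      · exact Or.inr (third01.trans third12).symm
      · exact Or.inr third3
    · interval_cases i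
      · exact Or.inr (second3.symm.trans hf3)
      · exact Or.inr hf
      · exact Or.inr (second12.symm.trans hf)
      · exact Or.inr hf3
    · interval_cases i
      · exact Or.inr hBg
      · exact Or.inl (around1.trans first01.symm)
      · exact Or.inl (last12.symm.trans (around1.trans first01.symm))
      · exact Or.inl hTg

/-- The seam for three columns, four rows and the shift `0`. -/
theorem crossingSeam_zigzagSquares_three :
    CrossingSeam (squares 3 (zigzagSquares 3)) 4 ((0 : ℕ) : ZMod 3) ((2 : ℕ) : ZMod 3) := by
  have hq := zigzagSquares_disjoint (s := 3) rfl
  set C := blueClass (squares 3 (zigzagSquares 3)) 4 ((0 : ℕ) : ZMod 3) (seam 3 2) with hC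
  have per : ∀ i, C i 3 = C i 0 := fun i =>
    blueClass_add_width (A := squares 3 (zigzagSquares 3)) (t := 4)
      (r := ((0 : ℕ) : ZMod 3)) (K := seam 3 2) i 0
  have diag : C 3 1 = C 0 1 :=
    blueClass_diag (hq.isOpen (by omega)) (not_seam (by omega) (by omega) (by omega) (by omega)
      (by omega))
  have rise : ∀ i n, i < 3 → n < 3 → ¬zigzagSquares 3 i n →
      (n = 0 ∨ ¬zigzagSquares 3 i (n - 1)) → C i n = C (i + 1) n := fun i n hi hn h1 h2 =>
    squares_rise (by omega) hn h1 h2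
  have around : ∀ i a, i < 4 → a < 3 → Cut (zigzagSquares 3) i a →
      (∀ k < 3, k ≠ a → ¬Cut (zigzagSquares 3) i k) → C i (a + 1) = C i a :=
    fun i a hi ha h h' => squares_around hi le_rfl ha h h (fun k hk => h' k (by omega) (by omega))
      (fun k h1 h2 => h' k h2 (by omega))
  have r0 : C 0 2 = C 0 1 := by
    apply around 0 1 <;> (try unfold Cut zigzagSquares) <;> omega
  have r1 : C 1 2 = C 1 1 := by
    apply around 1 1 <;> (try unfold Cut zigzagSquares) <;> omega
  have r2 : C 2 1 = C 2 0 := by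
    apply around 2 0 <;> (try unfold Cut zigzagSquares) <;> omega
  have r3 : C 3 1 = C 3 0 := by
    apply around 3 0 <;> (try unfold Cut zigzagSquares) <;> omega
  have v00 : C 0 0 = C 1 0 := by
    apply rise 0 <;> (try unfold zigzagSquares) <;> omega
  have v10 : C 1 0 = C 2 0 := by
    apply rise 1 <;> (try unfold zigzagSquares) <;> omega
  have v11 : C 1 1 = C 2 1 := by
    apply rise 1 <;> (try unfold zigzagSquares) <;> omega
  have v12 : C 1 2 = C 2 2 := by
    apply rise 1 <;> (try unfold zigzagSquares) <;> omega
  have v22 : C 2 2 = C 3 2 := by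
    apply rise 2 <;> (try unfold zigzagSquares) <;> omega
  refine crossingSeam_squares (by omega) (by omega) hq (zigzagSquares_row (by omega))
    (seam 3 2) rfl ?_ ?_ ?_
  · change C 3 2 = C 0 3
    rw [per, ← v22, ← v12, r1, v11, r2, ← v10, v00]
  · change C 3 3 = C 0 2
    rw [per, r0, ← diag, r3]
  · intro i hi n hn
    change C i n = C 3 2 ∨ C i n = C 3 3
    rw [per]
    interval_cases i <;> interval_cases n <;> grind

end FourRows

/-! ### Even numbers of columns and rows -/

section Alternating

variable {s t : ℕ} {r : ZMod s} {A : Pattern s} {K : ZMod s → Prop}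

theorem blueClass_row {i a b : ℕ} (hi : i < t) (hab : a ≤ b)
    (h : ∀ k, a ≤ k → k < b → ¬A.red i (k : ZMod s))
    (ha : A.red i (a : ZMod s) ∨ A.red i ((a : ZMod s) - 1))
    (hb : A.red i (b : ZMod s) ∨ A.red i ((b : ZMod s) - 1)) :
    blueClass A t r K i a = blueClass A t r K i b :=
  component_eq_iff.2 (((Conn.of_link (GridLink.spoke i _ hi ha)).symm.trans
    (conn_span hi hab h)).trans (Conn.of_link (GridLink.spoke i _ hi hb)))

theorem blueClass_rise {i n : ℕ} (hi : i + 1 < t) (h : ¬A.blue i (n : ZMod s)) :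
    blueClass A t r K i n = blueClass A t r K (i + 1) n :=
  component_eq_iff.2 (Conn.of_link (GridLink.blue i _ hi h))

theorem val_natCast_mod_two (hs : s % 2 = 0) (n : ℕ) : (n : ZMod s).val % 2 = n % 2 := by
  rw [ZMod.val_natCast, Nat.mod_mod_of_dvd _ (Nat.dvd_of_mod_eq_zero hs)]

/-- Every second horizontal edge of both rows is deleted, so that with the shift `r` the remaining
ones alternate between the rows, and all vertical edges from row `0` to row `1`. -/
def alternating (s r : ℕ) : Pattern s where
  red i j := if i = 0 then (j.val + r) % 2 = 1 else j.val % 2 = 0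
  blue i _ := i = 0

theorem val_sub_one_mod_two (hs : s % 2 = 0) (h2 : 2 ≤ s) (j : ZMod s) :
    (j - 1).val % 2 = (j.val + 1) % 2 := by
  rw [val_sub_one h2]
  split_ifs <;> omega

theorem alternating_admissible {r : ℕ} (hs : s % 2 = 0) (h2 : 2 ≤ s) :
    (alternating s r).Admissible 2 (r : ZMod s) := by
  intro i hi j
  have h := val_sub_one_mod_two hs h2 j
  interval_cases i
  · simp only [alternating, Pattern.below, if_true]
    simp only [true_or, iff_true]
    omega
  · simp only [alternating, Pattern.below]
    simp
    omega

theorem alternating_open {r : ℕ} : (alternating s r).Open 2 := by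
  intro j
  simp [alternating]

/-- The relations in the first two rows of a pattern that agrees there with `alternating`. -/
theorem alternating_row {r : ℕ} (hs : s % 2 = 0) (h2 : 2 ≤ s) {ρ : ZMod s} (ht : 2 ≤ t)
    (hA : ∀ i < 2, ∀ j, A.red i j ↔ (alternating s r).red i j) :
    (∀ n, n % 2 = 0 → blueClass A t ρ K 0 (n + r) = blueClass A t ρ K 0 (n + 1 + r)) ∧
    ∀ n, n % 2 = 1 → blueClass A t ρ K 1 n = blueClass A t ρ K 1 (n + 1) := by
  refine ⟨fun n hn => ?_, fun n hn => ?_⟩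
  · refine blueClass_row (by omega) (by omega) (fun k h3 h4 => ?_) ?_ ?_
    · have := val_natCast_mod_two hs k
      rw [hA 0 (by omega)]
      simp only [alternating, if_true]
      omega
    · have := val_natCast_mod_two hs (n + r)
      have := val_sub_one_mod_two hs h2 ((n + r : ℕ) : ZMod s)
      simp only [hA 0 (by omega), alternating, if_true]
      omega
    · have := val_natCast_mod_two hs (n + 1 + r)
      have := val_sub_one_mod_two hs h2 ((n + 1 + r : ℕ) : ZMod s)
      simp only [hA 0 (by omega), alternating, if_true]
      omega
  · refine blueClass_row (by omega) (by omega) (fun k h3 h4 => ?_) ?_ ?_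
    · have := val_natCast_mod_two hs k
      rw [hA 1 (by omega)]
      simp only [alternating, one_ne_zero, if_false]
      omega
    · have := val_natCast_mod_two hs n
      have := val_sub_one_mod_two hs h2 (n : ZMod s)
      simp only [hA 1 (by omega), alternating, one_ne_zero, if_false]
      omega
    · have := val_natCast_mod_two hs (n + 1)
      have := val_sub_one_mod_two hs h2 ((n + 1 : ℕ) : ZMod s)
      simp only [hA 1 (by omega), alternating, one_ne_zero, if_false]
      omega

theorem exists_alternating_red {r : ℕ} (hs : s % 2 = 0) :
    ∀ i < 2, ∃ d : ZMod s, (alternating s r).red i d := by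
  intro i hi
  interval_cases i
  · refine ⟨((r + 1 : ℕ) : ZMod s), ?_⟩
    have := val_natCast_mod_two hs (r + 1)
    simp only [alternating, if_true]
    omega
  · refine ⟨((0 : ℕ) : ZMod s), ?_⟩
    have := val_natCast_mod_two hs 0
    simp only [alternating, one_ne_zero, if_false]
    omega

/-- With an even number of columns, two rows have a tour for every shift: it runs alternately through
a remaining edge of row `0` and one of row `1`. -/
theorem hasTour_two_rows {r : ℕ} (hs : s % 2 = 0) (h2 : 2 ≤ s) : HasTour (gridPerm s 2 r) := by
  have : NeZero s := ⟨by omega⟩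
  obtain ⟨hB, hT⟩ := alternating_row (A := alternating s r) (t := 2) (ρ := (r : ZMod s))
    (K := fun _ => False) hs h2 le_rfl fun _ _ _ => Iff.rfl
  set C := blueClass (alternating s r) 2 (r : ZMod s) (fun _ => False) with hC
  have diag : ∀ n, C 1 n = C 0 (n + r) := fun n => blueClass_diag alternating_open not_false
  have allT : ∀ n, C 1 n = C 1 0 := by
    intro n
    induction n with
    | zero => rfl
    | succ n ih =>
      rcases Nat.mod_two_eq_zero_or_one n with h | h
      · rw [diag, ← hB n h, ← diag, ih]
      · rw [← hT n h, ih]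
  have allB : ∀ n, C 0 n = C 1 0 := by
    intro n
    have h1 := diag (n + r * (s - 1))
    have h2 : n + r * (s - 1) + r = n + r * s := by
      obtain ⟨k, rfl⟩ : ∃ k, s = k + 1 := ⟨s - 1, by omega⟩
      simp only [Nat.add_sub_cancel]
      ring
    rw [h2, allT] at h1
    rw [h1, hC]
    simp [blueClass]
  refine hasTour_of_conn (by omega) (alternating_admissible hs h2) (1, ((0 : ℕ) : ZMod s), false)
    fun i hi j c => ?_
  obtain ⟨n, -, h⟩ := exists_component_eq_blueClass (t := 2) (r := (r : ZMod s))
    (K := fun _ => False) (exists_alternating_red hs) hi j c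
  refine component_eq_iff.1 (h.trans ?_)
  interval_cases i
  · exact allB n
  · exact allT n

/-- The seam for an even number of columns: two rows that are connected for every shift, and above
them the squares in the columns `0, 1` and `3, 4`. -/
theorem crossingSeam_alternating {r : ℕ} (hs : s % 2 = 0) (h6 : 6 ≤ s) :
    CrossingSeam ((alternating s r).extend 2 fun j => j.val = 0 ∨ j.val = 3) 4 (r : ZMod s)
      ((1 : ℕ) : ZMod s) := by
  have : NeZero s := ⟨by omega⟩
  set A := (alternating s r).extend 2 fun j => j.val = 0 ∨ j.val = 3 with hA
  have hopen : A.Open 4 := Pattern.extend_open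
  have hadm : A.Admissible 4 (r : ZMod s) := by
    refine (alternating_admissible hs (by omega)).extend (by omega) alternating_open fun j => ?_
    rw [val_sub_one (by omega)]
    split_ifs <;> omega
  obtain ⟨hB, hD⟩ := alternating_row (A := A) (t := 4) (r := r) (ρ := (r : ZMod s))
    (K := seam s 1) hs (by omega) (by omega) fun i hi j => by
      simp only [hA, Pattern.extend, if_pos hi]
  set C := blueClass A 4 (r : ZMod s) (seam s 1) with hC
  have diag : ∀ n < s, n ≠ 1 → n ≠ 2 → C 3 n = C 0 (n + r) := fun n hn h1 h2 =>
    blueClass_diag hopen (not_seam hn (by omega) h1 h2 (by omega))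
  have rise1 : ∀ n, C 1 n = C 2 n := fun n =>
    blueClass_rise (by omega) (by simp [hA, Pattern.extend, alternating])
  have rise2 : ∀ n < s, n ≠ 0 → n ≠ 1 → n ≠ 3 → n ≠ 4 → C 2 n = C 3 n := by
    intro n hn h0 h1 h3 h4
    refine blueClass_rise (by omega) ?_
    simp only [hA, Pattern.extend, val_sub_one (show 2 ≤ s by omega), ZMod.val_natCast_of_lt hn]
    split_ifs <;> omega
  have red : ∀ i, 2 ≤ i → ∀ n < s, A.red i (n : ZMod s) ↔ n = 0 ∨ n = 3 := by
    intro i hi n hn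
    simp only [hA, Pattern.extend, ZMod.val_natCast_of_lt hn, if_neg (show ¬i < 2 by omega)]
  have pred : ∀ n : ℕ, (((n + 1 : ℕ) : ZMod s) - 1) = (n : ZMod s) := by
    intro n
    push_cast
    ring
  have row13 : ∀ i, 2 ≤ i → i < 4 → C i 1 = C i 3 := by
    intro i h1 h2
    refine blueClass_row h2 (by omega) (fun k h3 h4 => ?_) (Or.inr ?_) (Or.inl ?_)
    · rw [red i h1 k (by omega)]
      omega
    · have := pred 0
      rw [Nat.zero_add] at this
      rw [this, red i h1 0 (by omega)]
      omega
    · rw [red i h1 3 (by omega)]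
      omega
  have row40 : ∀ i, 2 ≤ i → i < 4 → C i 4 = C i 0 := by
    intro i h1 h2
    have h3 : C i (0 + s) = C i 0 := blueClass_add_width i 0
    rw [← h3]
    refine blueClass_row h2 (by omega) (fun k h4 h5 => ?_) (Or.inr ?_) (Or.inl ?_)
    · rw [red i h1 k (by omega)]
      omega
    · have := pred 3
      rw [this, red i h1 3 (by omega)]
      omega
    · rw [Nat.zero_add, ZMod.natCast_self, ← Nat.cast_zero, red i h1 0 (by omega)]
      omega
  have hE : ∀ n, n % 2 = 1 → C 2 n = C 2 (n + 1) := fun n hn => by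
    rw [← rise1, ← rise1, hD n hn]
  have hlast : C 2 (s - 1) = C 2 0 := by
    have h3 : C 2 (0 + s) = C 2 0 := blueClass_add_width 2 0
    rw [hE (s - 1) (by omega), Nat.sub_add_cancel (by omega), ← h3, Nat.zero_add]
  have walk : ∀ n, 5 ≤ n → n < s → C 0 (n + r) = C 0 (5 + r) := by
    intro n hn
    induction n, hn using Nat.le_induction with
    | base => exact fun _ => rfl
    | succ n hn ih =>
      intro h1
      rw [← ih (by omega)]
      rcases Nat.mod_two_eq_zero_or_one n with h | h
      · exact (hB n h).symm
      · rw [← diag n (by omega) (by omega) (by omega),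
          ← diag (n + 1) (by omega) (by omega) (by omega),
          ← rise2 n (by omega) (by omega) (by omega) (by omega) (by omega),
          ← rise2 (n + 1) (by omega) (by omega) (by omega) (by omega) (by omega), hE n h]
  have d0 := diag 0 (by omega) (by omega) (by omega)
  have d3 := diag 3 (by omega) (by omega) (by omega)
  have d4 := diag 4 (by omega) (by omega) (by omega)
  have dl := diag (s - 1) (by omega) (by omega) (by omega)
  have b0 := hB 0 (by omega)
  have b2 := hB 2 (by omega)
  have b4 := hB 4 (by omega)
  have t13 := row13 3 (by omega) (by omega)
  have t40 := row40 3 (by omega) (by omega)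
  have u13 := row13 2 (by omega) (by omega)
  have u40 := row40 2 (by omega) (by omega)
  have e1 := hE 1 (by omega)
  have e3 := hE 3 (by omega)
  have f2 := rise2 2 (by omega) (by omega) (by omega) (by omega) (by omega)
  have fl := rise2 (s - 1) (by omega) (by omega) (by omega) (by omega) (by omega)
  have wl := walk (s - 1) (by omega) (by omega)
  norm_num at b0 b2 b4 e1 e3
  have h5 : C 0 (5 + r) = C 3 2 := by
    rw [← f2, ← e1, u13, e3, u40, ← hlast, fl, dl, wl]
  have h4 : C 0 (4 + r) = C 3 2 := by rw [b4, h5]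
  have h0 : C 0 (0 + r) = C 3 2 := by rw [← d0, ← t40, d4, h4]
  have h3 : C 0 (3 + r) = C 3 1 := by rw [← d3, t13]
  have h2 : C 0 (2 + r) = C 3 1 := by rw [b2, h3]
  have h1 : C 0 (1 + r) = C 3 2 := by
    rw [← b0, ← h0, Nat.zero_add]
  have low : ∀ n < s, C 0 (n + r) = C 3 1 ∨ C 0 (n + r) = C 3 2 := by
    intro n hn
    rcases lt_or_ge n 5 with h | h
    · interval_cases n
      · exact Or.inr h0
      · exact Or.inr h1
      · exact Or.inl h2
      · exact Or.inl h3
      · exact Or.inr h4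
    · rw [walk n h hn]
      exact Or.inr h5
  have low' : ∀ n, C 0 n = C 3 1 ∨ C 0 n = C 3 2 := by
    intro n
    have h1 := low ((n : ZMod s) - r).val (ZMod.val_lt _)
    have h2 : C 0 (((n : ZMod s) - r).val + r) = C 0 n := by
      simp [hC, blueClass]
    rwa [h2] at h1
  have high : ∀ n < s, C 3 n = C 3 1 ∨ C 3 n = C 3 2 := by
    intro n hn
    by_cases h1 : n = 1
    · exact Or.inl (by rw [h1])
    by_cases h2 : n = 2
    · exact Or.inr (by rw [h2])
    rw [diag n hn h1 h2]
    exact low n hn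
  have mid : ∀ n < s, C 2 n = C 3 1 ∨ C 2 n = C 3 2 := by
    intro n hn
    rcases lt_or_ge n 5 with h | h
    · right
      interval_cases n
      · rw [← u40, ← e3, ← u13, e1, f2]
      · rw [e1, f2]
      · exact f2
      · rw [← u13, e1, f2]
      · rw [← e3, ← u13, e1, f2]
    · rw [rise2 n hn (by omega) (by omega) (by omega) (by omega)]
      exact high n hn
  have hrow : ∀ i < 4, ∃ d : ZMod s, A.red i d := by
    intro i hi
    rcases lt_or_ge i 2 with h | h
    · obtain ⟨d, hd⟩ := exists_alternating_red (r := r) hs i h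
      exact ⟨d, by simpa only [hA, Pattern.extend, if_pos h] using hd⟩
    · exact ⟨((0 : ℕ) : ZMod s), (red i h 0 (by omega)).2 (Or.inl rfl)⟩
  have hc : ((1 : ℕ) : ZMod s) + 1 = ((2 : ℕ) : ZMod s) := by norm_num
  refine ⟨hopen, hadm, ?_, ?_, fun i hi j d => ?_⟩
  · have := component_eq_iff.1 (h2.symm)
    rw [Nat.cast_add, ← hc] at this
    exact this
  · have := component_eq_iff.1 (h1.symm)
    rw [Nat.cast_add, ← hc] at this
    exact this
  · obtain ⟨n, hn, h⟩ := exists_component_eq_blueClass (t := 4) (r := (r : ZMod s))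
      (K := seam s 1) hrow hi j d
    have h' : C i n = C 3 1 ∨ C i n = C 3 2 := by
      interval_cases i
      · exact low' n
      · rw [rise1]
        exact mid n hn
      · exact mid n hn
      · exact high n hn
    rcases h' with h' | h'
    · exact Or.inl (component_eq_iff.1 (h.trans h'))
    · have := component_eq_iff.1 (h.trans h')
      rw [← hc] at this
      exact Or.inr this

end Alternating

section FourColumns

/-- A single square. -/
def singleSquare (i c : ℕ) : Prop := i = 0 ∧ c = 0

/-- The seam for four columns, two rows and the shift `1`. -/
theorem crossingSeam_singleSquare :
    CrossingSeam (squares 4 singleSquare) 2 ((1 : ℕ) : ZMod 4) ((1 : ℕ) : ZMod 4) := by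
  have hq : DisjointSquares 4 2 singleSquare := by
    refine ⟨?_, ?_, ?_, ?_, ?_⟩ <;> unfold singleSquare <;> omega
  have hrow : ∀ i < 2, ∃ n < 4, Cut singleSquare i n := fun i hi =>
    ⟨0, by omega, by unfold Cut singleSquare; omega⟩
  set C := blueClass (squares 4 singleSquare) 2 ((1 : ℕ) : ZMod 4) (seam 4 1) with hC
  have per : C 0 4 = C 0 0 := blueClass_add_width 0 0
  have diag : ∀ n < 4, n ≠ 1 → n ≠ 2 → C 1 n = C 0 (n + 1) := fun n hn h1 h2 =>
    blueClass_diag (hq.isOpen (by omega)) (not_seam hn (by omega) h1 h2 (by omega))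
  have rise : ∀ n < 4, n ≠ 0 → n ≠ 1 → C 0 n = C 1 n := by
    intro n hn h1 h2
    apply squares_rise (by omega) hn <;> unfold singleSquare <;> omega
  have row : ∀ i < 2, C i 1 = C i 0 := by
    intro i hi
    apply squares_around hi le_rfl (by omega) <;> unfold Cut singleSquare <;> omega
  have r0 := row 0 (by omega)
  have r1 := row 1 (by omega)
  have v2 := rise 2 (by omega) (by omega) (by omega)
  have v3 := rise 3 (by omega) (by omega) (by omega)
  have d0 := diag 0 (by omega) (by omega) (by omega)
  have d3 := diag 3 (by omega) (by omega) (by omega)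
  norm_num at d0 d3
  refine crossingSeam_squares (by omega) (by omega) hq hrow (seam 4 1) rfl ?_ ?_ ?_
  · change C 1 1 = C 0 3
    rw [v3, d3, per, ← r0, ← d0, r1]
  · exact v2.symm
  · intro i hi n hn
    change C i n = C 1 1 ∨ C i n = C 1 2
    interval_cases i <;> interval_cases n <;> grind

/-- Three squares, of which two lie next to each other. -/
def threeSquares (i c : ℕ) : Prop := i = 0 ∧ (c = 0 ∨ c = 2) ∨ i = 2 ∧ c = 0

theorem hasTour_four_four : HasTour (gridPerm 4 4 0) := by
  have hq : DisjointSquares 4 4 threeSquares := by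
    refine ⟨?_, ?_, ?_, ?_, ?_⟩ <;> unfold threeSquares <;> omega
  set C := blueClass (squares 4 threeSquares) 4 ((0 : ℕ) : ZMod 4) (fun _ => False) with hC
  have diag : ∀ n, C 3 n = C 0 n := fun n =>
    blueClass_diag (hq.isOpen (by omega)) not_false
  have rise1 : ∀ n < 4, C 1 n = C 2 n := by
    intro n hn
    apply squares_rise (by omega) hn <;> unfold threeSquares <;> omega
  have rise2 : ∀ n < 4, n ≠ 0 → n ≠ 1 → C 2 n = C 3 n := by
    intro n hn h1 h2
    apply squares_rise (by omega) hn <;> unfold threeSquares <;> omega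
  have between : ∀ i < 2, C i 1 = C i 2 := by
    intro i hi
    refine squares_between (a := 0) (by omega) ?_ ?_ ?_ ?_ ?_ <;>
      (try unfold Cut threeSquares) <;> omega
  have around : ∀ i < 2, C i 3 = C i 0 := by
    intro i hi
    refine squares_around (b := 2) (by omega) ?_ ?_ ?_ ?_ ?_ ?_ <;>
      (try unfold Cut threeSquares) <;> omega
  have around' : ∀ i, 2 ≤ i → i < 4 → C i 1 = C i 0 := by
    intro i h1 h2
    refine squares_around (b := 0) (by omega) ?_ ?_ ?_ ?_ ?_ ?_ <;>
      (try unfold Cut threeSquares) <;> omega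
  have all : ∀ i < 4, ∀ n < 4, C i n = C 0 0 := by
    have a0 := between 0 (by omega)
    have a1 := between 1 (by omega)
    have b0 := around 0 (by omega)
    have b1 := around 1 (by omega)
    have c2 := around' 2 (by omega) (by omega)
    have c3 := around' 3 (by omega) (by omega)
    have d0 := diag 0
    have d1 := diag 1
    have d2 := diag 2
    have d3 := diag 3
    have e0 := rise1 0 (by omega)
    have e1 := rise1 1 (by omega)
    have e2 := rise1 2 (by omega)
    have e3 := rise1 3 (by omega)
    have f2 := rise2 2 (by omega) (by omega) (by omega)
    have f3 := rise2 3 (by omega) (by omega) (by omega)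
    intro i hi n hn
    interval_cases i <;> interval_cases n <;> grind
  refine hasTour_of_conn (by omega) (hq.admissible (by omega) (by omega))
    (0, ((0 : ℕ) : ZMod 4), false) fun i hi j c => ?_
  obtain ⟨n, hn, h⟩ := squares_reach (q := threeSquares) (t := 4) (r := ((0 : ℕ) : ZMod 4))
    (K := fun _ => False) (by omega) (fun i hi => ⟨0, by omega, by unfold Cut threeSquares; omega⟩)
    hi j c
  exact component_eq_iff.1 (h.trans (all i hi n hn))

end FourColumns

/-! ### Distinguishing the cases -/

section Cases

variable {s t r : ℕ}

theorem hasTour_even_even (hs : s % 2 = 0) (h4 : 4 ≤ s) (ht : t % 2 = 0) (h2 : 2 ≤ t)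
    (hr : r < s) : HasTour (gridPerm s t r) := by
  rcases eq_or_ne t 2 with rfl | ht2
  · exact hasTour_two_rows hs (by omega)
  have six : ∀ {s t r : ℕ}, s % 2 = 0 → 6 ≤ s → t % 2 = 0 → 4 ≤ t → HasTour (gridPerm s t r) := by
    intro s t r hs h6 ht h4
    have := (crossingSeam_alternating (r := r) hs h6).hasTour (by omega) (by omega) ((t - 4) / 2)
    rwa [show 4 + 2 * ((t - 4) / 2) = t by omega] at this
  rcases le_or_gt 6 s with h6 | h6
  · exact six hs h6 ht (by omega)
  obtain rfl : s = 4 := by omega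
  have one : HasTour (gridPerm 4 t 1) := by
    have := crossingSeam_singleSquare.hasTour (by omega) (by omega) ((t - 2) / 2)
    rwa [show 2 + 2 * ((t - 2) / 2) = t by omega] at this
  interval_cases r
  · rcases eq_or_ne t 4 with rfl | ht4
    · exact hasTour_four_four
    · refine hasTour_transpose (s' := t) (t' := 4) (r' := 0) (by omega) (by omega) (by omega)
        (by omega) (by ring) ?_ ?_ (six ht (by omega) rfl le_rfl)
      · rw [gridPerm_false_pow_height, pow_zero]
      · rw [gridPerm_true_pow_width, pow_zero]
  · exact one
  -- exchanging the colours leads to two rows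
  · refine hasTour_transpose (s' := 2 * t) (t' := 2) (r' := t) (by omega) (by omega) (by omega)
      (by omega) (by ring) ?_ ?_ (hasTour_two_rows (by omega) (by omega))
    · rw [mul_comm, pow_mul, gridPerm_false_pow_height, ← pow_mul]
      exact gridPerm_true_pow_width
    · rw [gridPerm_false_pow_height]
  · exact hasTour_mirror (by decide) one

theorem hasTour_odd_even (hs : s % 2 = 1) (h3 : 3 ≤ s) (ht : t % 2 = 0) (h2 : 2 ≤ t)
    (hr : r < s) (hne : ¬(t = 2 ∧ r = 0)) : HasTour (gridPerm s t r) := by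
  have even : ∀ r, 0 < r → r < s → r % 2 = 0 → HasTour (gridPerm s t r) := by
    intro r h0 hr hr2
    have := (crossingSeam_rowSquares hs hr2 h0 hr).hasTour h3 (by omega) ((t - 2) / 2)
    rwa [show 2 + 2 * ((t - 2) / 2) = t by omega] at this
  rcases Nat.eq_zero_or_pos r with rfl | h0
  · have h4 : t = 4 + 2 * ((t - 4) / 2) := by omega
    rw [h4]
    rcases eq_or_ne s 3 with rfl | hs3
    · exact crossingSeam_zigzagSquares_three.hasTour le_rfl (by omega) _
    · exact (crossingSeam_zigzagSquares hs (by omega)).hasTour h3 (by omega) _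
  rcases Nat.mod_two_eq_zero_or_one r with h | h
  · exact even r h0 hr h
  · refine hasTour_mirror ?_ (even (s - r) (by omega) (by omega) (by omega))
    rw [Nat.sub_add_cancel hr.le, ZMod.natCast_self]

theorem coprime_of_mul_eq_succ {n m k : ℕ} (h : k * n = m + 1) : n.Coprime m := by
  have h1 : n.gcd m ∣ m + 1 := h ▸ (Nat.gcd_dvd_left n m).mul_left k
  exact Nat.dvd_one.1 ((Nat.dvd_add_right (Nat.gcd_dvd_right n m)).1 h1)

theorem hasTour_odd_odd (hs : s % 2 = 1) (h3 : 3 ≤ s) (ht : t % 2 = 1) (h3' : 3 ≤ t)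
    (hr : r < s) : HasTour (gridPerm s t r) := by
  have coprime : ∀ n, 3 ≤ n → Nat.Coprime n (n - 1) := fun n hn =>
    coprime_of_mul_eq_succ (k := 1) (by omega)
  have even : ∀ r, r < s → r % 2 = 0 → HasTour (gridPerm s t r) := by
    intro r hr hr2
    rcases Nat.eq_zero_or_pos r with rfl | h0
    · rcases le_or_gt s t with hst | hst
      · exact hasTour_of_coprime (c := s) h3 (by omega) hst (by omega) (by simp) (coprime s h3)
      · refine hasTour_transpose (s' := t) (t' := s) (r' := 0) (by omega) (by omega) (by omega)
          (by omega) (by ring) ?_ ?_ (hasTour_of_coprime (c := t) h3' (by omega) hst.le (by omega)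
            (by simp) (coprime t h3'))
        · rw [gridPerm_false_pow_height, pow_zero]
        · rw [gridPerm_true_pow_width, pow_zero]
    have h1 : t = 3 + 2 * ((t - 3) / 2) := by omega
    rcases eq_or_ne r (s - 1) with h5 | h5
    · refine hasTour_of_coprime (c := 1) h3 (by omega) (by omega) (by omega) ?_
        (Nat.coprime_one_left _)
      rw [h5, Nat.add_sub_cancel' (by omega), ZMod.natCast_self]
    rcases eq_or_ne r 2 with rfl | h6
    · rcases eq_or_ne s 5 with rfl | h7
      · exact hasTour_of_coprime (c := 3) h3 (by omega) h3' (by omega) (by decide) (by decide)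
      · rw [h1]
        exact (crossingSeam_twoRowSquares_two (Or.inl ⟨rfl, rfl⟩) hs (by omega)).hasTour h3
          (by omega) _
    · rw [h1]
      exact (crossingSeam_twoRowSquares (Or.inl ⟨rfl, rfl⟩) hs hr2 (by omega) (by omega)).hasTour h3
        (by omega) _
  rcases Nat.mod_two_eq_zero_or_one r with h | h
  · exact even r hr h
  · refine hasTour_mirror ?_ (even (s - r) (by omega) (by omega))
    rw [Nat.sub_add_cancel hr.le, ZMod.natCast_self]

theorem hasTour_even_odd_of_odd (hs : s % 2 = 0) (h3 : 3 ≤ s) (ht : t % 2 = 1) (h3' : 3 ≤ t)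
    (hr : r < s) (hr2 : r % 2 = 1) : HasTour (gridPerm s t r) := by
  have h1 : t = 3 + 2 * ((t - 3) / 2) := by omega
  have mirror : ∀ r < s, HasTour (gridPerm s t (s - r)) → HasTour (gridPerm s t r) := by
    intro r hr h
    refine hasTour_mirror ?_ h
    rw [Nat.sub_add_cancel hr.le, ZMod.natCast_self]
  have coprime : ∀ n, 3 ≤ n → Nat.Coprime n (2 * n - 1) := fun n hn =>
    coprime_of_mul_eq_succ (k := 2) (by omega)
  have half : ∀ r, 2 * r ≤ s → r % 2 = 1 → HasTour (gridPerm s t r) := by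
    intro r hrs hr2
    rcases eq_or_ne r 1 with rfl | hr1
    · refine mirror 1 (by omega) (hasTour_of_coprime (c := 1) h3 (by omega) (by omega) (by omega) ?_
        (Nat.coprime_one_left _))
      rw [Nat.add_sub_cancel' (by omega), ZMod.natCast_self]
    rcases eq_or_ne (2 * r) s with rfl | h2
    · rcases le_or_gt r t with hrt | hrt
      · exact hasTour_of_coprime (c := r) h3 (by omega) hrt (by omega)
          (by rw [← two_mul, ZMod.natCast_self]) (coprime r (by omega))
      · refine hasTour_transpose (s' := 2 * t) (t' := r) (r' := t) (by omega) (by omega) (by omega)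
          (by omega) (by ring) ?_ ?_ (hasTour_of_coprime (c := t) (by omega) (by omega) hrt.le
            (by omega) (by rw [← two_mul, ZMod.natCast_self]) (coprime t h3'))
        · rw [mul_comm 2 t, pow_mul, gridPerm_false_pow_height, ← pow_mul, mul_comm r 2]
          exact gridPerm_true_pow_width
        · rw [gridPerm_false_pow_height]
    refine mirror r (by omega) ?_
    rcases eq_or_ne (2 * r + 2) s with h4 | h4
    · rcases eq_or_ne r 3 with rfl | h5
      · obtain rfl : s = 8 := by omega
        exact hasTour_of_coprime (c := 3) h3 (by omega) h3' (by omega) (by decide) (by decide)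
      -- the columns from `s - r = r + 2` on are free, and the shift by `s - r` becomes one by `2`
      · rw [h1]
        exact (crossingSeam_twoRowSquares_two (m := s - r) (Or.inr (by omega)) (by omega)
          (by omega)).hasTour h3 (by omega) _
    -- the columns from `s - r` on are free, and the shift by `s - r` becomes one by `s - 2 * r`
    · rw [h1]
      exact (crossingSeam_twoRowSquares (m := s - r) (ρ := s - 2 * r) (Or.inr (by omega)) (by omega)
        (by omega) (by omega) (by omega)).hasTour h3 (by omega) _
  rcases le_or_gt (2 * r) s with h | h
  · exact half r h hr2
  · exact mirror r hr (half (s - r) (by omega) (by omega))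

/-- With an even number of columns and an even shift, exchanging the colours leads to an even number
of rows. -/
theorem hasTour_even_odd_of_even (hs : s % 2 = 0) (h3 : 3 ≤ s) (ht : t % 2 = 1) (h3' : 3 ≤ t)
    (hr2 : r % 2 = 0) : HasTour (gridPerm s t r) := by
  have hg2 : 2 ∣ s.gcd r := Nat.dvd_gcd (Nat.dvd_of_mod_eq_zero hs) (Nat.dvd_of_mod_eq_zero hr2)
  obtain ⟨k, hk⟩ := Nat.gcd_dvd_left s r
  obtain ⟨l, hl⟩ := Nat.gcd_dvd_right s r
  have hg0 : 0 < s.gcd r := Nat.gcd_pos_of_pos_left r (by omega)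
  have hk0 : 0 < k := by
    rcases Nat.eq_zero_or_pos k with rfl | h
    · omega
    · exact h
  -- `x` turns around the blue cycles are as good as `gcd(s, r)` red steps
  obtain ⟨x, hx⟩ : ∃ x : ℕ, r * x ≡ s.gcd r [MOD s] := by
    rcases (Nat.le_of_dvd (by omega) (Nat.gcd_dvd_left s r)).eq_or_lt with h | h
    · exact ⟨0, by rw [h, mul_zero]; exact (Nat.mod_self s).symm ▸ Nat.zero_mod s⟩
    · obtain ⟨x, -, hx⟩ := Nat.exists_mul_mod_eq_gcd (n := r) (k := s) (by rwa [Nat.gcd_comm])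
      exact ⟨x, by rw [Nat.ModEq, hx, Nat.gcd_comm, Nat.mod_eq_of_lt h]⟩
  have hU : gridPerm s t r false ^ (t * k) = 1 := by
    rw [pow_mul, gridPerm_false_pow_height, ← pow_mul]
    have : r * k = s * l := by
      calc r * k = s.gcd r * l * k := by rw [← hl]
        _ = s.gcd r * k * l := by ring
        _ = s * l := by rw [← hk]
    rw [this, pow_mul, gridPerm_true_pow_width, one_pow]
  have hR : gridPerm s t r true ^ s.gcd r = gridPerm s t r false ^ (t * x % (t * k)) := by
    rw [← pow_eq_pow_mod _ hU, pow_mul, gridPerm_false_pow_height, ← pow_mul,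
      pow_eq_pow_mod (r * x) (gridPerm_true_pow_width (s := s) (t := t) (r := r)),
      pow_eq_pow_mod (s.gcd r) (gridPerm_true_pow_width (s := s) (t := t) (r := r)), hx]
  have htk : 3 ≤ t * k := by nlinarith
  have hcard : t * k * s.gcd r = s * t := by
    calc t * k * s.gcd r = s.gcd r * k * t := by ring
      _ = s * t := by rw [← hk]
  refine hasTour_transpose (by omega) (by omega) (by omega) hg0 hcard hU hR ?_
  have hlt : t * x % (t * k) < t * k := Nat.mod_lt _ (by omega)
  have hg : s.gcd r % 2 = 0 := Nat.mod_eq_zero_of_dvd hg2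
  rcases Nat.mod_two_eq_zero_or_one (t * k) with h | h
  · exact hasTour_even_even h (by omega) hg (by omega) hlt
  · refine hasTour_odd_even h htk hg (by omega) hlt ?_
    -- otherwise two red steps would lead back to the start
    rintro ⟨h5, h6⟩
    rw [h5, h6, pow_zero] at hR
    have h7 := congrArg (fun f : Equiv.Perm (XVertex s t) => (f (⟨0, by omega⟩, 0)).2) hR
    simp only [gridPerm_true_pow, Equiv.Perm.one_apply, zero_add] at h7
    rw [ZMod.natCast_eq_zero_iff] at h7
    exact absurd (Nat.le_of_dvd (by omega) h7) (by omega)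

theorem hasTour_gridPerm (hs : 3 ≤ s) (ht : 2 ≤ t) (hr : r < s) (h : ¬(Odd s ∧ t = 2 ∧ r = 0)) :
    HasTour (gridPerm s t r) := by
  rw [Nat.odd_iff] at h
  rcases Nat.mod_two_eq_zero_or_one s with h1 | h1 <;>
    rcases Nat.mod_two_eq_zero_or_one t with h2 | h2
  · exact hasTour_even_even h1 (by omega) h2 ht hr
  · rcases Nat.mod_two_eq_zero_or_one r with h3 | h3
    · exact hasTour_even_odd_of_even h1 hs h2 (by omega) h3
    · exact hasTour_even_odd_of_odd h1 hs h2 (by omega) hr h3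
  · exact hasTour_odd_even h1 hs h2 ht hr fun h3 => h ⟨h1, h3⟩
  · exact hasTour_odd_odd h1 hs h2 (by omega) hr

end Cases

end QuarticTours

theorem mainTheorem11 (s t r : ℕ) (hs : 3 ≤ s) (ht : 2 ≤ t) (hr : r ≤ s - 1) :
    (∃ W : Graph (QuarticTours.XVertex s t) (QuarticTours.XEdge s t),
      QuarticTours.IsGoodEulerianSubgraph (QuarticTours.horizontal s t)
        (QuarticTours.X s t r) W) ↔
    ¬ (Odd s ∧ t = 2 ∧ r = 0) := by
  refine ⟨?_, fun h => QuarticTours.exists_isGoodEulerianSubgraph (by omega) ht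
    (QuarticTours.hasTour_gridPerm hs ht (by omega) h)⟩
  rintro ⟨W, hW⟩ ⟨hodd, rfl, rfl⟩
  exact QuarticTours.not_isGoodEulerianSubgraph_two_zero hs hodd W hW
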